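/- Let $(\mathcal C,\mathbb E,\mathfrak s)$ be a small extriangulated category, with higher extension groups $\{\mathbb E^{k}\}_{k\ge 1}$, $\mathbb E^1=\mathbb E$: either the standard ones, $\mathbb E^{k+1}(D,A)=\int^{B}\mathbb E^{k}(B,A)\otimes\mathbb E(D,B)$, or any family of bifunctors $\mathbb E^k:\mathcal C^{op}\times\mathcal C\to\mathrm{Ab}$, additive in each variable, with connecting transformations that give exact sequences $\mathbb E^k(C,-)\to\mathbb E^k(B,-)\to\mathbb E^k(A,-)\to\mathbb E^{k+1}(C,-)$ and $\mathbb E^k(-,A)\to\mathbb E^k(-,B)\to\mathbb E^k(-,C)\to\mathbb E^{k+1}(-,A)$ for each $\mathbb E$-triangle $A\to B\to C\dashrightarrow$, are compatible with morphisms of $\mathbb E$-triangles, and such that $\mathbb E^k(f,-)=0$ whenever $\mathbb E(f,-)=0$ and $\mathbb E^k(-,g)=0$ whenever $\mathbb E(-,g)=0$. Let $n\ge 0$. Notation. For a class $\mathcal Y$ of objects (full subcategory), $\mathrm{free}(\mathcal Y)$ is the class of all finite (possibly empty) coproducts and $\mathrm{smd}(\mathcal Y)$ the class of all direct summands of objects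 of $\mathcal Y$. $\mathcal X^\vee_m$ is the class of the objects of $\mathcal X$-coresolution dimension at most $m$, that is, of those $A$ with, for some $k\le m$, a sequence of conflations $K_i\to Y_i\to K_{i+1}$ $(0\le i<k)$, $K_0=A$, $Y_i\in\mathcal X$, $K_k$ isomorphic to an object of $\mathcal X$. A morphism $f$ is $\mathbb E$-projective if $\mathbb E(f,-)=0$; $\mathcal P_{\mathbb E}(\mathcal C)$ is the class of $\mathbb E$-projective objects; $\Omega(\mathcal X)$ is the class of the objects $A$ with a conflation $A\to P\to X$, $P\in\mathcal P_{\mathbb E}(\mathcal C)$, $X\in\mathcal X$. A class $\mathcal Y$ has enough deflations (enough $\mathbb E$-projective morphisms) from $\mathcal X$ if every $C\in\mathcal Y$ has a deflation (an $\mathbb E$-projective deflation) $X\to C$ with $X\in\mathcal X$. $[\mathcal X]$ is the ideal of the morphisms that factor through objects of $\mathcal X$. $\underline{\mathcal X^\vee_n}$ is the quotient of $\mathcal X^\vee_n$ by the ideal of $\mathbb E$-projective morphisms. For a small preadditive category $\mathcal Z$, $\mathsf{Mod}\,\mathcal Z$ is the category of additive functors $\mathcal Z^{op}\to\mathrm{Ab}$,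 and $\mathrm{fp}\,\mathcal Z$ is its full subcategory of cokernels of morphisms between finite coproducts of representables. $\mathcal R^n_{\mathcal X}\subseteq\mathsf{Mod}\,\underline{\mathcal X^\vee_n}$ is the full subcategory of the $G$ with an exact sequence $\underline{\mathcal X^\vee_n}(-,X_0)\to\underline{\mathcal X^\vee_n}(-,X_1)\to G\to0$, $X_0\in\mathcal X$, $X_1\in\mathcal X^\vee_n$. $\mathrm{Proj}$ denotes the class of objects that are projective with respect to all epimorphisms. A category is Krull–Schmidt if each object is a finite coproduct of objects with local endomorphism ring. Theorem. Let $\mathcal X=\mathrm{free}(\mathcal X)$ be $(n+2)$-rigid, that is, $\mathbb E^{k}(\mathcal X,\mathcal X)=0$ for $1\le k\le n+1$, and suppose that $\mathcal X^\vee_n$ has enough $\mathbb E$-projective morphisms from $\mathcal X$. Put $\mathcal D=\mathcal X^\vee_{n+1}/[\mathcal X]$. The functor $M\mapsto\mathbb E(-,M)|_{\mathcal X^\vee_n}$ from $\mathcal X_{n+1}^\vee$ to $\mathsf{Mod}\,\underline{\mathcal X^\vee_n}$ factors (uniquely) through a functor $\mathbb F:\mathcal D\to\mathsf{Mod}\,\underline{\mathcal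 X^\vee_n}$. Let $\varepsilon_{\mathbb F}$ be the class of the pairs $A'\to A\to A''$ in $\mathcal D$ for which $0\to\mathbb F(A')\to\mathbb F(A)\to\mathbb F(A'')\to0$ is exact. (a) $\mathbb F$ takes values in $\mathcal R^n_{\mathcal X}$; $\mathcal R^n_{\mathcal X}$ is additive and closed under extensions in $\mathsf{Mod}\,\underline{\mathcal X^\vee_n}$, and is an exact category with the short exact sequences with terms in it; $(\mathcal D,\varepsilon_{\mathbb F})$ is an exact category, and $\mathbb F:\mathcal D\to\mathcal R^n_{\mathcal X}$ is an equivalence of exact categories. If moreover $\mathcal X=\mathrm{smd}(\mathcal X)$, then: (a1) $\mathcal D$ is weakly idempotent complete if $\mathcal X^\vee_{n+1}$ has enough deflations from $\mathcal X$; (a2) $\mathcal D$ is Krull–Schmidt if $\mathcal C$ is. (b) Suppose that $\mathcal X^\vee_n=\mathcal X$ and that $\mathcal X$ is precovering in $\mathcal X^\vee_{n+1}$. (b1) $\mathcal D$ is abelian, and $\varepsilon_{\mathbb F}$ is the class of all its short exact sequences; $\mathrm{fp}\,\underline{\mathcal X}$ is abelian, its short exact sequences being those of $\mathsf{Mod}\,\underline{\mathcal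 X}$ with terms in it; and $\mathbb F:\mathcal D\to\mathrm{fp}\,\underline{\mathcal X}$ is an equivalence of abelian categories. (b2) If $\mathcal C$ has enough $\mathbb E$-projectives and $\mathcal P_{\mathbb E}(\mathcal C)\subseteq\mathcal X$, then $\Omega(\mathcal X)\subseteq\mathcal X^\vee_{n+1}$ and $\mathrm{Proj}(\mathcal D)=\mathrm{smd}(\Omega(\mathcal X)/[\mathcal X])$, direct summands being taken in $\mathcal D$. If in addition $\mathcal C$ is Krull–Schmidt and $\mathcal X=\mathrm{smd}(\mathcal X)$, then $\mathrm{Proj}(\mathcal D)=\Omega(\mathcal X)/[\mathcal X]$ up to isomorphism: an object of $\mathcal D$ is projective if and only if it is isomorphic in $\mathcal D$ to an object of $\Omega(\mathcal X)$. -/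

import Mathlib

open CategoryTheory CategoryTheory.Limits Opposite

universe u

namespace Extri

/-! ## Classes of objects in a category -/

section Generic

universe v w

variable {D : Type w} [Category.{v} D]

/-- `free P`: the class of all finite (possibly empty) coproducts of objects of `P`. -/
def free (P : ObjectProperty D) : ObjectProperty D := fun A =>
  ∃ (m : ℕ) (Y : Fin m → D) (j : ∀ i, Y i ⟶ A),
    (∀ i, P (Y i)) ∧ Nonempty (IsColimit (Cofan.mk A j))

/-- `smd P`: the class of all direct summands of objects of `P`, that is, of all `A` for which
some `M` in `P` is a coproduct of `A` and another object. -/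
def smd (P : ObjectProperty D) : ObjectProperty D := fun A =>
  ∃ (A' M : D) (i : A ⟶ M) (j : A' ⟶ M), P M ∧ Nonempty (IsColimit (BinaryCofan.mk i j))

/-- The condition `P = free P`. -/
class IsFree (P : ObjectProperty D) : Prop where
  free_eq : free P = P

/-- `P` is a precovering class (contravariantly finite) in `Q`. -/
def IsPrecoveringIn (P Q : ObjectProperty D) : Prop :=
  ∀ M : D, Q M → ∃ (W : D) (f : W ⟶ M), P W ∧
    ∀ (W' : D) (g : W' ⟶ M), P W' → ∃ h : W' ⟶ W, h ≫ f = g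

/-- Weak idempotent completeness: every split epimorphism has a kernel. -/
def IsWeaklyIdempotentComplete (D : Type w) [Category.{v} D] [Preadditive D] : Prop :=
  ∀ ⦃A B : D⦄ (f : A ⟶ B), IsSplitEpi f → HasKernel f

/-- Every object is a finite coproduct of objects with local endomorphism ring. -/
def IsKrullSchmidt (D : Type w) [Category.{v} D] [Preadditive D] : Prop :=
  ∀ A : D, free (fun Y : D => IsLocalRing (End Y)) A

/-- A class of pairs of composable morphisms. -/
abbrev PairClass (D : Type w) [Category.{v} D] : Type max v w :=
  ∀ ⦃A B C : D⦄, (A ⟶ B) → (B ⟶ C) → Prop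

/-- `i` is a kernel of `p` and `p` is a cokernel of `i`. -/
def IsKernelCokernelPair [Preadditive D] : PairClass D := fun _ _ _ i p =>
  ∃ w : i ≫ p = 0, Nonempty (IsLimit (KernelFork.ofι i w)) ∧
    Nonempty (IsColimit (CokernelCofork.ofπ p w))

/-- `0 → A → B → C → 0` is a short exact sequence in the (abelian) category `D`. -/
def IsShortExactPair [Preadditive D] : PairClass D := fun _ _ _ i p =>
  ∃ w : i ≫ p = 0, (ShortComplex.mk i p w).ShortExact

/-- The admissible monomorphisms of a class of pairs. -/
def AdmissibleMono (ε : PairClass D) {A B : D} (i : A ⟶ B) : Prop :=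
  ∃ (C : D) (p : B ⟶ C), ε i p

/-- The admissible epimorphisms of a class of pairs. -/
def AdmissibleEpi (ε : PairClass D) {B C : D} (p : B ⟶ C) : Prop :=
  ∃ (A : D) (i : A ⟶ B), ε i p

/-- `(D, ε)` is an exact category in the sense of Quillen. -/
structure IsExactCategory [Preadditive D] (ε : PairClass D) : Prop where
  additive : HasFiniteBiproducts D
  kernel_cokernel : ∀ ⦃A B C : D⦄ (i : A ⟶ B) (p : B ⟶ C), ε i p → IsKernelCokernelPair i p
  iso_closed : ∀ ⦃A B C A' B' C' : D⦄ (i : A ⟶ B) (p : B ⟶ C) (i' : A' ⟶ B') (p' : B' ⟶ C')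
    (a : A ≅ A') (b : B ≅ B') (c : C ≅ C'), i ≫ b.hom = a.hom ≫ i' → p ≫ c.hom = b.hom ≫ p' →
    ε i p → ε i' p'
  id_mono : ∀ A : D, AdmissibleMono ε (𝟙 A)
  id_epi : ∀ A : D, AdmissibleEpi ε (𝟙 A)
  comp_mono : ∀ ⦃A B C : D⦄ (i : A ⟶ B) (j : B ⟶ C), AdmissibleMono ε i → AdmissibleMono ε j →
    AdmissibleMono ε (i ≫ j)
  comp_epi : ∀ ⦃A B C : D⦄ (p : A ⟶ B) (q : B ⟶ C), AdmissibleEpi ε p → AdmissibleEpi ε q →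
    AdmissibleEpi ε (p ≫ q)
  pushout : ∀ ⦃A B A' : D⦄ (i : A ⟶ B) (f : A ⟶ A'), AdmissibleMono ε i →
    ∃ (B' : D) (f' : B ⟶ B') (i' : A' ⟶ B'), IsPushout i f f' i' ∧ AdmissibleMono ε i'
  pullback : ∀ ⦃B C C' : D⦄ (p : B ⟶ C) (f : C' ⟶ C), AdmissibleEpi ε p →
    ∃ (B' : D) (f' : B' ⟶ B) (p' : B' ⟶ C'), IsPullback f' p' p f ∧ AdmissibleEpi ε p'

/-- An equivalence of exact categories: an additive equivalence which preserves and reflects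
the distinguished pairs (equivalently, it and its quasi-inverse are exact). -/
structure IsExactEquivalence {D' : Type*} [Category* D'] [Preadditive D] [Preadditive D']
    (ε : PairClass D) (ε' : PairClass D') (G : D ⥤ D') : Prop where
  additive : G.Additive
  isEquivalence : G.IsEquivalence
  exact_iff : ∀ ⦃A B C : D⦄ (i : A ⟶ B) (p : B ⟶ C), ε i p ↔ ε' (G.map i) (G.map p)

/-- The preadditive category `D` is abelian. -/
def IsAbelianCategory (D : Type w) [Category.{v} D] [inst : Preadditive D] : Prop :=
  ∃ a : Abelian D, a.toPreadditive = inst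

lemma IsFree.of_isColimit {P : ObjectProperty D} [hP : IsFree P] {m : ℕ} {Y : Fin m → D} {A : D}
    (j : ∀ i, Y i ⟶ A) (hY : ∀ i, P (Y i)) (h : IsColimit (Cofan.mk A j)) : P A := by
  rw [← hP.free_eq]
  exact ⟨m, Y, j, hY, ⟨h⟩⟩

lemma IsFree.biprod {P : ObjectProperty D} [Preadditive D] [HasBinaryBiproducts D]
    [hP : IsFree P] {A B : D} (hA : P A) (hB : P B) : P (A ⊞ B) := by
  let Y : Fin 2 → D := ![A, B]
  let j : ∀ i, Y i ⟶ A ⊞ B := fun i =>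
    match i with
    | 0 => (biprod.inl : A ⟶ A ⊞ B)
    | 1 => (biprod.inr : B ⟶ A ⊞ B)
  refine IsFree.of_isColimit (m := 2) (Y := Y) j ?_ ?_
  · intro i
    fin_cases i
    · exact hA
    · exact hB
  · refine Cofan.IsColimit.mk _ (fun s => biprod.desc (s.inj 0) (s.inj 1)) ?_ ?_
    · intro s i
      fin_cases i
      · exact biprod.inl_desc _ _
      · exact biprod.inr_desc _ _
    · intro s f hf
      apply biprod.hom_ext'
      · exact (hf 0).trans (biprod.inl_desc _ _).symm
      · exact (hf 1).trans (biprod.inr_desc _ _).symm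

open ZeroObject in
lemma IsFree.zero {P : ObjectProperty D} [Preadditive D] [HasZeroObject D]
    [hP : IsFree P] : P (0 : D) := by
  refine IsFree.of_isColimit (m := 0) (Y := fun _ => (0 : D)) (fun i => i.elim0)
    (fun i => i.elim0) ?_
  refine Cofan.IsColimit.mk _ (fun s => 0) (fun s i => i.elim0) (fun s f _ => ?_)
  exact (isZero_zero D).eq_of_src _ _

end Generic

/-! ## Modules over a small preadditive category -/

section Modules

variable (Z : Type u) [SmallCategory Z] [Preadditive Z]

/-- Right `Z`-modules: additive contravariant functors from `Z` to abelian groups. -/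
abbrev RightMod : Type (u + 1) := Zᵒᵖ ⥤+ AddCommGrpCat.{u}

variable {Z}

/-- The representable right module `Z(-, A)`. -/
noncomputable abbrev rep (A : Z) : RightMod Z :=
  AdditiveFunctor.of (preadditiveYoneda.obj A)

/-- Exactness of `L → M → N → 0`, checked at every object. -/
def RightExactPair : PairClass (RightMod Z) := fun _ _ _ f g =>
  ∀ z : Zᵒᵖ, Function.Exact (f.hom.app z).hom (g.hom.app z).hom ∧
    Function.Surjective (g.hom.app z).hom

/-- Exactness of `0 → L → M → N → 0`, checked at every object. -/
def ModShortExact : PairClass (RightMod Z) := fun _ _ _ f g =>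
  ∀ z : Zᵒᵖ, Function.Injective (f.hom.app z).hom ∧
    Function.Exact (f.hom.app z).hom (g.hom.app z).hom ∧
    Function.Surjective (g.hom.app z).hom

/-- `fp Z`: cokernels of morphisms between finite coproducts of representable modules. -/
def fp : ObjectProperty (RightMod Z) := fun G =>
  ∃ (P Q : RightMod Z) (f : P ⟶ Q) (g : Q ⟶ G),
    free (fun R => ∃ A : Z, Nonempty (R ≅ rep A)) P ∧
    free (fun R => ∃ A : Z, Nonempty (R ≅ rep A)) Q ∧ RightExactPair f g

/-- A class of modules closed under extensions. -/
def ClosedUnderExtensions (P : ObjectProperty (RightMod Z)) : Prop :=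
  ∀ ⦃L M N : RightMod Z⦄ (f : L ⟶ M) (g : M ⟶ N), ModShortExact f g → P L → P N → P M

/-- The short exact sequences of modules with all terms in `P`. -/
def inducedPairs (P : ObjectProperty (RightMod Z)) : PairClass P.FullSubcategory :=
  fun _ _ _ i p => ModShortExact i.hom p.hom

/-- The class `ε_F` of the pairs which `F` sends to short exact sequences. -/
def epsilon {D : Type*} [Category* D] (F : D ⥤ RightMod Z) : PairClass D :=
  fun _ _ _ i p => ModShortExact (F.map i) (F.map p)

end Modules

/-! ## Bifunctors -/

section Bifunctors

variable {C : Type u} [SmallCategory C]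

/-- The group `E(D, A)`. -/
abbrev Grp (E : Cᵒᵖ ⥤ C ⥤ AddCommGrpCat.{u}) (D A : C) : Type u :=
  ((E.obj (op D)).obj A : AddCommGrpCat.{u})

/-- `push E a δ` is `a · δ`. -/
abbrev push (E : Cᵒᵖ ⥤ C ⥤ AddCommGrpCat.{u}) {D A A' : C} (a : A ⟶ A') :
    Grp E D A →+ Grp E D A' :=
  ((E.obj (op D)).map a).hom

/-- `pull E c δ` is `δ · c`. -/
abbrev pull (E : Cᵒᵖ ⥤ C ⥤ AddCommGrpCat.{u}) {D D' A : C} (c : D' ⟶ D) :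
    Grp E D A →+ Grp E D' A :=
  ((E.map c.op).app A).hom

lemma push_id (E : Cᵒᵖ ⥤ C ⥤ AddCommGrpCat.{u}) {D A : C} (δ : Grp E D A) :
    push E (𝟙 A) δ = δ := by simp [push]

lemma pull_id (E : Cᵒᵖ ⥤ C ⥤ AddCommGrpCat.{u}) {D A : C} (δ : Grp E D A) :
    pull E (𝟙 D) δ = δ := by simp [pull]

lemma push_comp (E : Cᵒᵖ ⥤ C ⥤ AddCommGrpCat.{u}) {D A A' A'' : C} (a : A ⟶ A') (a' : A' ⟶ A'')
    (δ : Grp E D A) : push E (a ≫ a') δ = push E a' (push E a δ) := by simp [push]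

lemma pull_comp (E : Cᵒᵖ ⥤ C ⥤ AddCommGrpCat.{u}) {D D' D'' A : C} (c : D' ⟶ D) (c' : D'' ⟶ D')
    (δ : Grp E D A) : pull E (c' ≫ c) δ = pull E c' (pull E c δ) := by simp [pull]

lemma push_pull (E : Cᵒᵖ ⥤ C ⥤ AddCommGrpCat.{u}) {D D' A A' : C} (a : A ⟶ A') (c : D' ⟶ D)
    (δ : Grp E D A) : push E a (pull E c δ) = pull E c (push E a δ) := by
  have := (E.map c.op).naturality a
  exact (DFunLike.congr_fun (congrArg AddCommGrpCat.Hom.hom this) δ).symm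

/-- The defining relations of the tensor product over `C` of the bifunctors `F` and `G`: a
generator `⟨B, η, δ⟩` stands for `η ⊗ δ` with `η ∈ F(B, A)` and `δ ∈ G(D, B)`. -/
inductive TensorRel (F G : Cᵒᵖ ⥤ C ⥤ AddCommGrpCat.{u}) (D A : C) :
    FreeAbelianGroup (Σ B : C, Grp F B A × Grp G D B) → Prop
  | add_left (B : C) (η η' : Grp F B A) (δ : Grp G D B) :
      TensorRel F G D A (FreeAbelianGroup.of ⟨B, (η + η', δ)⟩
        - (FreeAbelianGroup.of ⟨B, (η, δ)⟩ + FreeAbelianGroup.of ⟨B, (η', δ)⟩))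
  | add_right (B : C) (η : Grp F B A) (δ δ' : Grp G D B) :
      TensorRel F G D A (FreeAbelianGroup.of ⟨B, (η, δ + δ')⟩
        - (FreeAbelianGroup.of ⟨B, (η, δ)⟩ + FreeAbelianGroup.of ⟨B, (η, δ')⟩))
  | balanced (B B' : C) (f : B ⟶ B') (η : Grp F B' A) (δ : Grp G D B) :
      TensorRel F G D A (FreeAbelianGroup.of ⟨B, (pull F f η, δ)⟩
        - FreeAbelianGroup.of ⟨B', (η, push G f δ)⟩)

/-- The group `∫^B F(B, A) ⊗ G(D, B)`. -/
abbrev TensorGrp (F G : Cᵒᵖ ⥤ C ⥤ AddCommGrpCat.{u}) (D A : C) : Type u :=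
  FreeAbelianGroup (Σ B : C, Grp F B A × Grp G D B) ⧸
    AddSubgroup.closure {z | TensorRel F G D A z}

/-- The effect of `η ⊗ δ ↦ (a · η) ⊗ (δ · c)` on generators. -/
def tensorGen (F G : Cᵒᵖ ⥤ C ⥤ AddCommGrpCat.{u}) {D D' A A' : C} (c : D' ⟶ D) (a : A ⟶ A') :
    (Σ B : C, Grp F B A × Grp G D B) → (Σ B : C, Grp F B A' × Grp G D' B) :=
  fun t => ⟨t.1, (push F a t.2.1, pull G c t.2.2)⟩

/-- The homomorphism `η ⊗ δ ↦ (a · η) ⊗ (δ · c)`. -/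
def tensorMap (F G : Cᵒᵖ ⥤ C ⥤ AddCommGrpCat.{u}) {D D' A A' : C} (c : D' ⟶ D) (a : A ⟶ A') :
    TensorGrp F G D A →+ TensorGrp F G D' A' :=
  QuotientAddGroup.map _ _ (FreeAbelianGroup.map (tensorGen F G c a)) (by
    rw [AddSubgroup.closure_le]
    rintro _ (⟨B, η, η', δ⟩ | ⟨B, η, δ, δ'⟩ | ⟨B, B', f, η, δ⟩)
    · apply AddSubgroup.subset_closure
      simpa [tensorGen] using
        TensorRel.add_left (F := F) (G := G) B (push F a η) (push F a η') (pull G c δ)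
    · apply AddSubgroup.subset_closure
      simpa [tensorGen] using
        TensorRel.add_right (F := F) (G := G) B (push F a η) (pull G c δ) (pull G c δ')
    · apply AddSubgroup.subset_closure
      have h := TensorRel.balanced (F := F) (G := G) B B' f (push F a η) (pull G c δ)
      rw [← push_pull, push_pull] at h
      simpa [tensorGen] using h)

lemma tensorMap_id (F G : Cᵒᵖ ⥤ C ⥤ AddCommGrpCat.{u}) (D A : C) :
    tensorMap F G (𝟙 D) (𝟙 A) = AddMonoidHom.id _ := by
  apply QuotientAddGroup.addMonoidHom_ext
  ext ⟨B, η, δ⟩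
  simp [tensorMap, tensorGen, push_id, pull_id]

lemma tensorMap_comp (F G : Cᵒᵖ ⥤ C ⥤ AddCommGrpCat.{u}) {D D' D'' A A' A'' : C}
    (c : D' ⟶ D) (c' : D'' ⟶ D') (a : A ⟶ A') (a' : A' ⟶ A'') :
    tensorMap F G (c' ≫ c) (a ≫ a') = (tensorMap F G c' a').comp (tensorMap F G c a) := by
  apply QuotientAddGroup.addMonoidHom_ext
  ext ⟨B, η, δ⟩
  simp [tensorMap, tensorGen, push_comp, pull_comp]

/-- The tensor product over `C` of two bifunctors,
`(D, A) ↦ ∫^B F(B, A) ⊗ G(D, B)`. -/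
def tensor (F G : Cᵒᵖ ⥤ C ⥤ AddCommGrpCat.{u}) : Cᵒᵖ ⥤ C ⥤ AddCommGrpCat.{u} where
  obj D :=
    { obj := fun A => AddCommGrpCat.of (TensorGrp F G D.unop A)
      map := fun a => AddCommGrpCat.ofHom (tensorMap F G (𝟙 _) a)
      map_id := fun A => by rw [tensorMap_id]; rfl
      map_comp := fun a a' => by
        rw [← AddCommGrpCat.ofHom_comp, ← tensorMap_comp, Category.comp_id] }
  map c :=
    { app := fun A => AddCommGrpCat.ofHom (tensorMap F G c.unop (𝟙 A))
      naturality := fun A A' a => by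
        dsimp only
        rw [← AddCommGrpCat.ofHom_comp, ← AddCommGrpCat.ofHom_comp, ← tensorMap_comp,
          ← tensorMap_comp]
        simp only [Category.comp_id, Category.id_comp] }
  map_id D := by
    ext A : 2
    exact congrArg AddCommGrpCat.ofHom (tensorMap_id F G D.unop A)
  map_comp c c' := by
    ext A : 2
    dsimp only [NatTrans.comp_app]
    rw [← AddCommGrpCat.ofHom_comp, ← tensorMap_comp, Category.comp_id]

end Bifunctors

/-! ## Extriangulated categories -/

/-- An external triangulation `(E, s)` of the additive category `C`. The correspondence `s` from
extensions `δ ∈ E(D, A)` to equivalence classes of sequences `A ⟶ B ⟶ D` is given by the relation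
`Realizes x y δ`, to be read as `s(δ) = [A --x--> B --y--> D]`. -/
structure Extriangulation (C : Type u) [SmallCategory C] [Preadditive C]
    [HasZeroObject C] [HasBinaryBiproducts C] where
  E : Cᵒᵖ ⥤ C ⥤ AddCommGrpCat.{u}
  additive_left : ∀ A : C, (E.flip.obj A).Additive
  additive_right : ∀ D : Cᵒᵖ, (E.obj D).Additive
  Realizes : ∀ {A B D : C}, (A ⟶ B) → (B ⟶ D) → Grp E D A → Prop
  exists_realization : ∀ {A D : C} (δ : Grp E D A),
    ∃ (B : C) (x : A ⟶ B) (y : B ⟶ D), Realizes x y δ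
  realizes_iff : ∀ {A B B' D : C} {δ : Grp E D A} {x : A ⟶ B} {y : B ⟶ D}
    (x' : A ⟶ B') (y' : B' ⟶ D), Realizes x y δ →
    (Realizes x' y' δ ↔ ∃ b : B ≅ B', x ≫ b.hom = x' ∧ b.hom ≫ y' = y)
  realizes_hom : ∀ {A B D A' B' D' : C} {x : A ⟶ B} {y : B ⟶ D} {δ : Grp E D A}
    {x' : A' ⟶ B'} {y' : B' ⟶ D'} {δ' : Grp E D' A'} (a : A ⟶ A') (c : D ⟶ D'),
    Realizes x y δ → Realizes x' y' δ' → push E a δ = pull E c δ' →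
    ∃ b : B ⟶ B', x ≫ b = a ≫ x' ∧ y ≫ c = b ≫ y'
  realizes_zero : ∀ A D : C,
    Realizes (biprod.inl : A ⟶ A ⊞ D) (biprod.snd : A ⊞ D ⟶ D) (0 : Grp E D A)
  realizes_sum : ∀ {A B D A' B' D' : C} {x : A ⟶ B} {y : B ⟶ D} {δ : Grp E D A}
    {x' : A' ⟶ B'} {y' : B' ⟶ D'} {δ' : Grp E D' A'},
    Realizes x y δ → Realizes x' y' δ' →
    Realizes (biprod.map x x') (biprod.map y y')
      (push E (biprod.inl : A ⟶ A ⊞ A') (pull E (biprod.fst : D ⊞ D' ⟶ D) δ) +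
        push E (biprod.inr : A' ⟶ A ⊞ A') (pull E (biprod.snd : D ⊞ D' ⟶ D') δ'))
  et3 : ∀ {A B D A' B' D' : C} {x : A ⟶ B} {y : B ⟶ D} {δ : Grp E D A}
    {x' : A' ⟶ B'} {y' : B' ⟶ D'} {δ' : Grp E D' A'} (a : A ⟶ A') (b : B ⟶ B'),
    Realizes x y δ → Realizes x' y' δ' → x ≫ b = a ≫ x' →
    ∃ c : D ⟶ D', push E a δ = pull E c δ' ∧ y ≫ c = b ≫ y'
  et3op : ∀ {A B D A' B' D' : C} {x : A ⟶ B} {y : B ⟶ D} {δ : Grp E D A}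
    {x' : A' ⟶ B'} {y' : B' ⟶ D'} {δ' : Grp E D' A'} (b : B ⟶ B') (c : D ⟶ D'),
    Realizes x y δ → Realizes x' y' δ' → y ≫ c = b ≫ y' →
    ∃ a : A ⟶ A', push E a δ = pull E c δ' ∧ x ≫ b = a ≫ x'
  et4 : ∀ {A B D M F : C} {f : A ⟶ B} {f' : B ⟶ D} {δ : Grp E D A}
    {g : B ⟶ M} {g' : M ⟶ F} {δ' : Grp E F B},
    Realizes f f' δ → Realizes g g' δ' →
    ∃ (N : C) (h' : M ⟶ N) (d : D ⟶ N) (e : N ⟶ F) (δ'' : Grp E N A),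
      f' ≫ d = g ≫ h' ∧ h' ≫ e = g' ∧ Realizes (f ≫ g) h' δ'' ∧
      Realizes d e (push E f' δ') ∧ pull E d δ'' = δ ∧ push E f δ'' = pull E e δ'
  et4op : ∀ {D A B F M : C} {f' : D ⟶ A} {f : A ⟶ B} {δ : Grp E B D}
    {g' : F ⟶ B} {g : B ⟶ M} {δ' : Grp E M F},
    Realizes f' f δ → Realizes g' g δ' →
    ∃ (N : C) (d : D ⟶ N) (e : N ⟶ F) (h' : N ⟶ A) (δ'' : Grp E M N),
      d ≫ h' = f' ∧ h' ≫ f = e ≫ g' ∧ Realizes h' (f ≫ g) δ'' ∧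
      Realizes d e (pull E g' δ) ∧ δ' = push E e δ'' ∧ push E d δ = pull E g δ''

namespace Extriangulation

variable {C : Type u} [SmallCategory C] [Preadditive C] [HasZeroObject C]
  [HasBinaryBiproducts C] (T : Extriangulation C)

/-- `A ⟶ B ⟶ D` is a conflation. -/
def IsConflation {A B D : C} (x : A ⟶ B) (y : B ⟶ D) : Prop :=
  ∃ δ : Grp T.E D A, T.Realizes x y δ

/-- `y` is a deflation. -/
def IsDeflation {B D : C} (y : B ⟶ D) : Prop :=
  ∃ (A : C) (x : A ⟶ B), T.IsConflation x y

/-- `P` is an `E`-projective object. -/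
def IsProjObj : ObjectProperty C := fun P =>
  ∀ ⦃A B D : C⦄ (x : A ⟶ B) (y : B ⟶ D), T.IsConflation x y →
    ∀ f : P ⟶ D, ∃ g : P ⟶ B, g ≫ y = f

/-- `f` is an `E`-projective morphism: `E(f, -) = 0`. -/
def IsProjMor {Y Y' : C} (f : Y ⟶ Y') : Prop :=
  ∀ (A : C) (δ : Grp T.E Y' A), pull T.E f δ = 0

/-- `g` is an `E`-injective morphism: `E(-, g) = 0`. -/
def IsInjMor {Y Y' : C} (g : Y ⟶ Y') : Prop :=
  ∀ (D : C) (δ : Grp T.E D Y), push T.E g δ = 0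

/-- `C` has enough `E`-projectives. -/
def EnoughProjObj : Prop :=
  ∀ D : C, ∃ (P : C) (p : P ⟶ D), T.IsProjObj P ∧ T.IsDeflation p

/-- `Q` has enough deflations from `P`. -/
def EnoughDeflations (Q P : ObjectProperty C) : Prop :=
  ∀ D : C, Q D → ∃ (W : C) (p : W ⟶ D), P W ∧ T.IsDeflation p

/-- `Q` has enough `E`-projective morphisms from `P`. -/
def EnoughProjMor (Q P : ObjectProperty C) : Prop :=
  ∀ D : C, Q D → ∃ (W : C) (p : W ⟶ D), P W ∧ T.IsDeflation p ∧ T.IsProjMor p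

/-- The syzygy class `Ω P`: the objects `A` with a conflation `A ⟶ Q ⟶ W`, where `Q` is an
`E`-projective object and `W` is in `P`. -/
def Omega (P : ObjectProperty C) : ObjectProperty C := fun A =>
  ∃ (Q W : C) (x : A ⟶ Q) (y : Q ⟶ W), T.IsProjObj Q ∧ P W ∧ T.IsConflation x y

/-- `HasCoresolution P m A`: `A` has a finite `P`-coresolution
`0 → A → Y₀ → Y₁ → ⋯ → Y_m → 0` of length `m`. -/
def HasCoresolution (P : ObjectProperty C) : ℕ → ObjectProperty C
  | 0 => fun A => ∃ Y : C, P Y ∧ Nonempty (A ≅ Y)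
  | m + 1 => fun A => ∃ (Y K : C) (x : A ⟶ Y) (y : Y ⟶ K),
      P Y ∧ HasCoresolution P m K ∧ T.IsConflation x y

/-- The class of the objects whose `P`-coresolution dimension is at most `m`. -/
def Cores (P : ObjectProperty C) (m : ℕ) : ObjectProperty C := fun A =>
  ∃ k ≤ m, T.HasCoresolution P k A

/-! ### Higher extension groups -/

/-- The standard higher extension bifunctors of a small extriangulated category:
`higherExt i` is `E^{i+1}`, where `E^1 = E` and `E^{k+1}(D, A) = ∫^B E^k(B, A) ⊗ E(D, B)`. -/
def higherExt : ℕ → Cᵒᵖ ⥤ C ⥤ AddCommGrpCat.{u}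
  | 0 => T.E
  | i + 1 => tensor (higherExt i) T.E

/-- The data which make a family of bifunctors (`Ex i` is `E^{i+1}`) a family of higher extension
groups in the axiomatic sense: `E^1 = E`, connecting transformations with exact sequences in both
variables, their compatibility with morphisms of `E`-triangles, and vanishing on `E`-projective
and on `E`-injective morphisms. -/
structure HigherExtData (Ex : ℕ → Cᵒᵖ ⥤ C ⥤ AddCommGrpCat.{u}) where
  additive_left : ∀ (i : ℕ) (A : C), ((Ex i).flip.obj A).Additive
  additive_right : ∀ (i : ℕ) (D : Cᵒᵖ), ((Ex i).obj D).Additive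
  one : Ex 0 = T.E
  del : ∀ {A B D : C} {x : A ⟶ B} {y : B ⟶ D} {δ : Grp T.E D A}, T.Realizes x y δ →
    ∀ i : ℕ, (Ex i).obj (op A) ⟶ (Ex (i + 1)).obj (op D)
  codel : ∀ {A B D : C} {x : A ⟶ B} {y : B ⟶ D} {δ : Grp T.E D A}, T.Realizes x y δ →
    ∀ i : ℕ, (Ex i).flip.obj D ⟶ (Ex (i + 1)).flip.obj A
  exact_del : ∀ {A B D : C} {x : A ⟶ B} {y : B ⟶ D} {δ : Grp T.E D A} (h : T.Realizes x y δ)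
    (i : ℕ) (W : C),
    Function.Exact (pull (Ex i) y : Grp (Ex i) D W →+ _) (pull (Ex i) x) ∧
    Function.Exact (pull (Ex i) x) ((del h i).app W).hom
  exact_codel : ∀ {A B D : C} {x : A ⟶ B} {y : B ⟶ D} {δ : Grp T.E D A} (h : T.Realizes x y δ)
    (i : ℕ) (W : C),
    Function.Exact (push (Ex i) x : Grp (Ex i) W A →+ _) (push (Ex i) y) ∧
    Function.Exact (push (Ex i) y) ((codel h i).app (op W)).hom
  del_natural : ∀ {A B D A' B' D' : C} {x : A ⟶ B} {y : B ⟶ D} {δ : Grp T.E D A}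
    {x' : A' ⟶ B'} {y' : B' ⟶ D'} {δ' : Grp T.E D' A'} (h : T.Realizes x y δ)
    (h' : T.Realizes x' y' δ') (a : A ⟶ A') (b : B ⟶ B') (c : D ⟶ D'),
    push T.E a δ = pull T.E c δ' → x ≫ b = a ≫ x' → y ≫ c = b ≫ y' → ∀ i : ℕ,
    (Ex i).map a.op ≫ del h i = del h' i ≫ (Ex (i + 1)).map c.op
  codel_natural : ∀ {A B D A' B' D' : C} {x : A ⟶ B} {y : B ⟶ D} {δ : Grp T.E D A}
    {x' : A' ⟶ B'} {y' : B' ⟶ D'} {δ' : Grp T.E D' A'} (h : T.Realizes x y δ)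
    (h' : T.Realizes x' y' δ') (a : A ⟶ A') (b : B ⟶ B') (c : D ⟶ D'),
    push T.E a δ = pull T.E c δ' → x ≫ b = a ≫ x' → y ≫ c = b ≫ y' → ∀ i : ℕ,
    (Ex i).flip.map c ≫ codel h' i = codel h i ≫ (Ex (i + 1)).flip.map a
  projMor_zero : ∀ {Y Y' : C} (f : Y ⟶ Y'), T.IsProjMor f →
    ∀ (i : ℕ) (W : C) (ω : Grp (Ex i) Y' W), pull (Ex i) f ω = 0
  injMor_zero : ∀ {Y Y' : C} (g : Y ⟶ Y'), T.IsInjMor g →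
    ∀ (i : ℕ) (W : C) (ω : Grp (Ex i) W Y), push (Ex i) g ω = 0

/-- A family of higher extension groups for `T`: the standard one, or any family which satisfies
the axioms. (The standard family is known to satisfy them as well; naming it separately makes it
unnecessary to assume this.) -/
def IsHigherExtFamily (Ex : ℕ → Cᵒᵖ ⥤ C ⥤ AddCommGrpCat.{u}) : Prop :=
  Ex = T.higherExt ∨ Nonempty (T.HigherExtData Ex)

end Extriangulation

/-- `P` is `(n+2)`-rigid with respect to the family `E^{i+1} = Ex i`:
`E^k(P, P) = 0` for `1 ≤ k ≤ n + 1`. -/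
def IsRigid {C : Type u} [SmallCategory C] (Ex : ℕ → Cᵒᵖ ⥤ C ⥤ AddCommGrpCat.{u}) (n : ℕ)
    (P : ObjectProperty C) : Prop :=
  ∀ i ≤ n, ∀ D A : C, P D → P A → ∀ ω : Grp (Ex i) D A, ω = 0

namespace Extriangulation

variable {C : Type u} [SmallCategory C] [Preadditive C] [HasZeroObject C]
  [HasBinaryBiproducts C] (T : Extriangulation C)

/-! ### Stable categories -/

/-- Two morphisms of the full subcategory `Q` are identified when their difference is an
`E`-projective morphism. -/
def stableRel (Q : ObjectProperty C) : HomRel Q.FullSubcategory :=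
  fun _ _ f g => T.IsProjMor (f - g).hom

lemma stableRel_iff (Q : ObjectProperty C) {Y Y' : Q.FullSubcategory} (f g : Y ⟶ Y') :
    T.stableRel Q f g ↔
      ∀ (A : C) (δ : Grp T.E Y'.obj A), pull T.E f.hom δ = pull T.E g.hom δ := by
  have key : ∀ (A : C) (δ : Grp T.E Y'.obj A),
      pull T.E (f - g).hom δ = pull T.E f.hom δ - pull T.E g.hom δ := by
    intro A δ
    have := T.additive_left A
    have h := (T.E.flip.obj A).map_sub (f := f.hom.op) (g := g.hom.op)
    exact DFunLike.congr_fun (congrArg AddCommGrpCat.Hom.hom h) δ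
  refine forall_congr' fun A => forall_congr' fun δ => ?_
  rw [key, sub_eq_zero]

instance (Q : ObjectProperty C) : Congruence (T.stableRel Q) where
  equivalence := by
    intro Y Y'
    refine ⟨fun f => ?_, fun {f g} h => ?_, fun {f g k} h h' => ?_⟩
    · rw [stableRel_iff]; intro A δ; rfl
    · rw [stableRel_iff] at *; intro A δ; exact (h A δ).symm
    · rw [stableRel_iff] at *; intro A δ; exact (h A δ).trans (h' A δ)
  comp_left := by
    intro Y Y' Y'' f g g' h
    rw [stableRel_iff] at *
    intro A δ
    have := h A δ
    simp only [ObjectProperty.FullSubcategory.comp_hom, pull_comp, this]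
  comp_right := by
    intro Y Y' Y'' f f' g h
    rw [stableRel_iff] at *
    intro A δ
    simp only [ObjectProperty.FullSubcategory.comp_hom, pull_comp, h]

lemma stableRel_add (Q : ObjectProperty C) ⦃Y Y' : Q.FullSubcategory⦄ (f₁ f₂ g₁ g₂ : Y ⟶ Y')
    (hf : T.stableRel Q f₁ f₂) (hg : T.stableRel Q g₁ g₂) :
    T.stableRel Q (f₁ + g₁) (f₂ + g₂) := by
  intro A δ
  have := T.additive_left A
  have e : (f₁ + g₁ - (f₂ + g₂)).hom = (f₁ - f₂).hom + (g₁ - g₂).hom := by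
    rw [add_sub_add_comm]; rfl
  have h := (T.E.flip.obj A).map_add (f := (f₁ - f₂).hom.op) (g := (g₁ - g₂).hom.op)
  have h' : pull T.E ((f₁ - f₂).hom + (g₁ - g₂).hom) δ
      = pull T.E (f₁ - f₂).hom δ + pull T.E (g₁ - g₂).hom δ :=
    DFunLike.congr_fun (congrArg AddCommGrpCat.Hom.hom h) δ
  rw [e, h', hf A δ, hg A δ, add_zero]

/-- The stable category of the full subcategory `Q`: its quotient by the ideal of
`E`-projective morphisms. -/
abbrev Stable (Q : ObjectProperty C) : Type u := CategoryTheory.Quotient (T.stableRel Q)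

instance (Q : ObjectProperty C) : Preadditive (T.Stable Q) :=
  Quotient.preadditive _ (T.stableRel_add Q)

/-- The object of the stable category given by an object of `Q`. -/
def stableObj {Q : ObjectProperty C} (Y : C) (hY : Q Y) : T.Stable Q := ⟨⟨Y, hY⟩⟩

/-- The contravariant functor induced by `E(-, M)` on the stable category of `Q`. -/
def stableE (Q : ObjectProperty C) (M : C) : (T.Stable Q)ᵒᵖ ⥤ AddCommGrpCat.{u} :=
  (CategoryTheory.Quotient.lift (T.stableRel Q) ((Q.ι.op ⋙ T.E.flip.obj M).rightOp) (by
    intro Y Y' f g h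
    rw [stableRel_iff] at h
    apply Quiver.Hom.unop_inj
    ext δ
    exact h M δ)).leftOp

instance (Q : ObjectProperty C) (M : C) : (T.stableE Q M).Additive where
  map_add := by
    rintro ⟨⟨Y⟩⟩ ⟨⟨Y'⟩⟩ ⟨f⟩ ⟨g⟩
    induction f using Quot.inductionOn with
    | h f =>
      induction g using Quot.inductionOn with
      | h g =>
        have := T.additive_left M
        exact (T.E.flip.obj M).map_add (f := f.hom.op) (g := g.hom.op)

/-- The functor `H` on the full subcategory `S`, sending `M` to `E(-, M)` restricted to `Q` and
regarded as a right module over the stable category of `Q`. -/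
def functorH (S Q : ObjectProperty C) : S.FullSubcategory ⥤ RightMod (T.Stable Q) where
  obj M := AdditiveFunctor.of (T.stableE Q M.obj)
  map {M N} h := ObjectProperty.homMk
    { app := fun Y => (T.E.obj (op Y.unop.as.obj)).map h.hom
      naturality := by
        rintro ⟨⟨Y⟩⟩ ⟨⟨Y'⟩⟩ ⟨f⟩
        induction f using Quot.inductionOn with
        | h f => exact ((T.E.map f.hom.op).naturality h.hom).symm }
  map_id M := by
    ext Y : 3
    exact (T.E.obj (op Y.unop.as.obj)).map_id M.obj
  map_comp h k := by
    ext Y : 3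
    exact (T.E.obj (op Y.unop.as.obj)).map_comp h.hom k.hom

/-- The class `R_P` of modules `G` over the stable category of `Q` with an exact sequence
`Q(-, X₀) → Q(-, X₁) → G → 0` of stable representables, where `X₀ ∈ P` and `X₁ ∈ Q`. -/
def classR (P Q : ObjectProperty C) : ObjectProperty (RightMod (T.Stable Q)) := fun G =>
  ∃ (X₀ X₁ : C) (_ : P X₀) (h₀ : Q X₀) (h₁ : Q X₁)
    (f : rep (T.stableObj X₀ h₀) ⟶ rep (T.stableObj X₁ h₁))
    (g : rep (T.stableObj X₁ h₁) ⟶ G), RightExactPair f g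

end Extriangulation

/-! ### The quotient by a class of objects -/

section IdealQuotient

variable {C : Type u} [SmallCategory C] [Preadditive C]

/-- Two morphisms of the full subcategory `S` are identified when their difference factors through
an object of `P`. -/
def idealRel (S P : ObjectProperty C) : HomRel S.FullSubcategory := fun M N f g =>
  ∃ (W : C) (a : M.obj ⟶ W) (b : W ⟶ N.obj), P W ∧ (f - g).hom = a ≫ b

variable [HasBinaryBiproducts C]

lemma idealRel_add (S P : ObjectProperty C) [IsFree P] ⦃M N : S.FullSubcategory⦄
    (f₁ f₂ g₁ g₂ : M ⟶ N) (hf : idealRel S P f₁ f₂) (hg : idealRel S P g₁ g₂) :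
    idealRel S P (f₁ + g₁) (f₂ + g₂) := by
  obtain ⟨W, a, b, hW, e⟩ := hf
  obtain ⟨W', a', b', hW', e'⟩ := hg
  refine ⟨W ⊞ W', biprod.lift a a', biprod.desc b b', IsFree.biprod hW hW', ?_⟩
  rw [biprod.lift_desc, ← e, ← e', add_sub_add_comm]
  rfl

variable [HasZeroObject C]

instance (S P : ObjectProperty C) [IsFree P] : Congruence (idealRel S P) where
  equivalence := by
    intro M N
    have hr : ∀ f : M ⟶ N, idealRel S P f f := fun f =>
      ⟨_, 0, 0, IsFree.zero, by rw [sub_self, comp_zero]; rfl⟩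
    have hs : ∀ {f g : M ⟶ N}, idealRel S P f g → idealRel S P g f := by
      rintro f g ⟨W, a, b, hW, e⟩
      refine ⟨W, -a, b, hW, ?_⟩
      rw [Preadditive.neg_comp, ← e, ← neg_sub]
      rfl
    refine ⟨hr, hs, fun {f g k} h h' => ?_⟩
    obtain ⟨W, a, b, hW, e⟩ := idealRel_add S P _ _ _ _ h h'
    refine ⟨W, a, b, hW, ?_⟩
    rw [← e]
    congr 1
    abel
  comp_left := by
    rintro M N L f g g' ⟨W, a, b, hW, e⟩
    refine ⟨W, f.hom ≫ a, b, hW, ?_⟩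
    rw [Category.assoc, ← e, ← Preadditive.comp_sub]
    rfl
  comp_right := by
    rintro M N L f f' g ⟨W, a, b, hW, e⟩
    refine ⟨W, a, b ≫ g.hom, hW, ?_⟩
    rw [← Category.assoc, ← e, ← Preadditive.sub_comp]
    rfl

/-- The quotient category `S/[P]`. -/
abbrev IdealQuot (S P : ObjectProperty C) : Type u := CategoryTheory.Quotient (idealRel S P)

instance (S P : ObjectProperty C) [IsFree P] : Preadditive (IdealQuot S P) :=
  Quotient.preadditive _ (idealRel_add S P)

/-- For a class `Q` of objects of `C`, the class of those objects of `S/[P]` which lie in `Q`. -/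
def onQuot (S P Q : ObjectProperty C) : ObjectProperty (IdealQuot S P) := fun Y => Q Y.as.obj

end IdealQuotient

end Extri

open Extri

/-!
Write `S` for the class of objects of `X`-coresolution dimension at most `n + 1` and `Q` for the
class of those of dimension at most `n`.

The theorem rests on the vanishing `E(Q, X) = 0`, which follows from rigidity by dimension shifting
along a coresolution (`IsHigherExtFamily.eq_zero_of_cores`). For the standard higher extension
groups this needs one piece of exactness: if `ω ⊗ δ = 0` in `∫^B F(B, W) ⊗ E(D, B)`, then `ω`
extends along the inflation of a conflation realizing `δ`
(`exists_pull_eq_of_tmul_eq_zero`). The reason is that every element of the coend is a pure tensor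
and that `ω ⊗ δ` vanishes only if `δ` is the image of an extension under a morphism which kills
`ω` (`exists_of_tmul_eq_zero`).

Given a conflation `M ⟶ Y ⟶ K` with `Y` in `X` and `K` in `Q`, the long exact sequence and
`E(Q, X) = 0` give an exact sequence of modules `Q(-, Y) ⟶ Q(-, K) ⟶ E(-, M) ⟶ 0` over the stable
category (`IsRigidTriple.rightExactPair`). By the Yoneda lemma a morphism `E(-, M) ⟶ E(-, N)` is
an element of `E(K, N)` killed by `Y`, hence comes from a morphism `M ⟶ N`, which is unique up to
morphisms factoring through `Y`: the functor `𝔽` is fully faithful. Conversely, a presentation of a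
module by `f : X₀ ⟶ X₁` becomes a presentation by a deflation when an `E`-projective deflation onto
`X₁` is added to `f`, and the module is then `E(-, M)` for the kernel `M`
(`IsRigidTriple.exists_functorF_iso`). So `𝔽` is an equivalence onto the class of modules with such
presentations. The latter is closed under extensions by the horseshoe lemma
(`presented_closedUnderExtensions`), hence an exact category, and exact structures are transported
along equivalences.

If `X` is closed under direct summands, so is `S` (`cores_of_biprod`): when `A ⊞ B` has a conflation
`A ⊞ B ⟶ Y ⟶ K`, the conflations `A ⟶ Y ⟶ K₁` and `B ⟶ Y ⟶ K₂` add up to a pullback of it, which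
gives a conflation `Y ⊞ Y ⟶ (K₁ ⊞ K₂) ⊞ Y ⟶ K`; this splits, and induction applies to `K₁`. Weak
idempotent completeness of `S/[X]` follows by lifting a split epimorphism to a split deflation, the
Krull–Schmidt property by decomposing objects in `C`.

If `Q = X` is precovering in `S`, the stable category has weak kernels
(`IsRigidTriple.exists_weakKernel`), so finitely presented modules are closed under kernels and
cokernels and form an abelian category. For `A` in `Ω(X)` the module `E(-, A)` is representable
(`IsRigidTriple.nonempty_functorF_iso_rep`), and each object of `S/[X]` is a quotient of one of them
(`IsRigidTriple.exists_epi_of_omega`), which determines the projective objects up to summands; in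
the Krull–Schmidt case a nonzero summand with local endomorphism ring is itself a syzygy, because
`Ω(X)` is closed under direct summands in `C` (`IsRigidTriple.omega_of_biprod`).
-/

namespace Extri

open ZeroObject

/-! ### Basic facts on extriangulated categories -/

namespace Extriangulation

variable {C : Type u} [SmallCategory C] [Preadditive C] [HasZeroObject C]
  [HasBinaryBiproducts C] (T : Extriangulation C)

section Additivity

variable {A A' D D' : C}

lemma push_add_hom (a a' : A ⟶ A') (δ : Grp T.E D A) :
    push T.E (a + a') δ = push T.E a δ + push T.E a' δ := by
  have := T.additive_right (op D)
  exact DFunLike.congr_fun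
    (congrArg AddCommGrpCat.Hom.hom ((T.E.obj (op D)).map_add (f := a) (g := a'))) δ

lemma push_neg_hom (a : A ⟶ A') (δ : Grp T.E D A) :
    push T.E (-a) δ = -push T.E a δ := by
  have := T.additive_right (op D)
  exact DFunLike.congr_fun
    (congrArg AddCommGrpCat.Hom.hom ((T.E.obj (op D)).map_neg (f := a))) δ

lemma push_zero_hom (δ : Grp T.E D A) : push T.E (0 : A ⟶ A') δ = 0 := by
  have := T.additive_right (op D)
  exact DFunLike.congr_fun
    (congrArg AddCommGrpCat.Hom.hom ((T.E.obj (op D)).map_zero A A')) δ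

lemma pull_add_hom (c c' : D' ⟶ D) (δ : Grp T.E D A) :
    pull T.E (c + c') δ = pull T.E c δ + pull T.E c' δ := by
  have := T.additive_left A
  exact DFunLike.congr_fun
    (congrArg AddCommGrpCat.Hom.hom ((T.E.flip.obj A).map_add (f := c.op) (g := c'.op))) δ

lemma push_sub_hom (a a' : A ⟶ A') (δ : Grp T.E D A) :
    push T.E (a - a') δ = push T.E a δ - push T.E a' δ := by
  rw [sub_eq_add_neg, push_add_hom, push_neg_hom, sub_eq_add_neg]

end Additivity

variable {T}

section Realization

variable {A B D A' B' D' W : C} {x : A ⟶ B} {y : B ⟶ D} {δ : Grp T.E D A}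
  {x' : A' ⟶ B'} {y' : B' ⟶ D'} {δ' : Grp T.E D' A'}

/-- Split sequences realize the zero extension. -/
lemma realizes_of_splitting (r : B ⟶ A) (s : D ⟶ B) (hr : x ≫ r = 𝟙 A) (hs : s ≫ y = 𝟙 D)
    (hxy : x ≫ y = 0) (hrs : r ≫ x + y ≫ s = 𝟙 B) : T.Realizes x y (0 : Grp T.E D A) := by
  have hsr : s ≫ r = 0 := by
    have h := congrArg (fun t => s ≫ t ≫ r) hrs
    simp only [Preadditive.add_comp, Preadditive.comp_add, Category.assoc, hr, Category.comp_id,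
      reassoc_of% hs, Category.id_comp] at h
    simpa using h
  refine (T.realizes_iff x y (T.realizes_zero A D)).2
    ⟨⟨biprod.desc x s, biprod.lift r y, ?_, ?_⟩, by simp, ?_⟩
  · ext <;> simp [hr, hs, hxy, hsr]
  · simp [hrs]
  · ext <;> simp [hxy, hs]

variable (T) in
lemma realizes_zero_left (B : C) :
    T.Realizes (0 : (0 : C) ⟶ B) (𝟙 B) (0 : Grp T.E B (0 : C)) :=
  realizes_of_splitting 0 (𝟙 B) (by simp) (by simp) (by simp) (by simp)

variable (T) in
lemma realizes_zero_right (A : C) :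
    T.Realizes (𝟙 A) (0 : A ⟶ (0 : C)) (0 : Grp T.E (0 : C) A) :=
  realizes_of_splitting (𝟙 A) 0 (by simp) (by simp) (by simp) (by simp)

lemma Realizes.comp_eq_zero (h : T.Realizes x y δ) : x ≫ y = 0 := by
  obtain ⟨c, -, hc⟩ := T.et3 (𝟙 A) x (T.realizes_zero_right A) h rfl
  rw [← hc, zero_comp]

lemma Realizes.pull_eq_zero (h : T.Realizes x y δ) : pull T.E y δ = 0 := by
  obtain ⟨c, hc, -⟩ := T.et3op (𝟙 B) y (T.realizes_zero_left B) h rfl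
  rw [← hc, map_zero]

/-- Exactness of `C(W, B) → C(W, D) → E(W, A)`. -/
lemma Realizes.exists_lift (h : T.Realizes x y δ) (c : W ⟶ D) (hc : pull T.E c δ = 0) :
    ∃ g : W ⟶ B, g ≫ y = c := by
  obtain ⟨b, -, hb⟩ := T.realizes_hom (𝟙 A) c (T.realizes_zero A W) h (by rw [map_zero, hc])
  exact ⟨biprod.inr ≫ b, by rw [Category.assoc, ← hb]; simp⟩

/-- Exactness of `C(B, W) → C(A, W) → E(D, W)`. -/
lemma Realizes.exists_desc (h : T.Realizes x y δ) (a : A ⟶ W) (ha : push T.E a δ = 0) :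
    ∃ g : B ⟶ W, x ≫ g = a := by
  obtain ⟨b, hb, -⟩ := T.realizes_hom a (𝟙 D) h (T.realizes_zero W D) (by rw [map_zero, ha])
  exact ⟨b ≫ biprod.fst, by rw [← Category.assoc, hb]; simp⟩

/-- The inflation of a conflation is a weak kernel of the deflation. -/
lemma Realizes.exists_lift_of_comp_eq_zero (h : T.Realizes x y δ) (g : W ⟶ B) (hg : g ≫ y = 0) :
    ∃ l : W ⟶ A, l ≫ x = g := by
  obtain ⟨a, -, ha⟩ := T.et3op g (0 : (0 : C) ⟶ D) (T.realizes_zero_right W) h (by simp [hg])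
  exact ⟨a, by rw [← ha]; simp⟩

/-- The deflation of a conflation is a weak cokernel of the inflation. -/
lemma Realizes.exists_desc_of_comp_eq_zero (h : T.Realizes x y δ) (g : B ⟶ W) (hg : x ≫ g = 0) :
    ∃ l : D ⟶ W, y ≫ l = g := by
  obtain ⟨c, -, hc⟩ := T.et3 (0 : A ⟶ (0 : C)) g h (T.realizes_zero_left W) (by simp [hg])
  exact ⟨c, by rw [hc]; simp⟩

/-- Exactness of `C(W, D) → E(W, A) → E(W, B)`. -/
lemma Realizes.exists_of_push_eq_zero (h : T.Realizes x y δ) (ω : Grp T.E W A)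
    (hω : push T.E x ω = 0) : ∃ c : W ⟶ D, pull T.E c δ = ω := by
  obtain ⟨M, v, w, hM⟩ := T.exists_realization ω
  obtain ⟨g, hg⟩ := hM.exists_desc x hω
  obtain ⟨c, hc, -⟩ := T.et3 (𝟙 A) g hM h (by rw [hg, Category.id_comp])
  exact ⟨c, by rw [← hc, push_id]⟩

/-- Exactness of `C(A, W) → E(D, W) → E(B, W)`. -/
lemma Realizes.exists_of_pull_eq_zero (h : T.Realizes x y δ) (ω : Grp T.E D W)
    (hω : pull T.E y ω = 0) : ∃ a : A ⟶ W, push T.E a δ = ω := by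
  obtain ⟨M, v, w, hM⟩ := T.exists_realization ω
  obtain ⟨g, hg⟩ := hM.exists_lift y hω
  obtain ⟨a, ha, -⟩ := T.et3op g (𝟙 D) h hM (by rw [hg, Category.comp_id])
  exact ⟨a, by rw [ha, pull_id]⟩

/-- Exactness of `E(D, -) → E(B, -) → E(A, -)` at the middle term. -/
lemma Realizes.exists_pull_eq (h : T.Realizes x y δ) (ω : Grp T.E B W)
    (hω : pull T.E x ω = 0) : ∃ ω' : Grp T.E D W, pull T.E y ω' = ω := by
  obtain ⟨M, v, w, hM⟩ := T.exists_realization ω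
  obtain ⟨N, d, e, h', δ'', -, -, -, hde, -, hd⟩ := T.et4op hM h
  rw [hω] at hde
  obtain ⟨r, hr⟩ := hde.exists_desc (𝟙 W) (by rw [map_zero])
  exact ⟨push T.E r δ'', by rw [← push_pull, ← hd, ← push_comp, hr, push_id]⟩

/-- An endomorphism of the middle term of a conflation which is compatible with the identities of
the end terms differs from the identity by a morphism of square zero. -/
lemma isIso_of_comp_eq_self (h : T.Realizes x y δ) (φ : B ⟶ B) (hx : x ≫ φ = x)
    (hy : φ ≫ y = y) : IsIso φ := by
  obtain ⟨τ, hτ⟩ := h.exists_desc_of_comp_eq_zero (φ - 𝟙 B) (by simp [hx])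
  have h0 : (φ - 𝟙 B) ≫ (φ - 𝟙 B) = 0 := by
    conv_lhs => rhs; rw [← hτ]
    simp [reassoc_of% hy]
  have h1 : φ ≫ φ = φ + φ - 𝟙 B := by
    have : φ ≫ φ - φ - (φ - 𝟙 B) = 0 := by simpa using h0
    rw [sub_eq_zero, sub_eq_iff_eq_add] at this
    rw [this]; abel
  refine ⟨𝟙 B + 𝟙 B - φ, ?_, ?_⟩ <;>
  · simp only [Preadditive.comp_sub, Preadditive.comp_add, Preadditive.sub_comp,
      Preadditive.add_comp, Category.comp_id, Category.id_comp, h1]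
    abel

/-- Realizations can be transported along isomorphisms of the end terms. -/
lemma Realizes.transport (h : T.Realizes x y δ) (a : A ≅ A') (c : D ≅ D') :
    T.Realizes (a.inv ≫ x) (y ≫ c.hom) (push T.E a.hom (pull T.E c.inv δ)) := by
  obtain ⟨M, v, w, hM⟩ := T.exists_realization (push T.E a.hom (pull T.E c.inv δ))
  obtain ⟨b, hb, hb'⟩ := T.realizes_hom a.hom c.hom h hM (by
    rw [← push_pull, ← pull_comp, Iso.hom_inv_id, pull_id])
  obtain ⟨b₁, hb₁, hb₁'⟩ := T.realizes_hom a.inv c.inv hM h (by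
    rw [← push_comp, Iso.hom_inv_id, push_id])
  have i1 : IsIso (b ≫ b₁) := isIso_of_comp_eq_self h _
    (by rw [reassoc_of% hb, hb₁, a.hom_inv_id_assoc])
    (by rw [Category.assoc, ← hb₁', ← reassoc_of% hb', c.hom_inv_id, Category.comp_id])
  have i2 : IsIso (b₁ ≫ b) := isIso_of_comp_eq_self hM _
    (by rw [reassoc_of% hb₁, hb, a.inv_hom_id_assoc])
    (by rw [Category.assoc, ← hb', ← reassoc_of% hb₁', c.inv_hom_id, Category.comp_id])
  have : IsIso b := by
    have : IsSplitMono b := ⟨⟨b₁ ≫ inv (b ≫ b₁), by rw [← Category.assoc, IsIso.hom_inv_id]⟩⟩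
    have : IsSplitEpi b := ⟨⟨inv (b₁ ≫ b) ≫ b₁, by simp⟩⟩
    exact isIso_of_epi_of_isSplitMono b
  refine (T.realizes_iff _ _ hM).2 ⟨(asIso b).symm, ?_, ?_⟩
  · simp only [Iso.symm_hom, asIso_inv, IsIso.comp_inv_eq, Category.assoc, hb,
      Iso.inv_hom_id_assoc]
  · simp [hb']

/-- Pullback of a realization along a morphism of the third terms: the resulting square is part
of a conflation. -/
lemma Realizes.exists_weakPullback (h : T.Realizes x y δ) (c : W ⟶ D) :
    ∃ (N : C) (d : A ⟶ N) (e : N ⟶ W) (h' : N ⟶ W ⊞ B) (δ'' : Grp T.E D N),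
      T.Realizes d e (pull T.E c δ) ∧ T.Realizes h' (biprod.desc (-c) y) δ'' ∧
      d ≫ h' = x ≫ biprod.inr ∧ h' ≫ biprod.fst = e := by
  -- axiom (ET4)ᵒᵖ for the sum of `0 ⟶ W ⟶ W` with the given conflation, and the split conflation
  -- of the graph of `c`
  have h0 : T.Realizes (x ≫ biprod.inr : A ⟶ W ⊞ B) (biprod.map (𝟙 W) y)
      (pull T.E (biprod.snd : W ⊞ D ⟶ D) δ) := by
    have := (T.realizes_sum (T.realizes_zero_left W) h).transport
      (⟨biprod.snd, biprod.inr, by ext; simp, by simp⟩ : (0 : C) ⊞ A ≅ A) (Iso.refl _)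
    simp only [Iso.refl_inv, pull_id, map_zero, zero_add, ← push_comp, biprod.inr_snd,
      push_id, Iso.refl_hom, Category.comp_id, biprod.inr_map] at this
    exact this
  have h1 : T.Realizes (biprod.lift (𝟙 W) c) (biprod.desc (-c) (𝟙 D)) (0 : Grp T.E D W) :=
    realizes_of_splitting biprod.fst biprod.inr (by simp) (by simp) (by simp)
      (by ext <;> simp)
  obtain ⟨N, d, e, h', δ'', h2, h3, h4, h5, -, -⟩ := T.et4op h0 h1
  refine ⟨N, d, e, h', δ'', ?_, ?_, h2, ?_⟩
  · simpa only [← pull_comp, biprod.lift_snd] using h5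
  · convert h4 using 1
    ext <;> simp
  · simpa using congrArg (· ≫ biprod.fst) h3

/-- Pushout of a realization along a morphism of the first terms: the resulting square is part
of a conflation. -/
lemma Realizes.exists_weakPushout (h : T.Realizes x y δ) (a : A ⟶ W) :
    ∃ (N : C) (d : W ⟶ N) (e : N ⟶ D) (h' : W ⊞ B ⟶ N) (δ'' : Grp T.E N A),
      T.Realizes d e (push T.E a δ) ∧ T.Realizes (biprod.lift (-a) x) h' δ'' ∧
      biprod.inl ≫ h' = d ∧ h' ≫ e = biprod.snd ≫ y := by
  -- axiom (ET4) for the split conflation of the graph of `-a`, and the sum of `W ⟶ W ⟶ 0` with the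
  -- given conflation
  have h0 : T.Realizes (biprod.map (𝟙 W) x) (biprod.snd ≫ y : W ⊞ B ⟶ D)
      (push T.E (biprod.inr : A ⟶ W ⊞ A) δ) := by
    have := (T.realizes_sum (T.realizes_zero_right W) h).transport (Iso.refl _)
      (⟨biprod.snd, biprod.inr, by ext; simp, by simp⟩ : (0 : C) ⊞ D ≅ D)
    simp only [Iso.refl_hom, push_id, map_zero, zero_add, Iso.refl_inv, Category.id_comp,
      ← push_pull, biprod.map_snd, ← pull_comp, biprod.inr_snd, pull_id] at this
    exact this
  have h1 : T.Realizes (biprod.lift (-a) (𝟙 A)) (biprod.desc (𝟙 W) a) (0 : Grp T.E W A) :=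
    realizes_of_splitting biprod.snd biprod.inl (by simp) (by simp) (by simp)
      (by ext <;> simp)
  obtain ⟨N, h', d, e, δ'', h2, h3, h4, h5, -, -⟩ := T.et4 h1 h0
  refine ⟨N, d, e, h', δ'', ?_, ?_, ?_, h3⟩
  · simpa only [← push_comp, biprod.inr_desc] using h5
  · convert h4 using 1
    ext <;> simp
  · simpa using (congrArg (biprod.inl ≫ ·) h2).symm

end Realization

/-- Adding a morphism to a deflation gives a deflation. -/
lemma IsDeflation.desc {A B D : C} {y : B ⟶ D} (hy : T.IsDeflation y) (c : A ⟶ D) :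
    T.IsDeflation (biprod.desc c y) := by
  obtain ⟨K, x, δ, h⟩ := hy
  obtain ⟨N, d, e, k, δ'', -, h4, -⟩ := h.exists_weakPullback (-c)
  rw [neg_neg] at h4
  exact ⟨N, k, δ'', h4⟩

/-- `E`-projective morphisms lift through deflations. -/
lemma IsProjMor.exists_lift {A B D W : C} {x : A ⟶ B} {y : B ⟶ D} {c : W ⟶ D}
    (hc : T.IsProjMor c) (h : T.IsConflation x y) : ∃ g : W ⟶ B, g ≫ y = c := by
  obtain ⟨δ, h⟩ := h
  exact h.exists_lift c (hc A δ)

lemma isProjObj_iff_isProjMor_id {P : C} : T.IsProjObj P ↔ T.IsProjMor (𝟙 P) := by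
  refine ⟨fun h A δ => ?_, fun h A B D x y hxy f => ?_⟩
  · obtain ⟨B, x, y, hr⟩ := T.exists_realization δ
    obtain ⟨s, hs⟩ := h x y ⟨δ, hr⟩ (𝟙 P)
    rw [← hs, pull_comp, hr.pull_eq_zero, map_zero]
  · have hf : T.IsProjMor f := fun A δ => by
      rw [← Category.id_comp f, pull_comp, h]
    exact hf.exists_lift hxy

lemma IsProjMor.comp {A B D : C} {f : A ⟶ B} (hf : T.IsProjMor f) (g : B ⟶ D) :
    T.IsProjMor (f ≫ g) := fun W δ => by rw [pull_comp, hf]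

lemma IsProjMor.precomp {A B D : C} {g : B ⟶ D} (hg : T.IsProjMor g) (f : A ⟶ B) :
    T.IsProjMor (f ≫ g) := fun W δ => by rw [pull_comp, hg, map_zero]

end Extriangulation

end Extri

namespace Extri

open ZeroObject

/-! ### Exactness of the standard higher extension groups -/

section Tensor

variable {C : Type u} [SmallCategory C] {F G : Cᵒᵖ ⥤ C ⥤ AddCommGrpCat.{u}} {D D' A B B' : C}

/-- The pure tensor `η ⊗ δ` in `∫^B F(B, A) ⊗ G(D, B)`. -/
def tmul (η : Grp F B A) (δ : Grp G D B) : Grp (tensor F G) D A :=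
  (QuotientAddGroup.mk (FreeAbelianGroup.of ⟨B, (η, δ)⟩) : TensorGrp F G D A)

lemma tmul_eq_of_sub_rel {z w : FreeAbelianGroup (Σ B : C, Grp F B A × Grp G D B)}
    (h : TensorRel F G D A (z - w)) :
    (QuotientAddGroup.mk z : TensorGrp F G D A) = QuotientAddGroup.mk w := by
  rw [eq_comm, QuotientAddGroup.eq]
  rw [neg_add_eq_sub]
  exact AddSubgroup.subset_closure h

lemma add_tmul (η η' : Grp F B A) (δ : Grp G D B) :
    (tmul (η + η') δ : Grp (tensor F G) D A) = tmul η δ + tmul η' δ :=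
  tmul_eq_of_sub_rel (TensorRel.add_left B η η' δ)

lemma tmul_add (η : Grp F B A) (δ δ' : Grp G D B) :
    (tmul η (δ + δ') : Grp (tensor F G) D A) = tmul η δ + tmul η δ' :=
  tmul_eq_of_sub_rel (TensorRel.add_right B η δ δ')

lemma pull_tmul (f : B ⟶ B') (η : Grp F B' A) (δ : Grp G D B) :
    (tmul (pull F f η) δ : Grp (tensor F G) D A) = tmul η (push G f δ) :=
  tmul_eq_of_sub_rel (TensorRel.balanced B B' f η δ)

lemma tmul_zero (η : Grp F B A) : (tmul η (0 : Grp G D B) : Grp (tensor F G) D A) = 0 := by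
  simpa using tmul_add η (0 : Grp G D B) 0

lemma zero_tmul (δ : Grp G D B) : (tmul (0 : Grp F B A) δ : Grp (tensor F G) D A) = 0 := by
  simpa using add_tmul (0 : Grp F B A) 0 δ

lemma neg_tmul (η : Grp F B A) (δ : Grp G D B) :
    (tmul (-η) δ : Grp (tensor F G) D A) = -tmul η δ := by
  rw [eq_neg_iff_add_eq_zero, ← add_tmul, neg_add_cancel, zero_tmul]

lemma pull_tensor_tmul (c : D' ⟶ D) (η : Grp F B A) (δ : Grp G D B) :
    pull (tensor F G) c (tmul η δ) = tmul η (pull G c δ) := by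
  have : (tensorGen F G c (𝟙 A) ⟨B, (η, δ)⟩) = ⟨B, (η, pull G c δ)⟩ := by
    simp [tensorGen, push_id]
  change (QuotientAddGroup.mk (FreeAbelianGroup.map (tensorGen F G c (𝟙 A))
    (FreeAbelianGroup.of ⟨B, (η, δ)⟩)) : TensorGrp F G D' A) = _
  rw [FreeAbelianGroup.map_of_apply, this]
  rfl

end Tensor

namespace Extriangulation

variable {C : Type u} [SmallCategory C] [Preadditive C] [HasZeroObject C]
  [HasBinaryBiproducts C] (T : Extriangulation C)

/-- The properties of a bifunctor `F`, in its contravariant variable, which pass from `F` to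
`F ⊗ E`: it is additive, its elements are killed by deflations, and it is half exact on
conflations. -/
structure IsEffaceableHalfExact (F : Cᵒᵖ ⥤ C ⥤ AddCommGrpCat.{u}) : Prop where
  pull_add : ∀ {D D' A : C} (c c' : D' ⟶ D) (ω : Grp F D A),
    pull F (c + c') ω = pull F c ω + pull F c' ω
  effaceable : ∀ {D A : C} (ω : Grp F D A),
    ∃ (N : C) (p : N ⟶ D), T.IsDeflation p ∧ pull F p ω = 0
  half_exact : ∀ {A B D W : C} {x : A ⟶ B} {y : B ⟶ D} {δ : Grp T.E D A}, T.Realizes x y δ →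
    ∀ ω : Grp F B W, pull F x ω = 0 → ∃ ω' : Grp F D W, pull F y ω' = ω

variable {T} {F : Cᵒᵖ ⥤ C ⥤ AddCommGrpCat.{u}}

namespace IsEffaceableHalfExact

lemma pull_zero_hom (hF : T.IsEffaceableHalfExact F) {D D' A : C} (ω : Grp F D A) :
    pull F (0 : D' ⟶ D) ω = 0 := by
  simpa using hF.pull_add (0 : D' ⟶ D) 0 ω

lemma pull_neg_hom (hF : T.IsEffaceableHalfExact F) {D D' A : C} (c : D' ⟶ D) (ω : Grp F D A) :
    pull F (-c) ω = -pull F c ω := by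
  rw [eq_neg_iff_add_eq_zero, ← hF.pull_add, neg_add_cancel, hF.pull_zero_hom]

lemma pull_sub_hom (hF : T.IsEffaceableHalfExact F) {D D' A : C} (c c' : D' ⟶ D)
    (ω : Grp F D A) : pull F (c - c') ω = pull F c ω - pull F c' ω := by
  rw [sub_eq_add_neg, hF.pull_add, hF.pull_neg_hom, sub_eq_add_neg]

/-- Half exactness applied to the conflation of a pushout square. -/
lemma exists_pull_eq_of_push (hF : T.IsEffaceableHalfExact F) {A A' B D N W : C} {x : A ⟶ B}
    {y : B ⟶ D} {δ : Grp T.E D A} (h : T.Realizes x y δ) (a : A ⟶ A') {d : A' ⟶ N} {e : N ⟶ D}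
    (hde : T.Realizes d e (push T.E a δ)) (ω : Grp F A' W) (hω : pull F a ω = 0) :
    ∃ ω' : Grp F N W, pull F d ω' = ω := by
  obtain ⟨N', d', e', h', δ'', h1, h2, h3, -⟩ := h.exists_weakPushout a
  obtain ⟨ω', hω'⟩ := hF.half_exact h2 (pull F biprod.fst ω) (by
    rw [← pull_comp, biprod.lift_fst, hF.pull_neg_hom, hω, neg_zero])
  obtain ⟨b, hb, -⟩ := (T.realizes_iff _ _ hde).1 h1
  refine ⟨pull F b.hom ω', ?_⟩
  rw [← pull_comp, hb, ← h3, pull_comp, hω', ← pull_comp, biprod.inl_fst, pull_id]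

end IsEffaceableHalfExact

variable (T) in
lemma isEffaceableHalfExact_E : T.IsEffaceableHalfExact T.E where
  pull_add c c' ω := T.pull_add_hom c c' ω
  effaceable ω := by
    obtain ⟨B, x, y, h⟩ := T.exists_realization ω
    exact ⟨B, y, ⟨_, x, ω, h⟩, h.pull_eq_zero⟩
  half_exact h ω hω := h.exists_pull_eq ω hω

/-- Every element of `F ⊗ E` is a pure tensor. -/
lemma exists_eq_tmul {D A : C} (ζ : Grp (tensor F T.E) D A) :
    ∃ (B : C) (η : Grp F B A) (δ : Grp T.E D B), ζ = tmul η δ := by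
  obtain ⟨z, rfl⟩ := QuotientAddGroup.mk_surjective (ζ : TensorGrp F T.E D A)
  induction z using FreeAbelianGroup.induction_on with
  | zero => exact ⟨0, 0, 0, (zero_tmul (F := F) (G := T.E) (B := 0) 0).symm⟩
  | of t => exact ⟨t.1, t.2.1, t.2.2, rfl⟩
  | neg t h =>
    exact ⟨t.1, -t.2.1, t.2.2, (neg_tmul _ _).symm⟩
  | add z w hz hw =>
    obtain ⟨B, η, δ, hz⟩ := hz
    obtain ⟨B', η', δ', hw⟩ := hw
    refine ⟨B ⊞ B', pull F biprod.fst η + pull F biprod.snd η',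
      push T.E biprod.inl δ + push T.E biprod.inr δ', ?_⟩
    have : (QuotientAddGroup.mk (z + w) : TensorGrp F T.E D A)
      = QuotientAddGroup.mk z + QuotientAddGroup.mk w := rfl
    rw [this, hz, hw, add_tmul, tmul_add, tmul_add]
    simp only [pull_tmul, ← push_comp, biprod.inl_fst, biprod.inr_fst, biprod.inl_snd,
      biprod.inr_snd, push_id, push_zero_hom, tmul_zero, add_zero, zero_add]
    rfl

/-- For `θ ∈ E(D, B)`, the pairs of a formal sum of generators `η ⊗ (h · θ)` of `F ⊗ E` and of
the corresponding sum of the elements `η · h` of `F(B, A)`. -/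
def refinements (F : Cᵒᵖ ⥤ C ⥤ AddCommGrpCat.{u}) {D : C} (A : C) {B : C} (θ : Grp T.E D B) :
    AddSubgroup (FreeAbelianGroup (Σ B : C, Grp F B A × Grp T.E D B) × Grp F B A) :=
  AddSubgroup.closure {p | ∃ (B' : C) (h : B ⟶ B') (η : Grp F B' A),
    p = (FreeAbelianGroup.of ⟨B', (η, push T.E h θ)⟩, pull F h η)}

lemma of_mem_refinements {D A B B' : C} {θ : Grp T.E D B} (h : B ⟶ B') (η : Grp F B' A)
    {δ : Grp T.E D B'} (hδ : push T.E h θ = δ) :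
    (FreeAbelianGroup.of ⟨B', (η, δ)⟩, pull F h η) ∈ refinements F A θ :=
  AddSubgroup.subset_closure ⟨B', h, η, by rw [hδ]⟩

/-- A pair lying over `θ = k · θ₁` lies over `θ₁` once its value has been pulled back along `k`. -/
lemma refinements_pull {D A B B₁ : C} {θ : Grp T.E D B} {θ₁ : Grp T.E D B₁} (k : B₁ ⟶ B)
    (hk : push T.E k θ₁ = θ) {z : FreeAbelianGroup (Σ B : C, Grp F B A × Grp T.E D B)}
    {ω : Grp F B A} (h : (z, ω) ∈ refinements F A θ) :
    (z, pull F k ω) ∈ refinements F A θ₁ := by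
  have : refinements F A θ ≤ (refinements F A θ₁).comap
      (AddMonoidHom.prodMap (AddMonoidHom.id _) (pull F k)) := by
    refine (AddSubgroup.closure_le _).2 ?_
    rintro _ ⟨B', h, η, rfl⟩
    refine AddSubgroup.subset_closure ⟨B', k ≫ h, η, ?_⟩
    simp only [AddMonoidHom.prodMap, AddMonoidHom.prod_apply, AddMonoidHom.comp_apply,
      AddMonoidHom.coe_fst, AddMonoidHom.coe_snd, AddMonoidHom.id_apply]
    rw [push_comp, hk, pull_comp]
  exact this h

/-- If `B ⟶ M ⟶ D` realizes `θ`, elements of `F(B, A)` which come from `F(M, A)` are killed by a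
morphism along which `θ` lifts. -/
lemma exists_refinement (hF : T.IsEffaceableHalfExact F) {D A B M : C} {x : B ⟶ M} {y : M ⟶ D}
    {θ : Grp T.E D B} (h : T.Realizes x y θ) (η : Grp F M A) :
    ∃ (B₁ : C) (k : B₁ ⟶ B) (θ₁ : Grp T.E D B₁), push T.E k θ₁ = θ ∧
      pull F k (pull F x η) = 0 := by
  obtain ⟨N, p, ⟨L, l, δ, hp⟩, hη⟩ := hF.effaceable η
  obtain ⟨K, d, e, h', δ'', -, h3, -, -, h6, -⟩ := T.et4op hp h
  exact ⟨K, e, δ'', h6.symm, by rw [← pull_comp, ← h3, pull_comp, hη, map_zero]⟩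

/-- A formal sum of generators which is zero has the value zero in `F(B, A)`, after `θ` has been
lifted along a suitable morphism. The value of a generator `η ⊗ (h · θ)` depends on `h`, but any two
choices of `h` differ by a morphism which kills `θ`, and agree after a refinement. -/
lemma exists_kill_of_zero_mem_refinements (hF : T.IsEffaceableHalfExact F) {D A B : C}
    {θ : Grp T.E D B} {ω : Grp F B A} (h : (0, ω) ∈ refinements F A θ) :
    ∃ (B₁ : C) (k : B₁ ⟶ B) (θ₁ : Grp T.E D B₁), push T.E k θ₁ = θ ∧ pull F k ω = 0 := by
  classical
  obtain ⟨M, x, y, hM⟩ := T.exists_realization θ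
  -- a choice, for each generator lying over `θ`, of one of its values in `F(B, A)`
  let v : (Σ B : C, Grp F B A × Grp T.E D B) → Grp F B A := fun t =>
    if ht : ∃ h : B ⟶ t.1, push T.E h θ = t.2.2 then pull F ht.choose t.2.1 else 0
  let φ := FreeAbelianGroup.lift v
  -- the value does not depend on the choice, after refinement
  have key : ∀ p ∈ refinements F A θ,
      ∃ (B₁ : C) (k : B₁ ⟶ B) (θ₁ : Grp T.E D B₁), push T.E k θ₁ = θ ∧
        pull F k (p.2 - φ p.1) = 0 := by
    intro p hp
    induction hp using AddSubgroup.closure_induction with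
    | mem p hp =>
      obtain ⟨B', h, η, rfl⟩ := hp
      have ht : ∃ h' : B ⟶ B', push T.E h' θ = push T.E h θ := ⟨h, rfl⟩
      have hφ : φ (FreeAbelianGroup.of ⟨B', (η, push T.E h θ)⟩) = pull F ht.choose η := by
        simp only [φ, FreeAbelianGroup.lift_apply_of, v]
        exact dif_pos ht
      obtain ⟨g, hg⟩ := hM.exists_desc (h - ht.choose) (by
        rw [push_sub_hom, ht.choose_spec, sub_self])
      obtain ⟨B₁, k, θ₁, hk, hk'⟩ := exists_refinement hF hM (pull F g η)
      refine ⟨B₁, k, θ₁, hk, ?_⟩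
      rw [← pull_comp F g, hg, hF.pull_sub_hom] at hk'
      rw [hφ]
      exact hk'
    | zero => exact ⟨B, 𝟙 B, θ, push_id _ _, by simp⟩
    | add p q _ _ hp hq =>
      obtain ⟨B₁, k, θ₁, hk, hp⟩ := hp
      obtain ⟨B₂, l, θ₂, hl, hq⟩ := hq
      obtain ⟨M, x, y, hM⟩ := T.exists_realization
        (push T.E (biprod.inl : B₁ ⟶ B₁ ⊞ B₂) θ₁ + push T.E biprod.inr θ₂)
      -- both `θ₁` and `θ₂` lift to the kernel of `(k, -l)`, up to a further refinement
      obtain ⟨g, hg⟩ := hM.exists_desc (biprod.fst ≫ k - biprod.snd ≫ l) (by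
        simp only [map_add, ← push_comp, Preadditive.comp_sub, biprod.inl_fst_assoc,
          biprod.inr_fst_assoc, biprod.inl_snd_assoc, biprod.inr_snd_assoc, zero_comp,
          zero_sub, sub_zero, push_neg_hom, hk, hl, add_neg_cancel])
      obtain ⟨B₃, m, θ₃, hm, hm'⟩ := exists_refinement hF hM (pull F g (q.2 - φ q.1))
      refine ⟨B₃, m ≫ biprod.fst ≫ k, θ₃, ?_, ?_⟩
      · rw [push_comp, hm]
        simp only [map_add, ← push_comp, biprod.inl_fst_assoc,
          biprod.inr_fst_assoc, zero_comp, push_zero_hom, hk, add_zero]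
      · rw [← pull_comp F g, hg, hF.pull_sub_hom, map_sub, pull_comp F l, hq, map_zero, map_zero,
          sub_zero, ← pull_comp] at hm'
        have e : (p + q).2 - φ (p + q).1 = (p.2 - φ p.1) + (q.2 - φ q.1) := by
          rw [Prod.fst_add, Prod.snd_add, map_add]; abel
        rw [e, map_add, hm', pull_comp, pull_comp, hp, map_zero, map_zero, add_zero]
    | neg p _ hp =>
      obtain ⟨B₁, k, θ₁, hk, hp⟩ := hp
      refine ⟨B₁, k, θ₁, hk, ?_⟩
      have e : (-p).2 - φ (-p).1 = -(p.2 - φ p.1) := by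
        rw [Prod.fst_neg, Prod.snd_neg, map_neg]; abel
      rw [e, map_neg, hp, neg_zero]
  obtain ⟨B₁, k, θ₁, hk, h⟩ := key _ h
  exact ⟨B₁, k, θ₁, hk, by simpa using h⟩

/-- A pure tensor `ω ⊗ δ` vanishes only if `δ` lifts along a morphism which kills `ω`. -/
lemma exists_of_tmul_eq_zero (hF : T.IsEffaceableHalfExact F) {D A B : C} {ω : Grp F B A}
    {δ : Grp T.E D B} (h : (tmul ω δ : Grp (tensor F T.E) D A) = 0) :
    ∃ (B₁ : C) (k : B₁ ⟶ B) (θ₁ : Grp T.E D B₁), push T.E k θ₁ = δ ∧ pull F k ω = 0 := by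
  have h : (FreeAbelianGroup.of ⟨B, (ω, δ)⟩ :
      FreeAbelianGroup (Σ B : C, Grp F B A × Grp T.E D B)) ∈
      AddSubgroup.closure {z | TensorRel F T.E D A z} :=
    (QuotientAddGroup.eq_zero_iff _).1 h
  -- every relation is visible over a suitable `θ`
  have key : ∀ z ∈ AddSubgroup.closure {z | TensorRel F T.E D A z},
      ∃ (B' : C) (θ : Grp T.E D B'), (z, 0) ∈ refinements F A θ := by
    intro z hz
    induction hz using AddSubgroup.closure_induction with
    | mem z hz =>
      rcases hz with ⟨B, η, η', δ⟩ | ⟨B, η, δ, δ'⟩ | ⟨B, B', f, η, δ⟩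
      · refine ⟨B, δ, ?_⟩
        have := (refinements F A δ).sub_mem (of_mem_refinements (𝟙 B) (η + η') (push_id _ δ))
          ((refinements F A δ).add_mem (of_mem_refinements (𝟙 B) η (push_id _ δ))
            (of_mem_refinements (𝟙 B) η' (push_id _ δ)))
        simpa [pull_id] using this
      · have h1 : push T.E biprod.fst (push T.E (biprod.inl : B ⟶ B ⊞ B) δ +
            push T.E biprod.inr δ') = δ := by
          simp only [map_add, ← push_comp, biprod.inl_fst, biprod.inr_fst, push_id,
            push_zero_hom, add_zero]
        have h2 : push T.E biprod.snd (push T.E (biprod.inl : B ⟶ B ⊞ B) δ +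
            push T.E biprod.inr δ') = δ' := by
          simp only [map_add, ← push_comp, biprod.inl_snd, biprod.inr_snd, push_id,
            push_zero_hom, zero_add]
        refine ⟨B ⊞ B, push T.E biprod.inl δ + push T.E biprod.inr δ', ?_⟩
        have := (refinements F A _).sub_mem (of_mem_refinements
            (biprod.fst + biprod.snd : B ⊞ B ⟶ B) η (by rw [push_add_hom, h1, h2]))
          ((refinements F A _).add_mem (of_mem_refinements (F := F) _ η h1)
            (of_mem_refinements _ η h2))
        simpa [hF.pull_add] using this
      · refine ⟨B, δ, ?_⟩
        have := (refinements F A δ).sub_mem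
          (of_mem_refinements (𝟙 B) (pull F f η) (push_id _ δ)) (of_mem_refinements f η rfl)
        simpa [pull_id] using this
    | zero => exact ⟨0, 0, AddSubgroup.zero_mem _⟩
    | add z w _ _ hz hw =>
      obtain ⟨B, θ, hz⟩ := hz
      obtain ⟨B', θ', hw⟩ := hw
      refine ⟨B ⊞ B', push T.E biprod.inl θ + push T.E biprod.inr θ', ?_⟩
      have h1 := refinements_pull (θ₁ := push T.E (biprod.inl : B ⟶ B ⊞ B') θ +
        push T.E biprod.inr θ') biprod.fst (by
          simp only [map_add, ← push_comp, biprod.inl_fst, biprod.inr_fst, push_id,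
            push_zero_hom, add_zero]) hz
      have h2 := refinements_pull (θ₁ := push T.E (biprod.inl : B ⟶ B ⊞ B') θ +
        push T.E biprod.inr θ') biprod.snd (by
          simp only [map_add, ← push_comp, biprod.inl_snd, biprod.inr_snd, push_id,
            push_zero_hom, zero_add]) hw
      simpa using AddSubgroup.add_mem _ h1 h2
    | neg z _ hz =>
      obtain ⟨B, θ, hz⟩ := hz
      exact ⟨B, θ, by simpa using AddSubgroup.neg_mem _ hz⟩
  obtain ⟨B', θ, hθ⟩ := key _ h
  -- enlarge `θ` so that `δ` becomes an image of it
  have h1 := refinements_pull (θ₁ := push T.E (biprod.inl : B' ⟶ B' ⊞ B) θ +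
    push T.E biprod.inr δ) biprod.fst (by
      simp only [map_add, ← push_comp, biprod.inl_fst, biprod.inr_fst, push_id,
        push_zero_hom, add_zero]) hθ
  have e2 : push T.E biprod.snd (push T.E (biprod.inl : B' ⟶ B' ⊞ B) θ +
      push T.E biprod.inr δ) = δ := by
    simp only [map_add, ← push_comp, biprod.inl_snd, biprod.inr_snd, push_id,
      push_zero_hom, zero_add]
  have h2 := AddSubgroup.sub_mem _ (of_mem_refinements _ ω e2) h1
  rw [Prod.mk_sub_mk, sub_self, map_zero, sub_zero] at h2
  obtain ⟨B₁, k, θ₁, hk, hk'⟩ := exists_kill_of_zero_mem_refinements hF h2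
  exact ⟨B₁, k ≫ biprod.snd, θ₁, by rw [push_comp, hk, e2], by rw [pull_comp, hk']⟩

/-- Exactness of `F(B, -) → F(A, -) → (F ⊗ E)(D, -)` at the middle term. -/
lemma exists_pull_eq_of_tmul_eq_zero (hF : T.IsEffaceableHalfExact F) {A B D W : C} {x : A ⟶ B}
    {y : B ⟶ D} {δ : Grp T.E D A} (h : T.Realizes x y δ) (ω : Grp F A W)
    (hω : (tmul ω δ : Grp (tensor F T.E) D W) = 0) : ∃ ω' : Grp F B W, pull F x ω' = ω := by
  obtain ⟨A₁, k, θ, rfl, hk⟩ := exists_of_tmul_eq_zero hF hω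
  obtain ⟨M, u, v, hM⟩ := T.exists_realization θ
  exact hF.exists_pull_eq_of_push hM k h ω hk

lemma IsEffaceableHalfExact.tensor (hF : T.IsEffaceableHalfExact F) :
    T.IsEffaceableHalfExact (tensor F T.E) where
  pull_add c c' ω := by
    obtain ⟨B, η, δ, rfl⟩ := exists_eq_tmul ω
    simp only [pull_tensor_tmul, pull_add_hom, tmul_add]
  effaceable ω := by
    obtain ⟨B, η, δ, rfl⟩ := exists_eq_tmul ω
    obtain ⟨M, x, y, h⟩ := T.exists_realization δ
    exact ⟨M, y, ⟨_, x, δ, h⟩, by rw [pull_tensor_tmul, h.pull_eq_zero, tmul_zero]⟩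
  half_exact := by
    intro A B D W x y δ h ω hω
    obtain ⟨K, η, θ, rfl⟩ := exists_eq_tmul ω
    rw [pull_tensor_tmul] at hω
    obtain ⟨M, u, v, hM⟩ := T.exists_realization θ
    obtain ⟨N, d, e, h', μ, -, -, -, hde, -, hd⟩ := T.et4op hM h
    obtain ⟨η', rfl⟩ := exists_pull_eq_of_tmul_eq_zero hF hde η hω
    exact ⟨tmul η' μ, by rw [pull_tensor_tmul, ← hd, pull_tmul]⟩

variable (T) in
lemma isEffaceableHalfExact_higherExt (i : ℕ) : T.IsEffaceableHalfExact (T.higherExt i) := by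
  induction i with
  | zero => exact T.isEffaceableHalfExact_E
  | succ i ih => exact ih.tensor

/-- Dimension shift for a family of higher extension groups. -/
lemma IsHigherExtFamily.subsingleton {Ex : ℕ → Cᵒᵖ ⥤ C ⥤ AddCommGrpCat.{u}}
    (hEx : T.IsHigherExtFamily Ex) {A B D : C} {x : A ⟶ B} {y : B ⟶ D}
    (h : T.IsConflation x y) (i : ℕ) (W : C) (hB : ∀ ω : Grp (Ex i) B W, ω = 0)
    (hD : ∀ ω : Grp (Ex (i + 1)) D W, ω = 0) (ω : Grp (Ex i) A W) : ω = 0 := by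
  obtain ⟨δ, h⟩ := h
  have : ∃ ω' : Grp (Ex i) B W, pull (Ex i) x ω' = ω := by
    obtain rfl | ⟨⟨d⟩⟩ := hEx
    · exact exists_pull_eq_of_tmul_eq_zero (T.isEffaceableHalfExact_higherExt i) h ω (hD _)
    · exact ((d.exact_del h i W).2 ω).1 (hD _)
  obtain ⟨ω', rfl⟩ := this
  rw [hB ω', map_zero]

lemma IsHigherExtFamily.zero_eq {Ex : ℕ → Cᵒᵖ ⥤ C ⥤ AddCommGrpCat.{u}}
    (hEx : T.IsHigherExtFamily Ex) : Ex 0 = T.E := by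
  obtain rfl | ⟨⟨d⟩⟩ := hEx
  · rfl
  · exact d.one

end Extriangulation

end Extri

namespace Extri

/-! ### Exact categories inside abelian categories -/

section Exact

universe v w

variable {A : Type w} [Category.{v} A]

lemma isShortExactPair_iff_isKernelCokernelPair [inst : Preadditive A]
    (h : IsAbelianCategory A) {X Y Z : A} (i : X ⟶ Y) (p : Y ⟶ Z) :
    IsShortExactPair i p ↔ IsKernelCokernelPair i p := by
  obtain ⟨a, rfl⟩ := h
  constructor
  · rintro ⟨w, hS⟩
    exact ⟨w, ⟨hS.fIsKernel⟩, ⟨hS.gIsCokernel⟩⟩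
  · rintro ⟨w, ⟨h₁⟩, ⟨h₂⟩⟩
    refine ⟨w, ?_⟩
    have h₁' : IsLimit (KernelFork.ofι (ShortComplex.mk i p w).f (ShortComplex.mk i p w).zero) := h₁
    have h₂' : IsColimit
      (CokernelCofork.ofπ (ShortComplex.mk i p w).g (ShortComplex.mk i p w).zero) := h₂
    exact ShortComplex.ShortExact.mk' (ShortComplex.exact_of_f_is_kernel _ h₁')
      (Fork.IsLimit.mono h₁') (Cofork.IsColimit.epi h₂')

section Abelian

variable [Abelian A]

lemma IsShortExactPair.exists_lift {X Y Z W : A} {i : X ⟶ Y} {p : Y ⟶ Z}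
    (h : IsShortExactPair i p) (g : W ⟶ Y) (hg : g ≫ p = 0) : ∃ l : W ⟶ X, l ≫ i = g := by
  obtain ⟨w, h⟩ := h
  have := h.mono_f
  exact ⟨h.exact.lift g hg, h.exact.lift_f g hg⟩

lemma IsShortExactPair.exists_desc {X Y Z W : A} {i : X ⟶ Y} {p : Y ⟶ Z}
    (h : IsShortExactPair i p) (g : Y ⟶ W) (hg : i ≫ g = 0) : ∃ l : Z ⟶ W, p ≫ l = g := by
  obtain ⟨w, h⟩ := h
  have := h.epi_g
  exact ⟨h.exact.desc g hg, h.exact.g_desc g hg⟩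

lemma IsShortExactPair.mono {X Y Z : A} {i : X ⟶ Y} {p : Y ⟶ Z}
    (h : IsShortExactPair i p) : Mono i := h.2.mono_f

lemma IsShortExactPair.epi {X Y Z : A} {i : X ⟶ Y} {p : Y ⟶ Z}
    (h : IsShortExactPair i p) : Epi p := h.2.epi_g

lemma IsShortExactPair.of_refinements {X Y Z : A} {i : X ⟶ Y} {p : Y ⟶ Z} (w : i ≫ p = 0)
    (hi : Mono i) (hp : Epi p) (h : ∀ ⦃T : A⦄ (y : T ⟶ Y), y ≫ p = 0 →
      ∃ (T' : A) (π : T' ⟶ T) (_ : Epi π) (x : T' ⟶ X), π ≫ y = x ≫ i) :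
    IsShortExactPair i p :=
  ⟨w, ShortComplex.ShortExact.mk' ((ShortComplex.exact_iff_exact_up_to_refinements _).2 h) hi hp⟩

lemma isShortExactPair_kernel {X Y : A} (p : X ⟶ Y) [hp : Epi p] :
    IsShortExactPair (kernel.ι p) p :=
  ⟨kernel.condition p, ShortComplex.ShortExact.mk'
    (ShortComplex.exact_of_f_is_kernel _ (kernelIsKernel p)) inferInstance hp⟩

lemma isShortExactPair_of_iso {X Y Z X' Y' Z' : A} {i : X ⟶ Y} {p : Y ⟶ Z}
    {i' : X' ⟶ Y'} {p' : Y' ⟶ Z'} (a : X ≅ X') (b : Y ≅ Y') (c : Z ≅ Z')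
    (h₁ : i ≫ b.hom = a.hom ≫ i') (h₂ : p ≫ c.hom = b.hom ≫ p') (h : IsShortExactPair i p) :
    IsShortExactPair i' p' := by
  obtain ⟨w, h⟩ := h
  have w' : i' ≫ p' = 0 := by
    rw [← cancel_epi a.hom, ← reassoc_of% h₁, ← h₂, reassoc_of% w, zero_comp, comp_zero]
  exact ⟨w', ShortComplex.shortExact_of_iso (ShortComplex.isoMk a b c h₁.symm h₂.symm) h⟩

/-- In a pushout square, parallel morphisms have the same cokernel. -/
lemma IsShortExactPair.pushout {X Y Z X' Y' : A} {i : X ⟶ Y} {p : Y ⟶ Z}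
    (h : IsShortExactPair i p) {f : X ⟶ X'} {f' : Y ⟶ Y'} {i' : X' ⟶ Y'}
    (sq : IsPushout i f f' i') : ∃ p' : Y' ⟶ Z, IsShortExactPair i' p' ∧ f' ≫ p' = p := by
  have := h.epi
  have : Mono i' := MorphismProperty.of_isPushout (P := MorphismProperty.monomorphisms A)
    sq.flip h.mono
  refine ⟨sq.desc p 0 (by rw [h.1, comp_zero]), ?_, sq.inl_desc _ _ _⟩
  refine IsShortExactPair.of_refinements (sq.inr_desc _ _ _) this
    (epi_of_epi_fac (sq.inl_desc _ _ _)) (fun T y hy => ?_)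
  obtain ⟨T₁, π, hπ, b, a, e⟩ := sq.hom_eq_add_up_to_refinements y
  have hb : b ≫ p = 0 := by
    have := e =≫ sq.desc p 0 (by rw [h.1, comp_zero])
    simpa [hy] using this.symm
  obtain ⟨l, rfl⟩ := h.exists_lift b hb
  exact ⟨T₁, π, hπ, l ≫ f + a, by rw [e, Category.assoc, sq.w, Preadditive.add_comp,
    Category.assoc]⟩

/-- In a pullback square, parallel morphisms have the same kernel. -/
lemma IsShortExactPair.pullback {X Y Z Y' Z' : A} {i : X ⟶ Y} {p : Y ⟶ Z}
    (h : IsShortExactPair i p) {f : Z' ⟶ Z} {f' : Y' ⟶ Y} {p' : Y' ⟶ Z'}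
    (sq : IsPullback f' p' p f) : ∃ i' : X ⟶ Y', IsShortExactPair i' p' ∧ i' ≫ f' = i := by
  have := h.mono
  have : Epi p' := MorphismProperty.of_isPullback (P := MorphismProperty.epimorphisms A)
    sq h.epi
  refine ⟨sq.lift i 0 (by rw [h.1, zero_comp]), ?_, sq.lift_fst _ _ _⟩
  refine IsShortExactPair.of_refinements (sq.lift_snd _ _ _)
    (mono_of_mono_fac (sq.lift_fst _ _ _)) this (fun T y hy => ?_)
  obtain ⟨l, hl⟩ := h.exists_lift (y ≫ f') (by
    rw [Category.assoc, sq.w, reassoc_of% hy, zero_comp])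
  refine ⟨T, 𝟙 T, inferInstance, l, ?_⟩
  apply sq.hom_ext
  · simp [hl]
  · simp [hy]

variable (P : ObjectProperty A)

/-- The pairs of morphisms of a full subcategory which are short exact in the ambient abelian
category. -/
def shortExactIn : PairClass P.FullSubcategory := fun _ _ _ i p => IsShortExactPair i.hom p.hom

variable {P}

lemma shortExactIn_isKernelCokernelPair {X Y Z : P.FullSubcategory} (i : X ⟶ Y) (p : Y ⟶ Z)
    (h : shortExactIn P i p) : IsKernelCokernelPair i p := by
  have := h.mono
  have := h.epi
  refine ⟨by ext; exact h.1, ⟨KernelFork.IsLimit.ofι i _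
      (fun g hg => ObjectProperty.homMk (h.exists_lift g.hom (congrArg (·.hom) hg)).choose)
      (fun g hg => ?_) (fun g hg m hm => ?_)⟩,
    ⟨CokernelCofork.IsColimit.ofπ p _
      (fun g hg => ObjectProperty.homMk (h.exists_desc g.hom (congrArg (·.hom) hg)).choose)
      (fun g hg => ?_) (fun g hg m hm => ?_)⟩⟩
  · ext; exact (h.exists_lift g.hom (congrArg (·.hom) hg)).choose_spec
  · ext
    rw [← cancel_mono i.hom]
    exact (congrArg (·.hom) hm).trans
      (h.exists_lift g.hom (congrArg (·.hom) hg)).choose_spec.symm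
  · ext; exact (h.exists_desc g.hom (congrArg (·.hom) hg)).choose_spec
  · ext
    rw [← cancel_epi p.hom]
    exact (congrArg (·.hom) hm).trans
      (h.exists_desc g.hom (congrArg (·.hom) hg)).choose_spec.symm

/-- For a full subcategory closed under kernels and cokernels the two notions of short exact
sequences agree. -/
lemma shortExactIn_iff_isShortExactPair [P.ContainsZero] [P.IsClosedUnderKernels]
    [P.IsClosedUnderCokernels] [P.IsClosedUnderFiniteProducts] {X Y Z : P.FullSubcategory}
    (i : X ⟶ Y) (p : Y ⟶ Z) : shortExactIn P i p ↔ IsShortExactPair i p := by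
  have hab : IsAbelianCategory P.FullSubcategory := ⟨inferInstance, rfl⟩
  constructor
  · intro h
    exact (isShortExactPair_iff_isKernelCokernelPair hab i p).2
      (shortExactIn_isKernelCokernelPair i p h)
  · rintro ⟨w, h⟩
    have := P.preservesMonomorphisms_ι_of_isNormalEpiCategory
    have := P.preservesEpimorphisms_ι_of_isNormalMonoCategory
    have := P.preservesKernels_ι p
    have := h.mono_f
    have := h.epi_g
    have w' : i.hom ≫ p.hom = 0 := congrArg (·.hom) w
    refine ⟨w', ShortComplex.ShortExact.mk' ?_ (inferInstanceAs (Mono (P.ι.map i)))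
      (inferInstanceAs (Epi (P.ι.map p)))⟩
    exact ShortComplex.exact_of_f_is_kernel _
      (KernelFork.mapIsLimit _ h.fIsKernel P.ι)

lemma closedUnderFiniteProducts_of_extensions [P.ContainsZero] [P.IsClosedUnderExtensions]
    [P.IsClosedUnderIsomorphisms] : P.IsClosedUnderFiniteProducts := by
  have : P.IsClosedUnderBinaryProducts := by
    refine ⟨?_⟩
    rintro X ⟨p⟩
    have e : X ≅ p.diag.obj ⟨.left⟩ ⊞ p.diag.obj ⟨.right⟩ :=
      p.isLimit.conePointUniqueUpToIso (limit.isLimit p.diag) ≪≫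
        HasLimit.isoOfNatIso (diagramIsoPair p.diag) ≪≫ (biprod.isoProd _ _).symm
    exact P.prop_of_iso e.symm (P.prop_biprod (p.prop_diag_obj _) (p.prop_diag_obj _))
  exact ObjectProperty.IsClosedUnderFiniteProducts.mk'

/-- The cokernel of an admissible monomorphism may be taken in the ambient category. -/
lemma admissibleMono_shortExactIn_iff [P.IsClosedUnderIsomorphisms] {X Y : P.FullSubcategory}
    (i : X ⟶ Y) : AdmissibleMono (shortExactIn P) i ↔
      ∃ (Z : A) (p : Y.obj ⟶ Z), P Z ∧ IsShortExactPair i.hom p :=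
  ⟨fun ⟨Z, p, h⟩ => ⟨Z.obj, p.hom, Z.property, h⟩,
    fun ⟨Z, p, hZ, h⟩ => ⟨⟨Z, hZ⟩, ObjectProperty.homMk p, h⟩⟩

/-- A full subcategory of an abelian category which is closed under extensions is an exact
category. -/
theorem isExactCategory_shortExactIn [P.ContainsZero] [P.IsClosedUnderExtensions]
    [P.IsClosedUnderIsomorphisms] : IsExactCategory (shortExactIn P) where
  additive := by
    have := closedUnderFiniteProducts_of_extensions (P := P)
    exact HasFiniteBiproducts.of_hasFiniteProducts
  kernel_cokernel _ _ _ i p h := shortExactIn_isKernelCokernelPair i p h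
  iso_closed := by
    intro X Y Z X' Y' Z' i p i' p' a b c h₁ h₂ h
    exact isShortExactPair_of_iso (P.ι.mapIso a) (P.ι.mapIso b) (P.ι.mapIso c)
      (congrArg (·.hom) h₁) (congrArg (·.hom) h₂) h
  id_mono X := by
    obtain ⟨Z, hZ, hPZ⟩ := P.exists_prop_of_containsZero
    refine ⟨⟨Z, hPZ⟩, ObjectProperty.homMk 0, IsShortExactPair.of_refinements (by simp)
      (inferInstanceAs (Mono (𝟙 X.obj))) ⟨fun _ _ _ => hZ.eq_of_src _ _⟩
      (fun T y _ => ⟨T, 𝟙 T, inferInstance, y, by simp⟩)⟩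
  id_epi X := by
    obtain ⟨Z, hZ, hPZ⟩ := P.exists_prop_of_containsZero
    refine ⟨⟨Z, hPZ⟩, ObjectProperty.homMk 0, IsShortExactPair.of_refinements (by simp)
      ⟨fun _ _ _ => hZ.eq_of_tgt _ _⟩ (inferInstanceAs (Epi (𝟙 X.obj)))
      (fun T y hy => ⟨T, 𝟙 T, inferInstance, 0, ?_⟩)⟩
    have : y = 0 := by simpa using hy
    simp [this]
  comp_mono := by
    rintro X Y Z i j ⟨U, p, hp⟩ ⟨V, q, hq⟩
    -- the cokernel of the composition is the pushout of `p` along `j`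
    have sq := IsPushout.of_hasPushout j.hom p.hom
    obtain ⟨q', hq', e⟩ := hq.pushout sq
    have hP : P (Limits.pushout j.hom p.hom) :=
      P.prop_X₂_of_shortExact hq'.2 U.property V.property
    have := hp.mono
    have := hq.mono
    have := hp.epi
    refine (admissibleMono_shortExactIn_iff _).2 ⟨_, pushout.inl j.hom p.hom, hP,
      IsShortExactPair.of_refinements ?_ (inferInstanceAs (Mono (i.hom ≫ j.hom)))
        (inferInstanceAs (Epi (pushout.inl j.hom p.hom)))
        (fun T y hy => ?_)⟩
    · rw [ObjectProperty.FullSubcategory.comp_hom, Category.assoc, pushout.condition,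
        reassoc_of% hp.1, zero_comp]
    · obtain ⟨l, rfl⟩ := hq.exists_lift y (by rw [← e, reassoc_of% hy, zero_comp])
      have : l ≫ p.hom = 0 := by
        have := hq'.mono
        rw [← cancel_mono (pushout.inr j.hom p.hom), Category.assoc, ← pushout.condition,
          ← Category.assoc, hy, zero_comp]
      obtain ⟨m, rfl⟩ := hp.exists_lift l this
      exact ⟨T, 𝟙 T, inferInstance, m, by simp⟩
  comp_epi := by
    rintro X Y Z p q ⟨U, i, hp⟩ ⟨V, j, hq⟩
    -- the kernel of the composition is the pullback of `j` along `p`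
    have sq := IsPullback.of_hasPullback p.hom j.hom
    obtain ⟨i', hi', e⟩ := hp.pullback sq
    have hP : P (Limits.pullback p.hom j.hom) :=
      P.prop_X₂_of_shortExact hi'.2 U.property V.property
    have := hp.epi
    have := hq.epi
    have := hq.mono
    refine ⟨⟨_, hP⟩, ObjectProperty.homMk (pullback.fst p.hom j.hom),
      IsShortExactPair.of_refinements ?_ (inferInstanceAs (Mono (pullback.fst p.hom j.hom)))
        (inferInstanceAs (Epi (p.hom ≫ q.hom))) (fun T y hy => ?_)⟩
    · change pullback.fst p.hom j.hom ≫ p.hom ≫ q.hom = 0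
      rw [pullback.condition_assoc, hq.1, comp_zero]
    · obtain ⟨l, hl⟩ := hq.exists_lift (y ≫ p.hom) (by simpa using hy)
      exact ⟨T, 𝟙 T, inferInstance, pullback.lift y l hl.symm, by
        rw [Category.id_comp]; exact (pullback.lift_fst _ _ _).symm⟩
  pushout := by
    rintro X Y X' i f ⟨U, p, hp⟩
    have sq := IsPushout.of_hasPushout i.hom f.hom
    obtain ⟨p', hp', -⟩ := hp.pushout sq
    have hP : P (Limits.pushout i.hom f.hom) :=
      P.prop_X₂_of_shortExact hp'.2 X'.property U.property
    refine ⟨⟨_, hP⟩, ObjectProperty.homMk (pushout.inl _ _),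
      ObjectProperty.homMk (pushout.inr _ _), ?_, ⟨U, ObjectProperty.homMk p', hp'⟩⟩
    exact IsPushout.of_map P.ι (by ext; exact sq.w) sq
  pullback := by
    rintro Y Z Z' p f ⟨U, i, hp⟩
    have sq := IsPullback.of_hasPullback p.hom f.hom
    obtain ⟨i', hi', -⟩ := hp.pullback sq
    have hP : P (Limits.pullback p.hom f.hom) :=
      P.prop_X₂_of_shortExact hi'.2 U.property Z'.property
    refine ⟨⟨_, hP⟩, ObjectProperty.homMk (pullback.fst _ _),
      ObjectProperty.homMk (pullback.snd _ _), ?_, ⟨U, ObjectProperty.homMk i', hi'⟩⟩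
    exact IsPullback.of_map P.ι (by ext; exact sq.w) sq

end Abelian

/-! ### Transport along equivalences -/

section Transport

universe v' w'

variable {D : Type w'} [Category.{v'} D] [Preadditive A] [Preadditive D]

lemma isKernelCokernelPair_of_map (G : D ⥤ A) [G.Additive] [G.Full] [G.Faithful] {X Y Z : D}
    {i : X ⟶ Y} {p : Y ⟶ Z} (h : IsKernelCokernelPair (G.map i) (G.map p)) :
    IsKernelCokernelPair i p := by
  obtain ⟨w, ⟨h₁⟩, ⟨h₂⟩⟩ := h
  have w' : i ≫ p = 0 := G.map_injective (by simpa using w)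
  refine ⟨w', ⟨?_⟩, ⟨?_⟩⟩
  · exact isLimitOfReflects G ((KernelFork.isLimitMapConeEquiv _ G).symm h₁)
  · exact isColimitOfReflects G ((CokernelCofork.isColimitMapCoconeEquiv _ G).symm h₂)

lemma isKernelCokernelPair_map_iff (G : D ⥤ A) [G.Additive] [G.IsEquivalence] {X Y Z : D}
    (i : X ⟶ Y) (p : Y ⟶ Z) :
    IsKernelCokernelPair (G.map i) (G.map p) ↔ IsKernelCokernelPair i p := by
  refine ⟨isKernelCokernelPair_of_map G, ?_⟩
  rintro ⟨w, ⟨h₁⟩, ⟨h₂⟩⟩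
  exact ⟨by rw [← G.map_comp, w, G.map_zero], ⟨KernelFork.mapIsLimit _ h₁ G⟩,
    ⟨CokernelCofork.mapIsColimit _ h₂ G⟩⟩

lemma isAbelianCategory_of_isEquivalence (G : D ⥤ A) [G.Additive] [G.IsEquivalence]
    (h : IsAbelianCategory A) : IsAbelianCategory D := by
  obtain ⟨a, rfl⟩ := h
  have : HasFiniteProducts D := ⟨fun _ => Adjunction.hasLimitsOfShape_of_equivalence G⟩
  exact ⟨abelianOfEquivalence G, rfl⟩

lemma admissibleMono_of_map {ε : PairClass A} (hε : IsExactCategory ε) (G : D ⥤ A) [G.Additive]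
    [G.IsEquivalence] {X Y : D} {i : X ⟶ Y} (h : AdmissibleMono ε (G.map i)) :
    AdmissibleMono (fun _ _ _ i p => ε (G.map i) (G.map p) : PairClass D) i := by
  obtain ⟨Z, p, h⟩ := h
  refine ⟨G.objPreimage Z, G.preimage (p ≫ (G.objObjPreimageIso Z).inv), ?_⟩
  refine hε.iso_closed _ _ _ _ (Iso.refl _) (Iso.refl _) (G.objObjPreimageIso Z).symm ?_ ?_ h
  · simp
  · simp

lemma admissibleEpi_of_map {ε : PairClass A} (hε : IsExactCategory ε) (G : D ⥤ A) [G.Additive]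
    [G.IsEquivalence] {Y Z : D} {p : Y ⟶ Z} (h : AdmissibleEpi ε (G.map p)) :
    AdmissibleEpi (fun _ _ _ i p => ε (G.map i) (G.map p) : PairClass D) p := by
  obtain ⟨X, i, h⟩ := h
  refine ⟨G.objPreimage X, G.preimage ((G.objObjPreimageIso X).hom ≫ i), ?_⟩
  refine hε.iso_closed _ _ _ _ (G.objObjPreimageIso X).symm (Iso.refl _) (Iso.refl _) ?_ ?_ h
  · simp
  · simp

/-- Exact structures can be transported along equivalences. -/
theorem IsExactCategory.of_isEquivalence {ε : PairClass A} (hε : IsExactCategory ε) (G : D ⥤ A)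
    [G.Additive] [G.IsEquivalence] :
    IsExactCategory (fun _ _ _ i p => ε (G.map i) (G.map p) : PairClass D) where
  additive := by
    have := hε.additive
    have : HasFiniteProducts D := ⟨fun _ => Adjunction.hasLimitsOfShape_of_equivalence G⟩
    exact HasFiniteBiproducts.of_hasFiniteProducts
  kernel_cokernel _ _ _ i p h := isKernelCokernelPair_of_map G (hε.kernel_cokernel _ _ h)
  iso_closed := by
    intro X Y Z X' Y' Z' i p i' p' a b c h₁ h₂ h
    refine hε.iso_closed _ _ _ _ (G.mapIso a) (G.mapIso b) (G.mapIso c) ?_ ?_ h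
    · simp only [Functor.mapIso_hom, ← G.map_comp, h₁]
    · simp only [Functor.mapIso_hom, ← G.map_comp, h₂]
  id_mono X := admissibleMono_of_map hε G (by rw [G.map_id]; exact hε.id_mono _)
  id_epi X := admissibleEpi_of_map hε G (by rw [G.map_id]; exact hε.id_epi _)
  comp_mono := by
    rintro X Y Z i j ⟨U, p, hp⟩ ⟨V, q, hq⟩
    exact admissibleMono_of_map hε G (by
      rw [G.map_comp]; exact hε.comp_mono _ _ ⟨_, _, hp⟩ ⟨_, _, hq⟩)
  comp_epi := by
    rintro X Y Z p q ⟨U, i, hp⟩ ⟨V, j, hq⟩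
    exact admissibleEpi_of_map hε G (by
      rw [G.map_comp]; exact hε.comp_epi _ _ ⟨_, _, hp⟩ ⟨_, _, hq⟩)
  pushout := by
    rintro X Y X' i f ⟨U, p, hp⟩
    obtain ⟨B, f', i', sq, C, q, hq⟩ := hε.pushout (G.map i) (G.map f) ⟨_, _, hp⟩
    let e := (G.objObjPreimageIso B).symm
    refine ⟨G.objPreimage B, G.preimage (f' ≫ e.hom), G.preimage (i' ≫ e.hom), ?_, ?_⟩
    · refine IsPushout.of_map G (G.map_injective ?_) ?_
      · simp [sq.w_assoc]
      · exact IsPushout.of_iso sq (Iso.refl _) (Iso.refl _) (Iso.refl _) e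
          (by simp) (by simp) (by simp) (by simp)
    · refine admissibleMono_of_map hε G ⟨C, e.inv ≫ q, ?_⟩
      exact hε.iso_closed _ _ _ _ (Iso.refl _) e (Iso.refl _) (by simp) (by simp) hq
  pullback := by
    rintro Y Z Z' p f ⟨U, i, hp⟩
    obtain ⟨B, f', p', sq, C, j, hj⟩ := hε.pullback (G.map p) (G.map f) ⟨_, _, hp⟩
    let e := (G.objObjPreimageIso B).symm
    refine ⟨G.objPreimage B, G.preimage (e.inv ≫ f'), G.preimage (e.inv ≫ p'), ?_, ?_⟩
    · refine IsPullback.of_map G (G.map_injective ?_) ?_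
      · simp [sq.w]
      · exact IsPullback.of_iso sq e (Iso.refl _) (Iso.refl _) (Iso.refl _)
          (by simp) (by simp) (by simp) (by simp)
    · refine admissibleEpi_of_map hε G ⟨C, j ≫ e.hom, ?_⟩
      exact hε.iso_closed _ _ _ _ (Iso.refl _) e (Iso.refl _) (by simp) (by simp) hj

end Transport

end Exact

end Extri

namespace Extri

/-! ### Objects presented by projective objects -/

open ZeroObject

section Presented

universe v w

variable {A : Type w} [Category.{v} A]

/-- There is an epimorphism onto `K` from an object of `U`. -/
def Covered (U : ObjectProperty A) : ObjectProperty A := fun K =>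
  ∃ (P : A) (p : P ⟶ K), U P ∧ Epi p

lemma Covered.of_epi {U : ObjectProperty A} {K L : A} (h : Covered U K) (f : K ⟶ L) [Epi f] :
    Covered U L := by
  obtain ⟨P, p, hP, hp⟩ := h
  exact ⟨P, p ≫ f, hP, inferInstance⟩

variable [Abelian A]

/-- The objects `G` with an exact sequence `P₀ ⟶ P₁ ⟶ G ⟶ 0`, where `P₀` is in `U₀` and `P₁` is
in `U₁`. -/
def Presented (U₀ U₁ : ObjectProperty A) : ObjectProperty A := fun G =>
  ∃ (P : A) (p : P ⟶ G), U₁ P ∧ Epi p ∧ Covered U₀ (kernel p)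

/-- A class of projective objects which contains the zero objects and is closed under binary
biproducts. -/
structure IsProjectiveClass (U : ObjectProperty A) : Prop where
  projective : ∀ P, U P → Projective P
  biprod : ∀ P Q, U P → U Q → U (P ⊞ Q)
  zero : ∀ P, IsZero P → U P

variable {U U₀ U₁ : ObjectProperty A}

/-- An extension of covered objects is covered: the covering of the quotient lifts. -/
lemma Covered.of_isShortExactPair (hU : IsProjectiveClass U) {X Y Z : A} {i : X ⟶ Y} {p : Y ⟶ Z}
    (h : IsShortExactPair i p) (hX : Covered U X) (hZ : Covered U Z) : Covered U Y := by
  obtain ⟨P, f, hP, hf⟩ := hX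
  obtain ⟨Q, g, hQ, hg⟩ := hZ
  have := hU.projective Q hQ
  have := h.epi
  refine ⟨P ⊞ Q, biprod.desc (f ≫ i) (Projective.factorThru g p), hU.biprod P Q hP hQ, ?_⟩
  rw [epi_iff_surjective_up_to_refinements]
  intro T y
  obtain ⟨T₁, π₁, _, b, hb⟩ := surjective_up_to_refinements_of_epi g (y ≫ p)
  obtain ⟨l, hl⟩ := h.exists_lift (π₁ ≫ y - b ≫ Projective.factorThru g p) (by
    simp [hb])
  obtain ⟨T₂, π₂, _, a, ha⟩ := surjective_up_to_refinements_of_epi f l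
  refine ⟨T₂, π₂ ≫ π₁, inferInstance, biprod.lift a (π₂ ≫ b), ?_⟩
  rw [biprod.lift_desc, Category.assoc, ← reassoc_of% ha, hl]
  simp

instance : (Presented U₀ U₁).IsClosedUnderIsomorphisms where
  of_iso := by
    rintro G G' e ⟨P, p, hP, hp, hk⟩
    exact ⟨P, p ≫ e.hom, hP, inferInstance, hk.of_epi (kernelCompMono p e.hom).inv⟩

lemma Presented.of_isZero (hU₀ : IsProjectiveClass U₀) (hU₁ : IsProjectiveClass U₁) {Z : A}
    (hZ : IsZero Z) : Presented U₀ U₁ Z :=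
  ⟨Z, 𝟙 Z, hU₁.zero Z hZ, inferInstance, kernel (𝟙 Z), 𝟙 _,
    hU₀.zero _ (hZ.of_mono (kernel.ι (𝟙 Z))), inferInstance⟩

lemma presented_containsZero (hU₀ : IsProjectiveClass U₀) (hU₁ : IsProjectiveClass U₁) :
    (Presented U₀ U₁).ContainsZero :=
  ⟨0, isZero_zero A, Presented.of_isZero hU₀ hU₁ (isZero_zero A)⟩

/-- The horseshoe lemma. -/
lemma presented_closedUnderExtensions (hU₀ : IsProjectiveClass U₀)
    (hU₁ : IsProjectiveClass U₁) : (Presented U₀ U₁).IsClosedUnderExtensions where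
  prop_X₂_of_shortExact := by
    rintro ⟨i, p, w⟩ hS ⟨P, f, hP, hf, hfk⟩ ⟨Q, g, hQ, hg, hgk⟩
    have h : IsShortExactPair i p := ⟨w, hS⟩
    dsimp at *
    have := h.epi
    have := h.mono
    have := hU₁.projective Q hQ
    have hm : biprod.desc (f ≫ i) (Projective.factorThru g p) ≫ p = biprod.snd ≫ g := by
      ext <;> simp [w]
    refine ⟨P ⊞ Q, biprod.desc (f ≫ i) (Projective.factorThru g p), hU₁.biprod P Q hP hQ,
      ?_, ?_⟩
    · rw [epi_iff_surjective_up_to_refinements]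
      intro T y
      obtain ⟨T₁, π₁, _, b, hb⟩ := surjective_up_to_refinements_of_epi g (y ≫ p)
      obtain ⟨l, hl⟩ := h.exists_lift (π₁ ≫ y - b ≫ Projective.factorThru g p) (by
        simp [hb])
      obtain ⟨T₂, π₂, _, a, ha⟩ := surjective_up_to_refinements_of_epi f l
      refine ⟨T₂, π₂ ≫ π₁, inferInstance, biprod.lift a (π₂ ≫ b), ?_⟩
      rw [biprod.lift_desc, Category.assoc, ← reassoc_of% ha, hl]
      simp
    · -- the kernels form a short exact sequence
      let j : kernel f ⟶ kernel (biprod.desc (f ≫ i) (Projective.factorThru g p)) :=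
        kernel.lift _ (kernel.ι f ≫ biprod.inl) (by simp)
      let q : kernel (biprod.desc (f ≫ i) (Projective.factorThru g p)) ⟶ kernel g :=
        kernel.lift _ (kernel.ι _ ≫ biprod.snd) (by
          rw [Category.assoc, ← hm, kernel.condition_assoc, zero_comp])
      have hj : j ≫ kernel.ι _ = kernel.ι f ≫ biprod.inl := kernel.lift_ι _ _ _
      have hq : q ≫ kernel.ι _ = kernel.ι _ ≫ biprod.snd := kernel.lift_ι _ _ _
      refine Covered.of_isShortExactPair hU₀ (i := j) (p := q) ?_ hfk hgk
      refine IsShortExactPair.of_refinements ?_ ?_ ?_ ?_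
      · rw [← cancel_mono (kernel.ι g), Category.assoc, hq, reassoc_of% hj]
        simp
      · have : Mono (j ≫ kernel.ι _) := by rw [hj]; infer_instance
        exact mono_of_mono j (kernel.ι _)
      · rw [epi_iff_surjective_up_to_refinements]
        intro T y
        obtain ⟨l, hl⟩ := h.exists_lift (y ≫ kernel.ι g ≫ Projective.factorThru g p) (by simp)
        obtain ⟨T₁, π, _, a, ha⟩ := surjective_up_to_refinements_of_epi f l
        refine ⟨T₁, π, inferInstance, kernel.lift _
          (biprod.lift (-a) (π ≫ y ≫ kernel.ι g)) ?_, ?_⟩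
        · rw [biprod.lift_desc, Preadditive.neg_comp, ← reassoc_of% ha, hl]
          simp
        · rw [← cancel_mono (kernel.ι g)]
          simp [hq]
      · intro T y hy
        have hy' : (y ≫ kernel.ι _) ≫ biprod.snd = 0 := by
          rw [Category.assoc, ← hq, reassoc_of% hy, zero_comp]
        have e : y ≫ kernel.ι _ = ((y ≫ kernel.ι _) ≫ biprod.fst) ≫ biprod.inl := by
          ext
          · simp
          · simpa using hy'
        refine ⟨T, 𝟙 T, inferInstance, kernel.lift f ((y ≫ kernel.ι _) ≫ biprod.fst) ?_, ?_⟩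
        · have := congrArg (· ≫ biprod.desc (f ≫ i) (Projective.factorThru g p)) e
          simp only [Category.assoc, kernel.condition, comp_zero, biprod.inl_desc] at this
          rw [← cancel_mono i, zero_comp]
          simpa using this.symm
        · rw [← cancel_mono (kernel.ι _), Category.id_comp, Category.assoc, hj,
            kernel.lift_ι_assoc]
          exact e

/-- For an epimorphism `p`, the sequence `0 ⟶ ker p ⟶ ker (p ≫ f) ⟶ ker f ⟶ 0` is exact. -/
lemma isShortExactPair_kernel_comp {P G H : A} (p : P ⟶ G) [Epi p] (f : G ⟶ H) :
    IsShortExactPair (kernel.lift (p ≫ f) (kernel.ι p) (by simp))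
      (kernel.lift f (kernel.ι (p ≫ f) ≫ p) (by simp)) := by
  refine IsShortExactPair.of_refinements ?_ ?_ ?_ ?_
  · rw [← cancel_mono (kernel.ι f)]
    simp
  · exact mono_of_mono_fac (kernel.lift_ι (p ≫ f) (kernel.ι p) (by simp))
  · rw [epi_iff_surjective_up_to_refinements]
    intro T y
    obtain ⟨T₁, π, _, a, ha⟩ := surjective_up_to_refinements_of_epi p (y ≫ kernel.ι f)
    refine ⟨T₁, π, inferInstance, kernel.lift _ a ?_, ?_⟩
    · rw [← reassoc_of% ha]
      simp
    · rw [← cancel_mono (kernel.ι f)]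
      simp [ha]
  · intro T y hy
    refine ⟨T, 𝟙 T, inferInstance, kernel.lift p (y ≫ kernel.ι _) ?_, ?_⟩
    · have := congrArg (· ≫ kernel.ι f) hy
      simpa using this
    · rw [← cancel_mono (kernel.ι _)]
      simp

/-- A class of projective objects is coherent if the kernels of the morphisms between its objects
are covered by its objects. -/
def IsCoherentClass (U : ObjectProperty A) : Prop :=
  ∀ ⦃P Q : A⦄ (f : P ⟶ Q), U P → U Q → Covered U (kernel f)

/-- Over a coherent class, a finitely presented object is presented by each covering of it. -/
lemma Presented.covered_kernel (hU : IsProjectiveClass U) (hc : IsCoherentClass U) {G Q : A}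
    (hG : Presented U U G) (hQ : U Q) (q : Q ⟶ G) : Covered U (kernel q) := by
  obtain ⟨P, g, hP, hg, P₁, r, hP₁, hr⟩ := hG
  have := hU.projective Q hQ
  -- the kernel of `Q ⊞ P₁ ⟶ P` maps onto the kernel of `q`
  let φ : Q ⊞ P₁ ⟶ P := biprod.desc (Projective.factorThru q g) (r ≫ kernel.ι g)
  have hφ : φ ≫ g = biprod.fst ≫ q := by
    ext <;> simp [φ]
  have := hc φ (hU.biprod _ _ hQ hP₁) hP
  let ψ : kernel φ ⟶ kernel q := kernel.lift q (kernel.ι φ ≫ biprod.fst) (by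
    rw [Category.assoc, ← hφ, kernel.condition_assoc, zero_comp])
  have : Epi ψ := by
    rw [epi_iff_surjective_up_to_refinements]
    intro T t
    obtain ⟨T₁, π, _, a, ha⟩ := surjective_up_to_refinements_of_epi r
      (kernel.lift g (t ≫ kernel.ι q ≫ Projective.factorThru q g) (by simp))
    have ha' := congrArg (· ≫ kernel.ι g) ha
    simp only [Category.assoc, kernel.lift_ι] at ha'
    refine ⟨T₁, π, inferInstance, kernel.lift φ (biprod.lift (π ≫ t ≫ kernel.ι q) (-a)) ?_, ?_⟩
    · simp [φ, ha']
    · rw [← cancel_mono (kernel.ι q)]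
      simp [ψ]
  exact Covered.of_epi ‹_› ψ

lemma presented_closedUnderKernels (hU : IsProjectiveClass U) (hc : IsCoherentClass U) :
    (Presented U U).IsClosedUnderKernels where
  kernels_le := by
    rintro _ ⟨f, k, hk, hG, hG'⟩
    refine (Presented U U).prop_of_iso
      (IsLimit.conePointUniqueUpToIso (kernelIsKernel f) hk) ?_
    change Presented U U (kernel f)
    obtain ⟨P, g, hP, hg, hgk⟩ := id hG
    have hS := isShortExactPair_kernel_comp g f
    have := hS.epi
    obtain ⟨R, r, hR, hr⟩ := (hG'.covered_kernel hU hc hP (g ≫ f)).of_epi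
      (kernel.lift f (kernel.ι (g ≫ f) ≫ g) _)
    exact ⟨R, r, hR, hr, (hG.covered_kernel hU hc hR (r ≫ kernel.ι f)).of_epi
      (kernelCompMono r (kernel.ι f)).hom⟩

lemma presented_closedUnderCokernels (hU : IsProjectiveClass U) :
    (Presented U U).IsClosedUnderCokernels where
  cokernels_le := by
    rintro _ ⟨f, k, hk, hG, hG'⟩
    refine (Presented U U).prop_of_iso
      (IsColimit.coconePointUniqueUpToIso (cokernelIsCokernel f) hk) ?_
    change Presented U U (cokernel f)
    obtain ⟨P, g, hP, hg, hgk⟩ := hG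
    obtain ⟨P', g', hP', hg', hgk'⟩ := hG'
    refine ⟨P', g' ≫ cokernel.π f, hP', inferInstance, ?_⟩
    refine Covered.of_isShortExactPair hU (isShortExactPair_kernel_comp g' (cokernel.π f)) hgk' ?_
    exact ⟨P, g ≫ Abelian.factorThruImage f, hP, inferInstance⟩

end Presented

end Extri

namespace Extri

/-! ### The abelian category of modules -/

section Modules

open ZeroObject

variable {Z : Type u} [SmallCategory Z]

lemma isShortExactPair_functor_iff {F G H : Zᵒᵖ ⥤ AddCommGrpCat.{u}} (f : F ⟶ G) (g : G ⟶ H) :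
    IsShortExactPair f g ↔ ∀ z, Function.Injective (f.app z).hom ∧
      Function.Exact (f.app z).hom (g.app z).hom ∧ Function.Surjective (g.app z).hom := by
  constructor
  · rintro ⟨w, h⟩ z
    have := h.map_of_exact ((evaluation _ _).obj z)
    exact ⟨(AddCommGrpCat.mono_iff_injective _).1 this.mono_f,
      (ShortComplex.ab_exact_iff_function_exact _).1 this.exact,
      (AddCommGrpCat.epi_iff_surjective _).1 this.epi_g⟩
  · intro h
    have w : f ≫ g = 0 := by
      ext z x
      exact (h z).2.1.apply_apply_eq_zero x
    have : ∀ z, Mono (f.app z) := fun z => (AddCommGrpCat.mono_iff_injective _).2 (h z).1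
    have : ∀ z, Epi (g.app z) := fun z => (AddCommGrpCat.epi_iff_surjective _).2 (h z).2.2
    refine ⟨w, ShortComplex.ShortExact.mk' ?_ (NatTrans.mono_of_mono_app _)
      (NatTrans.epi_of_epi_app _)⟩
    rw [ShortComplex.exact_iff_isZero_homology, Functor.isZero_iff]
    intro z
    have hz : ((ShortComplex.mk f g w).map ((evaluation _ _).obj z)).Exact :=
      (ShortComplex.ab_exact_iff_function_exact _).2 (h z).2.1
    rw [ShortComplex.exact_iff_isZero_homology] at hz
    exact hz.of_iso ((ShortComplex.mk f g w).mapHomologyIso ((evaluation _ _).obj z)).symm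

variable [Preadditive Z]

instance : (additiveFunctor Zᵒᵖ AddCommGrpCat.{u}).IsClosedUnderSubobjects where
  prop_of_mono {F G} i _ hG := by
    have : G.Additive := hG
    refine ⟨fun {X Y} f g => ?_⟩
    rw [← cancel_mono (i.app Y)]
    simp

instance : (additiveFunctor Zᵒᵖ AddCommGrpCat.{u}).IsClosedUnderQuotients where
  prop_of_epi {F G} p _ hF := by
    have : F.Additive := hF
    refine ⟨fun {X Y} f g => ?_⟩
    rw [← cancel_epi (p.app X)]
    simp [← NatTrans.naturality]

instance : (additiveFunctor Zᵒᵖ AddCommGrpCat.{u}).ContainsZero :=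
  ⟨0, isZero_zero _, ⟨fun {X _} _ _ =>
    ((isZero_zero (Zᵒᵖ ⥤ AddCommGrpCat.{u})).obj X).eq_of_src _ _⟩⟩

instance : (additiveFunctor Zᵒᵖ AddCommGrpCat.{u}).IsClosedUnderFiniteProducts where
  isClosedUnderLimitsOfShape J _ := by
    refine ⟨?_⟩
    rintro F ⟨p⟩
    refine ⟨fun {X Y} f g => ?_⟩
    refine (isLimitOfPreserves ((evaluation _ _).obj Y) p.isLimit).hom_ext (fun j => ?_)
    have : (p.diag.obj j).Additive := p.prop_diag_obj j
    change F.map (f + g) ≫ (p.π.app j).app Y = (F.map f + F.map g) ≫ (p.π.app j).app Y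
    simp

/-- Additive functors form a full subcategory of the functor category which is closed under finite
products, kernels and cokernels. -/
noncomputable instance : Abelian (RightMod Z) :=
  inferInstanceAs (Abelian (additiveFunctor Zᵒᵖ AddCommGrpCat.{u}).FullSubcategory)

lemma modShortExact_iff_isShortExactPair {L M N : RightMod Z} (f : L ⟶ M) (g : M ⟶ N) :
    ModShortExact f g ↔ IsShortExactPair f g :=
  (isShortExactPair_functor_iff f.hom g.hom).symm.trans
    (shortExactIn_iff_isShortExactPair (P := additiveFunctor Zᵒᵖ AddCommGrpCat.{u}) f g)

lemma inducedPairs_eq_shortExactIn (P : ObjectProperty (RightMod Z)) :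
    inducedPairs P = shortExactIn P := by
  funext L M N f g
  exact propext (modShortExact_iff_isShortExactPair f.hom g.hom)

lemma closedUnderExtensions_of_isClosedUnderExtensions (P : ObjectProperty (RightMod Z))
    [P.IsClosedUnderExtensions] : ClosedUnderExtensions P := by
  intro L M N f g h hL hN
  exact P.prop_X₂_of_shortExact ((modShortExact_iff_isShortExactPair f g).1 h).2 hL hN

lemma epi_iff_surjective_app {M N : RightMod Z} (g : M ⟶ N) :
    Epi g ↔ ∀ z, Function.Surjective (g.hom.app z).hom := by
  constructor
  · intro h z
    exact ((modShortExact_iff_isShortExactPair _ _).2 (isShortExactPair_kernel g) z).2.2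
  · intro h
    have : ∀ z, Epi (g.hom.app z) := fun z => (AddCommGrpCat.epi_iff_surjective _).2 (h z)
    have : Epi g.hom := NatTrans.epi_of_epi_app _
    exact (additiveFunctor Zᵒᵖ AddCommGrpCat.{u}).ι.epi_of_epi_map this

/-! ### Representable modules -/

/-- A morphism `V ⟶ A`, as an element of `Z(V, A)`. -/
def repElt {V A : Z} (f : V ⟶ A) : (rep A).obj.obj (op V) := f

lemma repElt_surjective {A : Z} {z : Zᵒᵖ} (x : (rep A).obj.obj z) :
    ∃ f : z.unop ⟶ A, repElt f = x := ⟨x, rfl⟩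

lemma repElt_injective {V A : Z} {f g : V ⟶ A} (h : repElt f = repElt g) : f = g := h

lemma rep_map_repElt {V W A : Z} (f : V ⟶ A) (h : W ⟶ V) :
    ((rep A).obj.map h.op).hom (repElt f) = repElt (h ≫ f) := rfl

/-- The morphism out of a representable module which corresponds to an element, by the Yoneda
lemma. -/
noncomputable def repDesc {A : Z} {M : RightMod Z} (x : M.obj.obj (op A)) : rep A ⟶ M :=
  ObjectProperty.homMk
    { app := fun z => AddCommGrpCat.ofHom
        { toFun := fun f : z.unop ⟶ A => (M.obj.map f.op).hom x
          map_zero' := by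
            change (M.obj.map (0 : z.unop ⟶ A).op).hom x = _
            rw [op_zero, M.obj.map_zero]; rfl
          map_add' := fun (f g : z.unop ⟶ A) => by
            change (M.obj.map (f + g).op).hom x = _
            rw [op_add, M.obj.map_add]; rfl }
      naturality := fun z z' h => by
        ext f
        exact DFunLike.congr_fun (congrArg AddCommGrpCat.Hom.hom
          (M.obj.map_comp (Quiver.Hom.op (Y := A) f) h)) x }

lemma repDesc_repElt {V A : Z} {M : RightMod Z} (x : M.obj.obj (op A)) (f : V ⟶ A) :
    ((repDesc x).hom.app (op V)).hom (repElt f) = (M.obj.map f.op).hom x := rfl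

lemma map_id_apply (M : RightMod Z) (A : Z) (x : M.obj.obj (op A)) :
    (M.obj.map (𝟙 A).op).hom x = x :=
  DFunLike.congr_fun (congrArg AddCommGrpCat.Hom.hom (M.obj.map_id (op A))) x

lemma hom_naturality_apply {M N : RightMod Z} (φ : M ⟶ N) {V W : Z} (h : W ⟶ V)
    (x : M.obj.obj (op V)) :
    (φ.hom.app (op W)).hom ((M.obj.map h.op).hom x) =
      (N.obj.map h.op).hom ((φ.hom.app (op V)).hom x) :=
  DFunLike.congr_fun (congrArg AddCommGrpCat.Hom.hom (φ.hom.naturality h.op)) x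

lemma hom_repElt {V A : Z} {M : RightMod Z} (φ : rep A ⟶ M) (f : V ⟶ A) :
    (φ.hom.app (op V)).hom (repElt f) =
      (M.obj.map f.op).hom ((φ.hom.app (op A)).hom (repElt (𝟙 A))) := by
  rw [← hom_naturality_apply, rep_map_repElt, Category.comp_id]

lemma rep_hom_ext {A : Z} {M : RightMod Z} {φ ψ : rep A ⟶ M}
    (h : (φ.hom.app (op A)).hom (repElt (𝟙 A)) = (ψ.hom.app (op A)).hom (repElt (𝟙 A))) :
    φ = ψ := by
  ext z x
  obtain ⟨f, rfl⟩ := repElt_surjective x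
  exact (hom_repElt φ f).trans ((congrArg _ h).trans (hom_repElt ψ f).symm)

instance projective_rep (A : Z) : Projective (rep A) where
  factors {M N} f e he := by
    obtain ⟨x, hx⟩ := (epi_iff_surjective_app e).1 he (op A)
      ((f.hom.app (op A)).hom (repElt (𝟙 A)))
    refine ⟨repDesc x, rep_hom_ext ?_⟩
    change (e.hom.app (op A)).hom (((repDesc x).hom.app (op A)).hom (repElt (𝟙 A))) = _
    rw [repDesc_repElt, map_id_apply, hx]

variable (Z) in
/-- The Yoneda embedding of `Z` into its category of modules. -/
noncomputable def repFunctor : Z ⥤ RightMod Z :=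
  (additiveFunctor Zᵒᵖ AddCommGrpCat.{u}).lift preadditiveYoneda
    (fun A => (AdditiveFunctor.of (preadditiveYoneda.obj A)).property)

/-- The morphism of representable modules induced by a morphism. -/
noncomputable def repMap {A B : Z} (f : A ⟶ B) : rep A ⟶ rep B := (repFunctor Z).map f

lemma repMap_repElt {V A B : Z} (f : A ⟶ B) (g : V ⟶ A) :
    ((repMap f).hom.app (op V)).hom (repElt g) = repElt (g ≫ f) := rfl

lemma repMap_comp {A B W : Z} (f : A ⟶ B) (g : B ⟶ W) :
    repMap (f ≫ g) = repMap f ≫ repMap g := (repFunctor Z).map_comp f g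

instance : (repFunctor Z).Additive where
  map_add {A B f g} := by
    refine rep_hom_ext (A := A) (M := rep B) ?_
    change 𝟙 A ≫ (f + g) = 𝟙 A ≫ f + 𝟙 A ≫ g
    rw [Preadditive.comp_add]

lemma repMap_zero (A B : Z) : repMap (0 : A ⟶ B) = 0 := (repFunctor Z).map_zero A B

lemma repMap_injective {A B : Z} {f g : A ⟶ B} (h : repMap f = repMap g) : f = g := by
  have := congrArg (fun t => (t.hom.app (op A)).hom (repElt (𝟙 A))) h
  simp only [repMap_repElt, Category.id_comp] at this
  exact repElt_injective this

lemma exists_repMap_eq {A B : Z} (φ : rep A ⟶ rep B) : ∃ f : A ⟶ B, repMap f = φ := by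
  obtain ⟨f, hf⟩ := repElt_surjective ((φ.hom.app (op A)).hom (repElt (𝟙 A)))
  refine ⟨f, rep_hom_ext ?_⟩
  rw [repMap_repElt, Category.id_comp, ← hf]

/-- The modules represented by the objects of `P`. -/
def repClass (P : ObjectProperty Z) : ObjectProperty (RightMod Z) := fun R =>
  ∃ A : Z, P A ∧ Nonempty (R ≅ rep A)

/-- A class of objects which contains a zero object and, up to isomorphism, is closed under binary
biproducts. -/
structure IsAdditiveClass [HasBinaryBiproducts Z] (P : ObjectProperty Z) : Prop where
  zero : ∃ W : Z, P W ∧ IsZero W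
  biprod : ∀ A B : Z, P A → P B → ∃ W : Z, P W ∧ Nonempty (A ⊞ B ≅ W)

lemma IsAdditiveClass.isProjectiveClass [HasBinaryBiproducts Z] {P : ObjectProperty Z}
    (hP : IsAdditiveClass P) : IsProjectiveClass (repClass P) where
  projective := by
    rintro R ⟨A, hA, ⟨e⟩⟩
    exact Projective.of_iso e.symm inferInstance
  biprod := by
    rintro R S ⟨A, hA, ⟨e⟩⟩ ⟨B, hB, ⟨e'⟩⟩
    obtain ⟨W, hW, ⟨i⟩⟩ := hP.biprod A B hA hB
    have := preservesBinaryBiproducts_of_preservesBiproducts (repFunctor Z)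
    exact ⟨W, hW, ⟨biprod.mapIso e e' ≪≫ ((repFunctor Z).mapBiprod A B).symm ≪≫
      (repFunctor Z).mapIso i⟩⟩
  zero R hR := by
    obtain ⟨W, hW, h⟩ := hP.zero
    exact ⟨W, hW, ⟨hR.iso ((repFunctor Z).map_isZero h)⟩⟩

lemma rightExactPair_kernel {P M N : RightMod Z} (p : P ⟶ M) (g : M ⟶ N) [Epi g]
    (h : p ≫ g = 0) [hp : Epi (kernel.lift g p h)] : RightExactPair p g := by
  intro z
  have h₁ := (modShortExact_iff_isShortExactPair _ _).2 (isShortExactPair_kernel g) z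
  have h₂ := (epi_iff_surjective_app _).1 hp z
  refine ⟨fun x => ⟨fun hx => ?_, ?_⟩, h₁.2.2⟩
  · obtain ⟨y, rfl⟩ := (h₁.2.1 x).1 hx
    obtain ⟨w, rfl⟩ := h₂ y
    refine ⟨w, ?_⟩
    conv_lhs => rw [← kernel.lift_ι g p h]
    rfl
  · rintro ⟨w, rfl⟩
    exact DFunLike.congr_fun (congrArg (fun t => (t.hom.app z).hom) h) w

lemma RightExactPair.epi {P M N : RightMod Z} {p : P ⟶ M} {g : M ⟶ N}
    (h : RightExactPair p g) : Epi g :=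
  (epi_iff_surjective_app g).2 fun z => (h z).2

lemma RightExactPair.comp_eq_zero {P M N : RightMod Z} {p : P ⟶ M} {g : M ⟶ N}
    (h : RightExactPair p g) : p ≫ g = 0 := by
  ext z x
  exact (h z).1.apply_apply_eq_zero x

lemma RightExactPair.epi_lift {P M N : RightMod Z} {p : P ⟶ M} {g : M ⟶ N}
    (h : RightExactPair p g) : Epi (kernel.lift g p h.comp_eq_zero) := by
  have := h.epi
  rw [epi_iff_surjective_app]
  intro z y
  have h₁ := (modShortExact_iff_isShortExactPair _ _).2 (isShortExactPair_kernel g) z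
  obtain ⟨w, hw⟩ := ((h z).1 (((kernel.ι g).hom.app z).hom y)).1 (h₁.2.1.apply_apply_eq_zero y)
  refine ⟨w, h₁.1 ?_⟩
  rw [← hw]
  conv_rhs => rw [← kernel.lift_ι g p h.comp_eq_zero]
  rfl

lemma presented_iff_rightExactPair (U₀ U₁ : ObjectProperty (RightMod Z)) (G : RightMod Z) :
    Presented U₀ U₁ G ↔ ∃ (P Q : RightMod Z) (f : P ⟶ Q) (g : Q ⟶ G),
      U₀ P ∧ U₁ Q ∧ RightExactPair f g := by
  constructor
  · rintro ⟨Q, g, hQ, hg, P, p, hP, hp⟩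
    have hl : kernel.lift g (p ≫ kernel.ι g) (by simp) = p := by
      rw [← cancel_mono (kernel.ι g), kernel.lift_ι]
    have : Epi (kernel.lift g (p ≫ kernel.ι g) (by simp)) := by rwa [hl]
    exact ⟨P, Q, p ≫ kernel.ι g, g, hP, hQ, rightExactPair_kernel _ _ _⟩
  · rintro ⟨P, Q, f, g, hP, hQ, h⟩
    exact ⟨Q, g, hQ, h.epi, P, _, hP, h.epi_lift⟩

lemma RightExactPair.of_iso {P Q P' Q' M : RightMod Z} {f : P ⟶ Q} {g : Q ⟶ M} (a : P' ≅ P)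
    (b : Q' ≅ Q) (h : RightExactPair f g) :
    RightExactPair (a.hom ≫ f ≫ b.inv) (b.hom ≫ g) := by
  have := h.epi
  have := h.epi_lift
  have e : kernel.lift (b.hom ≫ g) (a.hom ≫ f ≫ b.inv) (by simp [h.comp_eq_zero]) =
      a.hom ≫ kernel.lift g f h.comp_eq_zero ≫
        (kernel.map _ _ b.inv (𝟙 M) (by simp)) := by
    rw [← cancel_mono (kernel.ι _)]
    simp
  have : Epi (kernel.lift (b.hom ≫ g) (a.hom ≫ f ≫ b.inv) (by simp [h.comp_eq_zero])) := by
    rw [e]; infer_instance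
  exact rightExactPair_kernel _ _ _

lemma IsProjectiveClass.free_le {A : Type*} [Category* A] [Abelian A] {U : ObjectProperty A}
    [U.IsClosedUnderIsomorphisms] (hU : IsProjectiveClass U) : free U ≤ U := by
  have : U.ContainsZero := ⟨0, isZero_zero A, hU.zero 0 (isZero_zero A)⟩
  have : U.IsClosedUnderBinaryCoproducts := by
    refine ⟨?_⟩
    rintro X ⟨p⟩
    have e : p.diag.obj ⟨.left⟩ ⊞ p.diag.obj ⟨.right⟩ ≅ X :=
      (biprod.isoCoprod _ _) ≪≫ (HasColimit.isoOfNatIso (diagramIsoPair p.diag)).symm ≪≫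
        (p.isColimit.coconePointUniqueUpToIso (colimit.isColimit p.diag)).symm
    exact U.prop_of_iso e (hU.biprod _ _ (p.prop_diag_obj _) (p.prop_diag_obj _))
  have : U.IsClosedUnderFiniteCoproducts := ObjectProperty.IsClosedUnderFiniteCoproducts.mk'
  rintro M ⟨m, Y, j, hY, ⟨h⟩⟩
  exact U.prop_of_isColimit_cofan h hY

lemma le_free {D : Type*} [Category* D] (P : ObjectProperty D) : P ≤ free P := fun A hA =>
  ⟨1, fun _ => A, fun _ => 𝟙 A, fun _ => hA,
    ⟨Cofan.IsColimit.mk _ (fun s => s.inj 0)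
      (fun s i => by rw [Subsingleton.elim i 0]; exact Category.id_comp _)
      (fun s f hf => (Category.id_comp f).symm.trans (hf 0))⟩⟩

instance (P : ObjectProperty Z) : (repClass P).IsClosedUnderIsomorphisms where
  of_iso := by
    rintro R S e ⟨A, hA, ⟨i⟩⟩
    exact ⟨A, hA, ⟨e.symm ≪≫ i⟩⟩

lemma isAdditiveClass_top [HasZeroObject Z] [HasBinaryBiproducts Z] :
    IsAdditiveClass (⊤ : ObjectProperty Z) where
  zero := ⟨0, trivial, isZero_zero Z⟩
  biprod A B _ _ := ⟨A ⊞ B, trivial, ⟨Iso.refl _⟩⟩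

/-- Over a category with finite biproducts, finitely presented modules are presented by
representable modules. -/
lemma fp_eq_presented [HasZeroObject Z] [HasBinaryBiproducts Z] :
    (fp : ObjectProperty (RightMod Z)) = Presented (repClass ⊤) (repClass ⊤) := by
  have hU : (fun R : RightMod Z => ∃ A : Z, Nonempty (R ≅ rep A)) = repClass ⊤ := by
    funext R
    simp [repClass]
  have hf : free (repClass (⊤ : ObjectProperty Z)) = repClass ⊤ :=
    le_antisymm isAdditiveClass_top.isProjectiveClass.free_le (le_free _)
  funext G
  rw [presented_iff_rightExactPair]
  simp only [fp, hU, hf]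

lemma presented_repClass_iff (P Q : ObjectProperty Z) (G : RightMod Z) :
    Presented (repClass P) (repClass Q) G ↔ ∃ (A B : Z) (f : rep A ⟶ rep B) (g : rep B ⟶ G),
      P A ∧ Q B ∧ RightExactPair f g := by
  rw [presented_iff_rightExactPair]
  constructor
  · rintro ⟨R, S, f, g, ⟨A, hA, ⟨a⟩⟩, ⟨B, hB, ⟨b⟩⟩, h⟩
    exact ⟨A, B, _, _, hA, hB, h.of_iso a.symm b.symm⟩
  · rintro ⟨A, B, f, g, hA, hB, h⟩
    exact ⟨rep A, rep B, f, g, ⟨A, hA, ⟨Iso.refl _⟩⟩, ⟨B, hB, ⟨Iso.refl _⟩⟩, h⟩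

/-- Weak kernels in `Z` make the class of representable modules coherent. -/
lemma isCoherentClass_repClass_top
    (h : ∀ ⦃A B : Z⦄ (f : A ⟶ B), ∃ (W : Z) (k : W ⟶ A), k ≫ f = 0 ∧
      ∀ ⦃V : Z⦄ (g : V ⟶ A), g ≫ f = 0 → ∃ l : V ⟶ W, l ≫ k = g) :
    IsCoherentClass (repClass (⊤ : ObjectProperty Z)) := by
  rintro R S φ ⟨A, -, ⟨a⟩⟩ ⟨B, -, ⟨b⟩⟩
  obtain ⟨f, hf⟩ := exists_repMap_eq (a.inv ≫ φ ≫ b.hom)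
  have hφ : φ = a.hom ≫ repMap f ≫ b.inv := by rw [hf]; simp
  obtain ⟨W, k, hk, hk'⟩ := h f
  have w : (repMap k ≫ a.inv) ≫ φ = 0 := by
    rw [hφ, Category.assoc, a.inv_hom_id_assoc, ← Category.assoc, ← repMap_comp, hk,
      repMap_zero, zero_comp]
  refine ⟨rep W, kernel.lift φ (repMap k ≫ a.inv) w, ⟨W, trivial, ⟨Iso.refl _⟩⟩, ?_⟩
  rw [epi_iff_surjective_app]
  rintro ⟨V⟩ x
  -- the element `x` of the kernel is a morphism killed by `f`
  obtain ⟨g, hg⟩ := exists_repMap_eq (repDesc x ≫ kernel.ι φ ≫ a.hom)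
  have hgf : g ≫ f = 0 := by
    apply repMap_injective
    rw [repMap_comp, hg, repMap_zero, ← cancel_mono b.inv]
    simp only [Category.assoc, ← hφ, kernel.condition, comp_zero, zero_comp]
  obtain ⟨l, hl⟩ := hk' g hgf
  have e : repMap l ≫ kernel.lift φ (repMap k ≫ a.inv) w = repDesc x := by
    rw [← cancel_mono (kernel.ι φ), Category.assoc, kernel.lift_ι, ← Category.assoc,
      ← repMap_comp, hl, hg]
    simp
  refine ⟨repElt l, ?_⟩
  have := congrArg (fun t => (t.hom.app (op V)).hom (repElt (𝟙 V))) e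
  refine Eq.trans ?_ (this.trans ?_)
  · change _ = ((kernel.lift φ (repMap k ≫ a.inv) w).hom.app (op V)).hom
      (((repMap l).hom.app (op V)).hom (repElt (𝟙 V)))
    rw [repMap_repElt, Category.id_comp]
  · rw [repDesc_repElt, map_id_apply]

end Modules

end Extri

namespace Extri

/-! ### Coresolutions by a rigid class -/

section Coresolutions

open ZeroObject

lemma IsFree.of_iso {D : Type*} [Category* D] {P : ObjectProperty D} [IsFree P] {A B : D}
    (e : A ≅ B) (hA : P A) : P B :=
  IsFree.of_isColimit (m := 1) (Y := fun _ => A) (fun _ => e.hom) (fun _ => hA)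
    (Cofan.IsColimit.mk _ (fun s => e.inv ≫ s.inj 0)
      (fun s i => by rw [Subsingleton.elim i 0]; exact e.hom_inv_id_assoc _)
      (fun s f hf => by rw [← hf 0]; exact (e.inv_hom_id_assoc f).symm))

namespace Extriangulation

variable {C : Type u} [SmallCategory C] [Preadditive C] [HasZeroObject C]
  [HasBinaryBiproducts C] {T : Extriangulation C}

lemma isConflation_id_zero (A : C) : T.IsConflation (𝟙 A) (0 : A ⟶ (0 : C)) :=
  ⟨0, T.realizes_zero_right A⟩

lemma IsConflation.transport {A B D A' D' : C} {x : A ⟶ B} {y : B ⟶ D} (h : T.IsConflation x y)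
    (a : A ≅ A') (d : D ≅ D') : T.IsConflation (a.inv ≫ x) (y ≫ d.hom) := by
  obtain ⟨δ, h⟩ := h
  exact ⟨_, h.transport a d⟩

lemma IsConflation.biprod {A B D A' B' D' : C} {x : A ⟶ B} {y : B ⟶ D} {x' : A' ⟶ B'}
    {y' : B' ⟶ D'} (h : T.IsConflation x y) (h' : T.IsConflation x' y') :
    T.IsConflation (biprod.map x x') (biprod.map y y') := by
  obtain ⟨δ, h⟩ := h
  obtain ⟨δ', h'⟩ := h'
  exact ⟨_, T.realizes_sum h h'⟩

variable {X : ObjectProperty C}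

lemma HasCoresolution.of_iso {m : ℕ} {A B : C} (e : A ≅ B) (h : T.HasCoresolution X m A) :
    T.HasCoresolution X m B := by
  cases m with
  | zero =>
    obtain ⟨Y, hY, ⟨i⟩⟩ := h
    exact ⟨Y, hY, ⟨e.symm ≪≫ i⟩⟩
  | succ m =>
    obtain ⟨Y, K, x, y, hY, hK, hxy⟩ := h
    exact ⟨Y, K, _, _, hY, hK, hxy.transport e (Iso.refl K)⟩

lemma le_cores (m : ℕ) : X ≤ T.Cores X m := fun A hA =>
  ⟨0, Nat.zero_le _, A, hA, ⟨Iso.refl A⟩⟩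

variable [IsFree X]

lemma HasCoresolution.succ {m : ℕ} {A : C} (h : T.HasCoresolution X m A) :
    T.HasCoresolution X (m + 1) A := by
  induction m generalizing A with
  | zero =>
    obtain ⟨Y, hY, ⟨i⟩⟩ := h
    exact ⟨Y, 0, _, _, hY, ⟨0, IsFree.zero, ⟨Iso.refl _⟩⟩,
      (isConflation_id_zero Y).transport i.symm (Iso.refl _)⟩
  | succ m ih =>
    obtain ⟨Y, K, x, y, hY, hK, hxy⟩ := h
    exact ⟨Y, K, x, y, hY, ih hK, hxy⟩

lemma cores_iff {m : ℕ} {A : C} : T.Cores X m A ↔ T.HasCoresolution X m A := by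
  refine ⟨?_, fun h => ⟨m, le_rfl, h⟩⟩
  rintro ⟨k, hk, h⟩
  obtain ⟨d, rfl⟩ := Nat.exists_eq_add_of_le hk
  clear hk
  induction d with
  | zero => exact h
  | succ d ih => exact ih.succ

lemma cores_succ_iff {m : ℕ} {A : C} : T.Cores X (m + 1) A ↔
    ∃ (Y K : C) (x : A ⟶ Y) (y : Y ⟶ K), X Y ∧ T.Cores X m K ∧ T.IsConflation x y := by
  simp only [cores_iff]
  rfl

lemma Cores.of_iso {m : ℕ} {A B : C} (e : A ≅ B) (h : T.Cores X m A) : T.Cores X m B :=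
  cores_iff.2 ((cores_iff.1 h).of_iso e)

lemma Cores.biprod {m : ℕ} {A B : C} (hA : T.Cores X m A) (hB : T.Cores X m B) :
    T.Cores X m (A ⊞ B) := by
  rw [cores_iff] at *
  induction m generalizing A B with
  | zero =>
    obtain ⟨Y, hY, ⟨i⟩⟩ := hA
    obtain ⟨Y', hY', ⟨i'⟩⟩ := hB
    exact ⟨Y ⊞ Y', IsFree.biprod hY hY', ⟨biprod.mapIso i i'⟩⟩
  | succ m ih =>
    obtain ⟨Y, K, x, y, hY, hK, hxy⟩ := hA
    obtain ⟨Y', K', x', y', hY', hK', hxy'⟩ := hB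
    exact ⟨_, _, _, _, IsFree.biprod hY hY', ih hK hK', hxy.biprod hxy'⟩

/-- Dimension shifting along a coresolution: `E^{k+1}(A, W) = 0` for `W` in `X` and `A` of
`X`-coresolution dimension at most `m`, as long as `k + m ≤ n`. -/
lemma IsHigherExtFamily.ext_eq_zero {Ex : ℕ → Cᵒᵖ ⥤ C ⥤ AddCommGrpCat.{u}}
    (hEx : T.IsHigherExtFamily Ex) {n : ℕ} (hrigid : IsRigid Ex n X) {W : C} (hW : X W)
    (m k : ℕ) (hk : k + m ≤ n) {A : C} (hA : T.HasCoresolution X m A) (ω : Grp (Ex k) A W) :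
    ω = 0 := by
  induction m generalizing A k with
  | zero =>
    obtain ⟨Y, hY, ⟨i⟩⟩ := hA
    exact hrigid k (by omega) A W (IsFree.of_iso i.symm hY) hW ω
  | succ m ih =>
    obtain ⟨Y, K, x, y, hY, hK, hxy⟩ := hA
    exact hEx.subsingleton hxy k W (fun ω => hrigid k (by omega) Y W hY hW ω)
      (fun ω => ih (k + 1) (by omega) hK ω) ω

lemma IsHigherExtFamily.eq_zero_of_cores {Ex : ℕ → Cᵒᵖ ⥤ C ⥤ AddCommGrpCat.{u}}
    (hEx : T.IsHigherExtFamily Ex) {n : ℕ} (hrigid : IsRigid Ex n X) {A W : C}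
    (hA : T.Cores X n A) (hW : X W) (ω : Grp T.E A W) : ω = 0 := by
  have h : ∀ ω : Grp (Ex 0) A W, ω = 0 := fun ω =>
    hEx.ext_eq_zero hrigid hW n 0 (by omega) (cores_iff.1 hA) ω
  rw [hEx.zero_eq] at h
  exact h ω

end Extriangulation

end Coresolutions

/-! ### The quotient category and the stable category -/

section QuotMor

variable {C : Type u} [SmallCategory C] [Preadditive C] {X S : ObjectProperty C}

/-- An object of `S`, as an object of `S/[X]`. -/
def quotObj (X : ObjectProperty C) {A : C} (hA : S A) : IdealQuot S X := ⟨⟨A, hA⟩⟩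

/-- The morphism of `S/[X]` given by a morphism of `C`. -/
def quotMor (X : ObjectProperty C) {A B : C} (hA : S A) (hB : S B) (f : A ⟶ B) :
    quotObj X hA ⟶ quotObj X hB :=
  (CategoryTheory.Quotient.functor (idealRel S X)).map
    (X := (⟨A, hA⟩ : S.FullSubcategory)) (Y := ⟨B, hB⟩) (ObjectProperty.homMk f)

lemma exists_quotObj_eq (M : IdealQuot S X) : ∃ (A : C) (hA : S A), quotObj X hA = M :=
  ⟨_, M.as.property, rfl⟩

lemma quotMor_surjective {A B : C} (hA : S A) (hB : S B) (f : quotObj X hA ⟶ quotObj X hB) :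
    ∃ g, quotMor X hA hB g = f := by
  obtain ⟨g, rfl⟩ := (CategoryTheory.Quotient.functor (idealRel S X)).map_surjective
    (X := (⟨A, hA⟩ : S.FullSubcategory)) (Y := ⟨B, hB⟩) f
  exact ⟨g.hom, rfl⟩

lemma quotMor_comp {A B D : C} (hA : S A) (hB : S B) (hD : S D) (f : A ⟶ B) (g : B ⟶ D) :
    quotMor X hA hD (f ≫ g) = quotMor X hA hB f ≫ quotMor X hB hD g := rfl

lemma quotMor_id {A : C} (hA : S A) : quotMor X hA hA (𝟙 A) = 𝟙 _ := rfl

variable [HasZeroObject C] [HasBinaryBiproducts C] [IsFree X]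

instance : (CategoryTheory.Quotient.functor (idealRel S X)).Additive where
  map_add := rfl

lemma quotMor_eq_iff {A B : C} (hA : S A) (hB : S B) (f g : A ⟶ B) :
    quotMor X hA hB f = quotMor X hA hB g ↔
      ∃ (W : C) (a : A ⟶ W) (b : W ⟶ B), X W ∧ f - g = a ≫ b :=
  CategoryTheory.Quotient.functor_map_eq_iff (idealRel S X) _ _

lemma quotMor_zero {A B : C} (hA : S A) (hB : S B) : quotMor X hA hB (0 : A ⟶ B) = 0 := rfl

lemma quotMor_sub {A B : C} (hA : S A) (hB : S B) (f g : A ⟶ B) :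
    quotMor X hA hB (f - g) = quotMor X hA hB f - quotMor X hA hB g :=
  (CategoryTheory.Quotient.functor (idealRel S X)).map_sub

lemma quotMor_add {A B : C} (hA : S A) (hB : S B) (f g : A ⟶ B) :
    quotMor X hA hB (f + g) = quotMor X hA hB f + quotMor X hA hB g := rfl

lemma quotMor_eq_zero_iff {A B : C} (hA : S A) (hB : S B) (f : A ⟶ B) :
    quotMor X hA hB f = 0 ↔ ∃ (W : C) (a : A ⟶ W) (b : W ⟶ B), X W ∧ f = a ≫ b := by
  rw [← quotMor_zero hA hB, quotMor_eq_iff]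
  simp only [sub_zero]

end QuotMor

/-- Quotient categories of full subcategories closed under finite biproducts have finite
biproducts. -/
lemma hasFiniteBiproducts_of_surjective {C : Type*} [Category* C] [Preadditive C]
    [HasZeroObject C] [HasBinaryBiproducts C] {Q : ObjectProperty C} {Z : Type*} [Category* Z]
    [Preadditive Z] (L : Q.FullSubcategory ⥤ Z) [L.Additive] (hL : Function.Surjective L.obj)
    (hzero : ∃ W, Q W ∧ IsZero W) (hbiprod : ∀ A B, Q A → Q B → Q (A ⊞ B)) :
    HasFiniteBiproducts Z ∧ HasZeroObject Z := by
  have h0 : HasZeroObject Z := by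
    obtain ⟨W, hW, hW0⟩ := hzero
    refine ⟨L.obj ⟨W, hW⟩, ?_⟩
    rw [IsZero.iff_id_eq_zero, ← L.map_id]
    have : 𝟙 (⟨W, hW⟩ : Q.FullSubcategory) = 0 := by
      ext
      exact hW0.eq_of_src _ _
    rw [this, L.map_zero]
  have hb : HasBinaryBiproducts Z := by
    refine ⟨fun P P' => ?_⟩
    obtain ⟨⟨A, hA⟩, rfl⟩ := hL P
    obtain ⟨⟨B, hB⟩, rfl⟩ := hL P'
    let S : Q.FullSubcategory := ⟨A ⊞ B, hbiprod A B hA hB⟩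
    let b : BinaryBicone (L.obj ⟨A, hA⟩) (L.obj ⟨B, hB⟩) :=
      { pt := L.obj S
        fst := L.map (ObjectProperty.homMk biprod.fst)
        snd := L.map (ObjectProperty.homMk biprod.snd)
        inl := L.map (ObjectProperty.homMk biprod.inl)
        inr := L.map (ObjectProperty.homMk biprod.inr)
        inl_fst := by
          rw [← L.map_comp, ← L.map_id]
          congr 1; ext; exact biprod.inl_fst
        inl_snd := by
          rw [← L.map_comp, ← L.map_zero]
          congr 1; ext; exact biprod.inl_snd
        inr_fst := by
          rw [← L.map_comp, ← L.map_zero]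
          congr 1; ext; exact biprod.inr_fst
        inr_snd := by
          rw [← L.map_comp, ← L.map_id]
          congr 1; ext; exact biprod.inr_snd }
    refine hasBinaryBiproduct_of_total b ?_
    simp only [b]
    rw [← L.map_comp, ← L.map_comp, ← L.map_add, ← L.map_id]
    congr 1
    exact ObjectProperty.hom_ext _ biprod.total
  have : HasFiniteProducts Z := hasFiniteProducts_of_has_binary_and_terminal
  exact ⟨HasFiniteBiproducts.of_hasFiniteProducts, h0⟩

namespace Extriangulation

variable {C : Type u} [SmallCategory C] [Preadditive C] [HasZeroObject C]
  [HasBinaryBiproducts C] {T : Extriangulation C}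

section Stable

variable {Q : ObjectProperty C}

instance : (CategoryTheory.Quotient.functor (T.stableRel Q)).Additive where
  map_add := rfl

variable (T) in
/-- The morphism of the stable category given by a morphism. -/
def stMor {A B : C} (hA : Q A) (hB : Q B) (f : A ⟶ B) : T.stableObj A hA ⟶ T.stableObj B hB :=
  (CategoryTheory.Quotient.functor (T.stableRel Q)).map
    (X := (⟨A, hA⟩ : Q.FullSubcategory)) (Y := ⟨B, hB⟩) (ObjectProperty.homMk f)

lemma stMor_surjective {A B : C} (hA : Q A) (hB : Q B)
    (f : T.stableObj A hA ⟶ T.stableObj B hB) : ∃ g, T.stMor hA hB g = f := by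
  obtain ⟨g, rfl⟩ := (CategoryTheory.Quotient.functor (T.stableRel Q)).map_surjective
    (X := (⟨A, hA⟩ : Q.FullSubcategory)) (Y := ⟨B, hB⟩) f
  exact ⟨g.hom, rfl⟩

lemma stMor_comp {A B D : C} (hA : Q A) (hB : Q B) (hD : Q D) (f : A ⟶ B) (g : B ⟶ D) :
    T.stMor hA hD (f ≫ g) = T.stMor hA hB f ≫ T.stMor hB hD g := rfl

lemma stMor_add {A B : C} (hA : Q A) (hB : Q B) (f g : A ⟶ B) :
    T.stMor hA hB (f + g) = T.stMor hA hB f + T.stMor hA hB g := rfl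

lemma stMor_id {A : C} (hA : Q A) : T.stMor hA hA (𝟙 A) = 𝟙 _ := rfl

lemma stMor_eq_iff {A B : C} (hA : Q A) (hB : Q B) (f g : A ⟶ B) :
    T.stMor hA hB f = T.stMor hA hB g ↔ T.IsProjMor (f - g) :=
  CategoryTheory.Quotient.functor_map_eq_iff (T.stableRel Q) _ _

lemma stMor_zero {A B : C} (hA : Q A) (hB : Q B) : T.stMor hA hB (0 : A ⟶ B) = 0 := rfl

lemma stMor_eq_zero_iff {A B : C} (hA : Q A) (hB : Q B) (f : A ⟶ B) :
    T.stMor hA hB f = 0 ↔ T.IsProjMor f := by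
  rw [← stMor_zero hA hB, stMor_eq_iff, sub_zero]

end Stable

/-! ### The functor to modules over the stable category -/

variable (T) in
/-- The common situation of the different parts of the theorem: `Q` and `S` stand for the classes
of objects of `X`-coresolution dimension at most `n` and at most `n + 1`. -/
structure IsRigidTriple (X Q S : ObjectProperty C) : Prop where
  le : X ≤ Q
  biprod : ∀ A B, Q A → Q B → Q (A ⊞ B)
  mem_iff : ∀ A, S A ↔
    ∃ (Y K : C) (x : A ⟶ Y) (y : Y ⟶ K), X Y ∧ Q K ∧ T.IsConflation x y
  eq_zero : ∀ {A W : C}, Q A → X W → ∀ ω : Grp T.E A W, ω = 0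
  enough : T.EnoughProjMor Q X

variable {X Q S : ObjectProperty C}

namespace IsRigidTriple

open ZeroObject

lemma functorH_map_eq (h : T.IsRigidTriple X Q S) (M N : S.FullSubcategory) (f g : M ⟶ N)
    (hfg : idealRel S X f g) : (T.functorH S Q).map f = (T.functorH S Q).map g := by
  obtain ⟨W, a, b, hW, e⟩ := hfg
  ext ⟨⟨Z⟩⟩ δ
  have key : ∀ δ : Grp T.E Z.obj M.obj, push T.E f.hom δ = push T.E g.hom δ := fun δ => by
    rw [← sub_eq_zero, ← push_sub_hom]
    change push T.E (f - g).hom δ = 0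
    rw [e, push_comp, h.eq_zero Z.property hW (push T.E a δ), map_zero]
  exact key δ

/-- The functor `M ↦ E(-, M)` on the quotient category `S/[X]`. -/
def functorF (h : T.IsRigidTriple X Q S) : IdealQuot S X ⥤ RightMod (T.Stable Q) :=
  CategoryTheory.Quotient.lift (idealRel S X) (T.functorH S Q) h.functorH_map_eq

lemma functor_comp_functorF (h : T.IsRigidTriple X Q S) :
    CategoryTheory.Quotient.functor (idealRel S X) ⋙ h.functorF = T.functorH S Q :=
  CategoryTheory.Quotient.lift_spec _ _ _

/-- The element of `E(Z, M)`, as an element of the module `𝔽(M)`. -/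
def elt (h : T.IsRigidTriple X Q S) {M Z : C} (hM : S M) (hZ : Q Z) (δ : Grp T.E Z M) :
    (h.functorF.obj (quotObj X hM)).obj.obj (op (T.stableObj Z hZ)) := δ

lemma elt_injective (h : T.IsRigidTriple X Q S) {M Z : C} (hM : S M) (hZ : Q Z)
    {δ δ' : Grp T.E Z M} (e : h.elt hM hZ δ = h.elt hM hZ δ') : δ = δ' := e

lemma elt_surjective (h : T.IsRigidTriple X Q S) {M Z : C} (hM : S M) (hZ : Q Z)
    (x : (h.functorF.obj (quotObj X hM)).obj.obj (op (T.stableObj Z hZ))) :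
    ∃ δ, h.elt hM hZ δ = x := ⟨x, rfl⟩

lemma elt_zero (h : T.IsRigidTriple X Q S) {M Z : C} (hM : S M) (hZ : Q Z) :
    h.elt hM hZ (0 : Grp T.E Z M) = 0 := rfl

lemma map_elt (h : T.IsRigidTriple X Q S) {M Z Z' : C} (hM : S M) (hZ : Q Z) (hZ' : Q Z')
    (f : Z' ⟶ Z) (δ : Grp T.E Z M) :
    ((h.functorF.obj (quotObj X hM)).obj.map (T.stMor hZ' hZ f).op).hom (h.elt hM hZ δ) =
      h.elt hM hZ' (pull T.E f δ) := rfl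

lemma functorF_map_elt (h : T.IsRigidTriple X Q S) {M N Z : C} (hM : S M) (hN : S N) (hZ : Q Z)
    (f : M ⟶ N) (δ : Grp T.E Z M) :
    ((h.functorF.map (quotMor X hM hN f)).hom.app (op (T.stableObj Z hZ))).hom (h.elt hM hZ δ) =
      h.elt hN hZ (push T.E f δ) := rfl

/-- The presentation of `E(-, M)` given by a conflation `M ⟶ Y ⟶ K`, part of the long exact
sequence: `E(-, Y)` vanishes on `Q`. -/
lemma rightExactPair (h : T.IsRigidTriple X Q S) {M Y K : C} (hM : S M) (hY : X Y) (hK : Q K)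
    {x : M ⟶ Y} {y : Y ⟶ K} {δ : Grp T.E K M} (hδ : T.Realizes x y δ) :
    RightExactPair (repMap (T.stMor (h.le _ hY) hK y)) (repDesc (h.elt hM hK δ)) := by
  intro z
  obtain ⟨Z, hZ, rfl⟩ : ∃ (Z : C) (hZ : Q Z), z = op (T.stableObj Z hZ) := ⟨_, _, rfl⟩
  refine ⟨fun t => ?_, fun t => ?_⟩
  · obtain ⟨g, rfl⟩ := repElt_surjective (A := T.stableObj K hK) (z := op (T.stableObj Z hZ)) t
    obtain ⟨g, rfl⟩ := stMor_surjective _ _ g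
    have e1 : ((repDesc (h.elt hM hK δ)).hom.app (op (T.stableObj Z hZ))).hom
        (repElt (T.stMor hZ hK g)) = h.elt hM hZ (pull T.E g δ) := by
      rw [repDesc_repElt, map_elt]
    constructor
    · intro hg
      obtain ⟨l, rfl⟩ := hδ.exists_lift g (h.elt_injective hM hZ (e1.symm.trans hg))
      exact ⟨repElt (T.stMor hZ (h.le _ hY) l), repMap_repElt _ _⟩
    · rintro ⟨l, hl⟩
      obtain ⟨l, rfl⟩ := repElt_surjective (z := op (T.stableObj Z hZ)) l
      obtain ⟨l, rfl⟩ := stMor_surjective _ _ l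
      rw [repMap_repElt] at hl
      have hl' : T.stMor hZ hK (l ≫ y) = T.stMor hZ hK g := repElt_injective hl
      rw [← hl', repDesc_repElt, map_elt, pull_comp, hδ.pull_eq_zero, map_zero]
      exact h.elt_zero hM hZ
  · obtain ⟨ω, rfl⟩ := h.elt_surjective hM hZ t
    obtain ⟨c, rfl⟩ := hδ.exists_of_push_eq_zero ω (h.eq_zero hZ hY _)
    exact ⟨repElt (T.stMor hZ hK c), by rw [repDesc_repElt, map_elt]⟩

lemma classR_functorF (h : T.IsRigidTriple X Q S) (M : IdealQuot S X) :
    T.classR X Q (h.functorF.obj M) := by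
  obtain ⟨⟨M, hM⟩⟩ := M
  obtain ⟨Y, K, x, y, hY, hK, δ, hδ⟩ := (h.mem_iff M).1 hM
  exact ⟨Y, K, hY, h.le _ hY, hK, _, _, h.rightExactPair hM hY hK hδ⟩

variable [IsFree X]

lemma le_right (h : T.IsRigidTriple X Q S) : X ≤ S := fun A hA =>
  (h.mem_iff A).2 ⟨A, 0, _, _, hA, h.le _ IsFree.zero, isConflation_id_zero A⟩

lemma biprod_right (h : T.IsRigidTriple X Q S) (A B : C) (hA : S A) (hB : S B) : S (A ⊞ B) := by
  rw [h.mem_iff] at *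
  obtain ⟨Y, K, x, y, hY, hK, hxy⟩ := hA
  obtain ⟨Y', K', x', y', hY', hK', hxy'⟩ := hB
  exact ⟨_, _, _, _, IsFree.biprod hY hY', h.biprod _ _ hK hK', hxy.biprod hxy'⟩

lemma hasFiniteBiproducts_stable (h : T.IsRigidTriple X Q S) :
    HasFiniteBiproducts (T.Stable Q) ∧ HasZeroObject (T.Stable Q) :=
  hasFiniteBiproducts_of_surjective (CategoryTheory.Quotient.functor (T.stableRel Q))
    (fun A => ⟨A.as, rfl⟩) ⟨0, h.le _ IsFree.zero, isZero_zero C⟩ h.biprod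

instance additive_functorF (h : T.IsRigidTriple X Q S) : h.functorF.Additive where
  map_add := by
    rintro M N f g
    obtain ⟨f, rfl⟩ := (CategoryTheory.Quotient.functor (idealRel S X)).map_surjective
      (X := M.as) (Y := N.as) f
    obtain ⟨g, rfl⟩ := (CategoryTheory.Quotient.functor (idealRel S X)).map_surjective
      (X := M.as) (Y := N.as) g
    change (T.functorH S Q).map (f + g) = (T.functorH S Q).map f + (T.functorH S Q).map g
    ext ⟨⟨Z⟩⟩ δ
    exact push_add_hom T f.hom g.hom δ

instance full_functorF (h : T.IsRigidTriple X Q S) : h.functorF.Full where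
  map_surjective := by
    intro M' N' α
    obtain ⟨M, hM, rfl⟩ := exists_quotObj_eq M'
    obtain ⟨N, hN, rfl⟩ := exists_quotObj_eq N'
    obtain ⟨Y, K, x, y, hY, hK, δ, hδ⟩ := (h.mem_iff M).1 hM
    obtain ⟨ω, hω⟩ := h.elt_surjective hN hK
      ((α.hom.app (op (T.stableObj K hK))).hom (h.elt hM hK δ))
    -- naturality along `y` shows that `ω` is a pushout of `δ`
    have hω' : pull T.E y ω = 0 := by
      apply h.elt_injective hN (h.le _ hY)
      rw [← h.map_elt hN hK (h.le _ hY), hω, ← hom_naturality_apply, h.map_elt, hδ.pull_eq_zero,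
        h.elt_zero, map_zero, h.elt_zero]
    obtain ⟨f, rfl⟩ := hδ.exists_of_pull_eq_zero ω hω'
    refine ⟨quotMor X hM hN f, ?_⟩
    have := (h.rightExactPair hM hY hK hδ).epi
    rw [← cancel_epi (repDesc (h.elt hM hK δ))]
    refine rep_hom_ext ?_
    change ((h.functorF.map (quotMor X hM hN f)).hom.app (op (T.stableObj K hK))).hom
      (((repDesc (h.elt hM hK δ)).hom.app (op (T.stableObj K hK))).hom (repElt (𝟙 _))) =
      (α.hom.app (op (T.stableObj K hK))).hom
      (((repDesc (h.elt hM hK δ)).hom.app (op (T.stableObj K hK))).hom (repElt (𝟙 _)))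
    rw [repDesc_repElt, map_id_apply, ← hω, h.functorF_map_elt]

instance faithful_functorF (h : T.IsRigidTriple X Q S) : h.functorF.Faithful where
  map_injective := by
    intro M' N' f g hfg
    obtain ⟨M, hM, rfl⟩ := exists_quotObj_eq M'
    obtain ⟨N, hN, rfl⟩ := exists_quotObj_eq N'
    obtain ⟨Y, K, x, y, hY, hK, δ, hδ⟩ := (h.mem_iff M).1 hM
    obtain ⟨f, rfl⟩ := quotMor_surjective _ _ f
    obtain ⟨g, rfl⟩ := quotMor_surjective _ _ g
    rw [quotMor_eq_iff]
    have e : push T.E f δ = push T.E g δ :=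
      congrArg (fun t => (t.hom.app (op (T.stableObj K hK))).hom (h.elt hM hK δ)) hfg
    obtain ⟨b, hb⟩ := hδ.exists_desc (f - g) (by rw [push_sub_hom, e, sub_self])
    exact ⟨Y, x, b, hY, hb.symm⟩

end IsRigidTriple

end Extriangulation

lemma RightExactPair.exists_desc {Z : Type u} [SmallCategory Z] [Preadditive Z]
    {P M N L : RightMod Z} {f : P ⟶ M} {g : M ⟶ N} (h : RightExactPair f g) (k : M ⟶ L)
    (hk : f ≫ k = 0) : ∃ l : N ⟶ L, g ≫ l = k := by
  have := h.epi
  have := h.epi_lift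
  refine (isShortExactPair_kernel g).exists_desc k ?_
  rw [← cancel_epi (kernel.lift g f h.comp_eq_zero), kernel.lift_ι_assoc, hk, comp_zero]

/-- Two quotients of the same module are isomorphic if the relations of each hold in the other. -/
lemma RightExactPair.nonempty_iso {Z : Type u} [SmallCategory Z] [Preadditive Z]
    {P P' M N N' : RightMod Z} {f : P ⟶ M} {g : M ⟶ N} (h : RightExactPair f g)
    {f' : P' ⟶ M} {g' : M ⟶ N'} (h' : RightExactPair f' g') (w : f ≫ g' = 0) (w' : f' ≫ g = 0) :
    Nonempty (N ≅ N') := by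
  have := h.epi
  have := h'.epi
  obtain ⟨a, ha⟩ := h.exists_desc g' w
  obtain ⟨b, hb⟩ := h'.exists_desc g w'
  exact ⟨⟨a, b, by rw [← cancel_epi g, reassoc_of% ha, hb, Category.comp_id],
    by rw [← cancel_epi g', reassoc_of% hb, ha, Category.comp_id]⟩⟩

namespace Extriangulation

variable {C : Type u} [SmallCategory C] [Preadditive C] [HasZeroObject C]
  [HasBinaryBiproducts C] {T : Extriangulation C} {X Q S : ObjectProperty C}

namespace IsRigidTriple

open ZeroObject

/-- The objects of the stable category which lie in `X`. -/
def stableX (T : Extriangulation C) (X Q : ObjectProperty C) : ObjectProperty (T.Stable Q) :=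
  fun z => X z.as.obj

lemma classR_eq_presented :
    T.classR X Q = Presented (repClass (stableX T X Q)) (repClass ⊤) := by
  funext G
  rw [presented_repClass_iff]
  refine propext ⟨?_, ?_⟩
  · rintro ⟨X₀, X₁, hX, h₀, h₁, f, g, hfg⟩
    exact ⟨_, _, f, g, hX, trivial, hfg⟩
  · rintro ⟨⟨⟨A, hA⟩⟩, ⟨⟨B, hB⟩⟩, f, g, hX, -, hfg⟩
    exact ⟨A, B, hX, hA, hB, f, g, hfg⟩

variable [IsFree X]

/-- Every module of the class `R` is of the form `E(-, M)`: a presentation by `f : X₀ ⟶ X₁` is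
changed into a deflation `X₀ ⊞ W ⟶ X₁` by adding an `E`-projective deflation. -/
lemma exists_functorF_iso (h : T.IsRigidTriple X Q S) {G : RightMod (T.Stable Q)}
    (hG : T.classR X Q G) : ∃ M : IdealQuot S X, Nonempty (h.functorF.obj M ≅ G) := by
  obtain ⟨X₀, X₁, hX, h₀, h₁, f, g, hfg⟩ := hG
  obtain ⟨f, rfl⟩ := exists_repMap_eq f
  obtain ⟨f, rfl⟩ := stMor_surjective _ _ f
  obtain ⟨W, p, hW, hp, hp'⟩ := h.enough X₁ h₁
  obtain ⟨M, x, δ, hδ⟩ := hp.desc f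
  have hXW : X (X₀ ⊞ W) := IsFree.biprod hX hW
  have hM : S M := (h.mem_iff M).2 ⟨_, _, _, _, hXW, h₁, δ, hδ⟩
  refine ⟨quotObj X hM, (h.rightExactPair hM hXW h₁ hδ).nonempty_iso hfg ?_ ?_⟩
  · have e : T.stMor (h.le _ hXW) h₁ (biprod.desc f p) =
        T.stMor (h.le _ hXW) h₀ biprod.fst ≫ T.stMor h₀ h₁ f := by
      rw [← stMor_comp, stMor_eq_iff]
      have : biprod.desc f p - biprod.fst ≫ f = biprod.snd ≫ p := by ext <;> simp
      rw [this]
      exact hp'.precomp _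
    rw [e, repMap_comp, Category.assoc, hfg.comp_eq_zero, comp_zero]
  · have e : T.stMor h₀ h₁ f = T.stMor h₀ (h.le _ hXW) biprod.inl ≫
        T.stMor (h.le _ hXW) h₁ (biprod.desc f p) := by
      rw [← stMor_comp, biprod.inl_desc]
    rw [e, repMap_comp, Category.assoc, (h.rightExactPair hM hXW h₁ hδ).comp_eq_zero, comp_zero]

/-- The biproduct in the stable category is the image of the biproduct. -/
lemma nonempty_stable_biprod_iso [HasBinaryBiproducts (T.Stable Q)] {A B : C} (hA : Q A)
    (hB : Q B) (hAB : Q (A ⊞ B)) :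
    Nonempty (T.stableObj A hA ⊞ T.stableObj B hB ≅ T.stableObj (A ⊞ B) hAB) := by
  refine ⟨⟨biprod.desc (T.stMor hA hAB biprod.inl) (T.stMor hB hAB biprod.inr),
    biprod.lift (T.stMor hAB hA biprod.fst) (T.stMor hAB hB biprod.snd), ?_, ?_⟩⟩
  · ext <;> simp [← stMor_comp, ← stMor_id, ← stMor_zero]
  · rw [biprod.lift_desc, ← stMor_comp, ← stMor_comp, ← stMor_add, biprod.total, stMor_id]

lemma isAdditiveClass_stableX (h : T.IsRigidTriple X Q S) [HasBinaryBiproducts (T.Stable Q)] :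
    IsAdditiveClass (stableX T X Q) where
  zero := by
    refine ⟨T.stableObj 0 (h.le _ IsFree.zero), IsFree.zero (P := X), ?_⟩
    rw [IsZero.iff_id_eq_zero, ← stMor_id, ← stMor_zero]
    congr 1
    exact (isZero_zero C).eq_of_src _ _
  biprod := by
    rintro ⟨⟨A, hA⟩⟩ ⟨⟨B, hB⟩⟩ hXA hXB
    exact ⟨T.stableObj (A ⊞ B) (h.biprod _ _ hA hB), IsFree.biprod (P := X) hXA hXB,
      nonempty_stable_biprod_iso hA hB _⟩

lemma classR_closed (h : T.IsRigidTriple X Q S) :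
    (T.classR X Q).ContainsZero ∧ (T.classR X Q).IsClosedUnderExtensions ∧
      (T.classR X Q).IsClosedUnderIsomorphisms := by
  obtain ⟨_, _⟩ := h.hasFiniteBiproducts_stable
  have : HasBinaryBiproducts (T.Stable Q) := hasBinaryBiproducts_of_finite_biproducts _
  have h₀ := h.isAdditiveClass_stableX.isProjectiveClass
  have h₁ := (isAdditiveClass_top (Z := T.Stable Q)).isProjectiveClass
  rw [classR_eq_presented]
  exact ⟨presented_containsZero h₀ h₁, presented_closedUnderExtensions h₀ h₁, inferInstance⟩

lemma isEquivalence_lift (h : T.IsRigidTriple X Q S) :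
    ((T.classR X Q).lift h.functorF h.classR_functorF).IsEquivalence where
  essSurj := ⟨fun G => by
    obtain ⟨M, ⟨e⟩⟩ := h.exists_functorF_iso G.property
    exact ⟨M, ⟨(T.classR X Q).isoMk e⟩⟩⟩

lemma additive_lift (h : T.IsRigidTriple X Q S) :
    ((T.classR X Q).lift h.functorF h.classR_functorF).Additive where
  map_add {_ _ f g} := by
    ext1
    exact h.functorF.map_add

lemma isExactCategory_inducedPairs (h : T.IsRigidTriple X Q S) :
    IsExactCategory (inducedPairs (T.classR X Q)) := by
  obtain ⟨_, _, _⟩ := h.classR_closed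
  rw [inducedPairs_eq_shortExactIn]
  exact isExactCategory_shortExactIn

lemma isExactCategory_epsilon (h : T.IsRigidTriple X Q S) :
    IsExactCategory (epsilon h.functorF) := by
  have := h.isEquivalence_lift
  have := h.additive_lift
  exact h.isExactCategory_inducedPairs.of_isEquivalence
    ((T.classR X Q).lift h.functorF h.classR_functorF)

end IsRigidTriple

end Extriangulation

end Extri

namespace Extri

/-! ### The exact equivalence -/

namespace Extriangulation

variable {C : Type u} [SmallCategory C] [Preadditive C] [HasZeroObject C]
  [HasBinaryBiproducts C] {T : Extriangulation C} {X Q S : ObjectProperty C} [IsFree X]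

lemma isRigidTriple_cores {Ex : ℕ → Cᵒᵖ ⥤ C ⥤ AddCommGrpCat.{u}}
    (hEx : T.IsHigherExtFamily Ex) {n : ℕ} (hrigid : IsRigid Ex n X)
    (hproj : T.EnoughProjMor (T.Cores X n) X) :
    T.IsRigidTriple X (T.Cores X n) (T.Cores X (n + 1)) where
  le := le_cores n
  biprod _ _ hA hB := hA.biprod hB
  mem_iff _ := cores_succ_iff
  eq_zero hA hW ω := hEx.eq_zero_of_cores hrigid hA hW ω
  enough := hproj

namespace IsRigidTriple

lemma closedUnderExtensions_classR (h : T.IsRigidTriple X Q S) :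
    ClosedUnderExtensions (T.classR X Q) := by
  obtain ⟨_, _, _⟩ := h.classR_closed
  exact closedUnderExtensions_of_isClosedUnderExtensions _

lemma isExactEquivalence_lift (h : T.IsRigidTriple X Q S) :
    IsExactEquivalence (epsilon h.functorF) (inducedPairs (T.classR X Q))
      ((T.classR X Q).lift h.functorF h.classR_functorF) where
  additive := h.additive_lift
  isEquivalence := h.isEquivalence_lift
  exact_iff _ _ _ _ _ := Iff.rfl

end IsRigidTriple

end Extriangulation

end Extri

namespace Extri

/-! ### Direct summands -/

lemma smd_iff {D : Type*} [Category* D] [Preadditive D] [HasBinaryBiproducts D]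
    {P : ObjectProperty D} {A : D} :
    smd P A ↔ ∃ B N : D, P N ∧ Nonempty (A ⊞ B ≅ N) := by
  constructor
  · rintro ⟨B, N, i, j, hN, ⟨h⟩⟩
    exact ⟨B, N, hN, ⟨(BinaryBiproduct.isColimit A B).coconePointUniqueUpToIso h⟩⟩
  · rintro ⟨B, N, hN, ⟨e⟩⟩
    exact ⟨B, N, biprod.inl ≫ e.hom, biprod.inr ≫ e.hom, hN,
      ⟨(BinaryBiproduct.isColimit A B).ofIsoColimit (BinaryCofan.ext e rfl rfl)⟩⟩

namespace Extriangulation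

variable {C : Type u} [SmallCategory C] [Preadditive C] [HasZeroObject C]
  [HasBinaryBiproducts C] {T : Extriangulation C}

/-- A conflation which realizes the zero extension splits. -/
lemma Realizes.nonempty_biprod_iso {A B D : C} {x : A ⟶ B} {y : B ⟶ D}
    (h : T.Realizes x y (0 : Grp T.E D A)) : Nonempty (A ⊞ D ≅ B) := by
  obtain ⟨e, -, -⟩ := (T.realizes_iff _ _ (T.realizes_zero A D)).1 h
  exact ⟨e⟩

lemma IsConflation.nonempty_biprod_iso {A B D : C} {x : A ⟶ B} {y : B ⟶ D}
    (h : T.IsConflation x y) (h0 : ∀ δ : Grp T.E D A, δ = 0) : Nonempty (A ⊞ D ≅ B) := by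
  obtain ⟨δ, h⟩ := h
  obtain rfl := h0 δ
  exact h.nonempty_biprod_iso

/-- The summands `A` and `B` of the first term of a conflation `A ⊞ B ⟶ Y ⟶ K` have conflations
`A ⟶ Y ⟶ K₁` and `B ⟶ Y ⟶ K₂`, and there is a conflation `Y ⊞ Y ⟶ (K₁ ⊞ K₂) ⊞ Y ⟶ K`: the
direct sum of the two conflations is a pullback of the given one. -/
lemma IsConflation.exists_of_biprod {A B Y K : C} {x : A ⊞ B ⟶ Y} {y : Y ⟶ K}
    (h : T.IsConflation x y) :
    ∃ (K₁ K₂ : C) (y₁ : Y ⟶ K₁) (y₂ : Y ⟶ K₂) (u : Y ⊞ Y ⟶ (K₁ ⊞ K₂) ⊞ Y)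
      (v : (K₁ ⊞ K₂) ⊞ Y ⟶ K), T.IsConflation (biprod.inl ≫ x) y₁ ∧
      T.IsConflation (biprod.inr ≫ x) y₂ ∧ T.IsConflation u v := by
  obtain ⟨δ, h⟩ := h
  obtain ⟨K₁, y₁, d₁, e₁, δ₁, -, -, h₁, -, -, w₁⟩ := T.et4 (T.realizes_zero A B) h
  have hBA : T.Realizes (biprod.inr : B ⟶ A ⊞ B) biprod.fst (0 : Grp T.E A B) :=
    T.realizes_of_splitting biprod.snd biprod.inl (by simp) (by simp) (by simp)
      (by rw [add_comm, biprod.total])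
  obtain ⟨K₂, y₂, d₂, e₂, δ₂, -, -, h₂, -, -, w₂⟩ := T.et4 hBA h
  obtain ⟨N, d, e, h', δ'', hN, hN', -, -⟩ := h.exists_weakPullback (biprod.desc e₁ e₂)
  have key : pull T.E (biprod.desc e₁ e₂) δ = push T.E biprod.inl (pull T.E biprod.fst δ₁) +
      push T.E biprod.inr (pull T.E biprod.snd δ₂) := by
    rw [push_pull, push_pull, w₁, w₂, ← pull_comp, ← pull_comp, ← pull_add_hom, biprod.desc_eq]
  rw [key] at hN
  obtain ⟨b, -, -⟩ := (T.realizes_iff _ _ (T.realizes_sum h₁ h₂)).1 hN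
  exact ⟨K₁, K₂, y₁, y₂, _, _, ⟨_, h₁⟩, ⟨_, h₂⟩,
    IsConflation.transport ⟨_, hN'⟩ b.symm (Iso.refl K)⟩

lemma Cores.mono {X : ObjectProperty C} {k m : ℕ} (hkm : k ≤ m) {A : C} (h : T.Cores X k A) :
    T.Cores X m A := by
  obtain ⟨j, hj, h⟩ := h
  exact ⟨j, hj.trans hkm, h⟩

variable {X : ObjectProperty C} [IsFree X]

/-- The classes of objects of bounded `X`-coresolution dimension inherit closure under direct
summands from `X`. -/
lemma cores_of_biprod (hX : smd X = X) {n : ℕ}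
    (h0 : ∀ {A W : C}, T.Cores X n A → X W → ∀ ω : Grp T.E A W, ω = 0) (m : ℕ) (hm : m ≤ n + 1)
    {A B : C} (h : T.Cores X m (A ⊞ B)) : T.Cores X m A := by
  induction m generalizing A B with
  | zero =>
    obtain ⟨Y, hY, e⟩ := cores_iff.1 h
    refine le_cores 0 _ ?_
    rw [← hX]
    exact smd_iff.2 ⟨B, Y, hY, e⟩
  | succ m ih =>
    obtain ⟨Y, K, x, y, hY, hK, hxy⟩ := cores_succ_iff.1 h
    obtain ⟨K₁, K₂, y₁, y₂, u, v, h₁, -, huv⟩ := hxy.exists_of_biprod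
    have hYY : X (Y ⊞ Y) := IsFree.biprod hY hY
    obtain ⟨e⟩ := huv.nonempty_biprod_iso (fun ω => h0 (Cores.mono (by omega) hK) hYY ω)
    have hK₁ : T.Cores X m (K₁ ⊞ (K₂ ⊞ Y)) :=
      (((le_cores m _ hYY).biprod hK).of_iso e).of_iso (biprod.associator _ _ _)
    exact cores_succ_iff.2 ⟨Y, K₁, _, _, hY, ih (by omega) hK₁, h₁⟩

end Extriangulation

end Extri

namespace Extri

/-! ### Weak idempotent completeness -/

/-- A split epimorphism has a kernel if the complementary idempotent splits. -/
lemma hasKernel_of_splitting {D : Type*} [Category* D] [Preadditive D] {K A B : D} {f : A ⟶ B}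
    {s : B ⟶ A} {i : K ⟶ A} {r : A ⟶ K} (hif : i ≫ f = 0) (hir : i ≫ r = 𝟙 K)
    (hri : r ≫ i = 𝟙 A - f ≫ s) : HasKernel f :=
  ⟨⟨⟨KernelFork.ofι i hif, KernelFork.IsLimit.ofι i hif (fun g _ => g ≫ r)
    (fun g hg => by rw [Category.assoc, hri, Preadditive.comp_sub, Category.comp_id,
      reassoc_of% hg, zero_comp, sub_zero])
    (fun g _ m hm => by rw [← hm, Category.assoc, hir, Category.comp_id])⟩⟩⟩

namespace Extriangulation

variable {C : Type u} [SmallCategory C] [Preadditive C] [HasZeroObject C]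
  [HasBinaryBiproducts C] {T : Extriangulation C}

/-- A split deflation has a kernel which is complementary to a given section. -/
lemma IsDeflation.exists_splitting {B D : C} {y : B ⟶ D} (hy : T.IsDeflation y) {s : D ⟶ B}
    (hs : s ≫ y = 𝟙 D) : ∃ (A : C) (x : A ⟶ B) (r : B ⟶ A), x ≫ y = 0 ∧ x ≫ r = 𝟙 A ∧
      r ≫ x = 𝟙 B - y ≫ s ∧ Nonempty (A ⊞ D ≅ B) := by
  obtain ⟨A, x, δ, h⟩ := hy
  have hδ : δ = 0 := by
    rw [← pull_id T.E δ, ← hs, pull_comp, h.pull_eq_zero, map_zero]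
  subst hδ
  obtain ⟨r, hr⟩ := h.exists_lift_of_comp_eq_zero (𝟙 B - y ≫ s) (by simp [hs])
  obtain ⟨t, ht⟩ := h.exists_desc (𝟙 A) (map_zero _)
  refine ⟨A, x, r, h.comp_eq_zero, ?_, hr, h.nonempty_biprod_iso⟩
  have : (x ≫ r) ≫ x = x := by
    rw [Category.assoc, hr, Preadditive.comp_sub, reassoc_of% h.comp_eq_zero]
    simp
  calc x ≫ r = (x ≫ r) ≫ x ≫ t := by rw [ht, Category.comp_id]
    _ = 𝟙 A := by rw [← Category.assoc, this, ht]

variable {X S : ObjectProperty C} [IsFree X]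

/-- A split epimorphism of `S/[X]` comes from a split deflation in `C`, after objects of `X` have
been added to its source; the kernel of the latter gives a kernel of the former. -/
lemma isWeaklyIdempotentComplete_idealQuot (hXS : X ≤ S) (hbiprod : ∀ A B, S A → S B → S (A ⊞ B))
    (hiso : ∀ {A B : C}, (A ≅ B) → S A → S B) (hsummand : ∀ A B, S (A ⊞ B) → S A)
    (hdefl : T.EnoughDeflations S X) : IsWeaklyIdempotentComplete (IdealQuot S X) := by
  intro A' B' f' hf'
  obtain ⟨A, hA, rfl⟩ := exists_quotObj_eq A'
  obtain ⟨B, hB, rfl⟩ := exists_quotObj_eq B'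
  obtain ⟨f, rfl⟩ := quotMor_surjective _ _ f'
  obtain ⟨s', hs'⟩ := hf'.exists_splitEpi.some
  obtain ⟨s, rfl⟩ := quotMor_surjective _ _ s'
  rw [← quotMor_comp, ← quotMor_id, eq_comm, quotMor_eq_iff] at hs'
  obtain ⟨W, a, b, hW, hab⟩ := hs'
  obtain ⟨V, w, hV, hw⟩ := hdefl B hB
  have hs : biprod.lift (biprod.lift s a) (0 : B ⟶ V) ≫ biprod.desc (biprod.desc f b) w = 𝟙 B := by
    simp [← hab]
  obtain ⟨K, x, r, hxy, hxr, hrx, ⟨e⟩⟩ := (hw.desc (biprod.desc f b)).exists_splitting hs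
  have hN : S ((A ⊞ W) ⊞ V) := hbiprod _ _ (hbiprod _ _ hA (hXS _ hW)) (hXS _ hV)
  have hK : S K := hsummand K B (hiso e.symm hN)
  have hXW : X (W ⊞ V) := IsFree.biprod hW hV
  refine hasKernel_of_splitting (s := quotMor X hB hA s)
    (i := quotMor X hK hA (x ≫ biprod.fst ≫ biprod.fst))
    (r := quotMor X hA hK (biprod.inl ≫ biprod.inl ≫ r)) ?_ ?_ ?_
  · rw [← quotMor_comp, quotMor_eq_zero_iff]
    refine ⟨_, x ≫ biprod.lift (biprod.fst ≫ biprod.snd) biprod.snd, -biprod.desc b w, hXW, ?_⟩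
    have : biprod.desc (biprod.desc f b) w = biprod.fst ≫ biprod.fst ≫ f +
        biprod.lift (biprod.fst ≫ biprod.snd) biprod.snd ≫ biprod.desc b w := by
      ext <;> simp
    rw [this, Preadditive.comp_add] at hxy
    simp only [Category.assoc, Preadditive.comp_neg]
    exact eq_neg_of_add_eq_zero_left hxy
  · rw [← quotMor_comp, ← quotMor_id, quotMor_eq_iff]
    refine ⟨_, x ≫ biprod.lift (biprod.fst ≫ biprod.snd) biprod.snd,
      -(biprod.desc (biprod.inr ≫ biprod.inl) biprod.inr ≫ r), hXW, ?_⟩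
    have : 𝟙 ((A ⊞ W) ⊞ V) = biprod.fst ≫ biprod.fst ≫ biprod.inl ≫ biprod.inl +
        biprod.lift (biprod.fst ≫ biprod.snd) biprod.snd ≫
          biprod.desc (biprod.inr ≫ biprod.inl) biprod.inr := by
      ext <;> simp
    have h2 : x ≫ 𝟙 ((A ⊞ W) ⊞ V) ≫ r = 𝟙 K := by simpa using hxr
    rw [this] at h2
    rw [← h2]
    simp
  · rw [← quotMor_comp, ← quotMor_comp, ← quotMor_id, ← quotMor_sub]
    congr 1
    have := congrArg (fun t => biprod.inl ≫ biprod.inl ≫ t ≫ biprod.fst ≫ biprod.fst) hrx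
    simpa using this

end Extriangulation

/-! ### Krull–Schmidt categories -/

section KrullSchmidt

lemma free_of_iso {D : Type*} [Category* D] {P : ObjectProperty D} {A B : D} (e : A ≅ B)
    (hA : free P A) : free P B := by
  obtain ⟨m, Y, j, hY, ⟨h⟩⟩ := hA
  exact ⟨m, Y, fun i => j i ≫ e.hom, hY, ⟨h.ofIsoColimit (Cofan.ext e (fun _ => rfl))⟩⟩

lemma free_of_isZero {D : Type*} [Category* D] [HasZeroMorphisms D] {P : ObjectProperty D} {A : D}
    (hA : IsZero A) : free P A :=
  ⟨0, fun i => i.elim0, fun i => i.elim0, fun i => i.elim0,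
    ⟨Cofan.IsColimit.mk _ (fun _ => 0) (fun _ i => i.elim0) (fun _ _ _ => hA.eq_of_src _ _)⟩⟩

/-- The number of summands is increased by one. -/
lemma free_biprod {D : Type*} [Category* D] [Preadditive D] [HasBinaryBiproducts D]
    {P : ObjectProperty D} {A B : D} (hA : P A) (hB : free P B) : free P (A ⊞ B) := by
  obtain ⟨m, Y, j, hY, ⟨h⟩⟩ := hB
  let f : Fin (m + 1) → D := Fin.cons A Y
  let c := extendCofan (f := f) (Cofan.mk B j) (BinaryBiproduct.bicone A B).toCocone
  have hc : IsColimit c := extendCofanIsColimit f h (BinaryBiproduct.isColimit A B)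
  refine ⟨m + 1, f, c.inj, ?_, ⟨hc.ofIsoColimit (Cofan.ext (Iso.refl _) (fun _ => ?_))⟩⟩
  · intro i
    refine Fin.cases ?_ (fun i => ?_) i
    · exact hA
    · exact hY i
  · exact Category.comp_id _

/-- Induction on the number of the summands of an object of `free P`. -/
lemma free_induction {D : Type*} [Category* D] [Preadditive D] [HasZeroObject D]
    [HasBinaryBiproducts D] {P R : ObjectProperty D} (hiso : ∀ ⦃A B⦄, (A ≅ B) → R A → R B)
    (hzero : ∀ ⦃A⦄, IsZero A → R A) (hbiprod : ∀ ⦃A B⦄, P A → R B → R (A ⊞ B)) {A : D}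
    (hA : free P A) : R A := by
  have : HasFiniteProducts D := hasFiniteProducts_of_has_binary_and_terminal
  have : HasFiniteBiproducts D := HasFiniteBiproducts.of_hasFiniteProducts
  obtain ⟨m, Y, j, hY, ⟨h⟩⟩ := hA
  induction m generalizing A with
  | zero =>
    refine hzero ((IsZero.iff_id_eq_zero A).2 (Cofan.IsColimit.hom_ext h _ _ (fun i => i.elim0)))
  | succ m ih =>
    have hB := ih (fun i : Fin m => Y i.succ) _ (fun i => hY i.succ)
      (biproduct.isColimit (fun i : Fin m => Y i.succ))
    have hc := extendCofanIsColimit Y (biproduct.isColimit (fun i : Fin m => Y i.succ))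
      (BinaryBiproduct.isColimit (Y 0) _)
    exact hiso (hc.coconePointUniqueUpToIso h) (hbiprod (hY 0) hB)

lemma isIso_or_isIso_of_add {D : Type*} [Category* D] [Preadditive D] {A : D}
    (hA : IsLocalRing (End A)) (f g : A ⟶ A) (h : IsIso (f + g)) : IsIso f ∨ IsIso g := by
  have : IsIso (inv (f + g) ≫ f) ∨ IsIso (inv (f + g) ≫ g) := by
    simp only [← isUnit_iff_isIso]
    refine hA.isUnit_or_isUnit_of_add_one ?_
    change inv (f + g) ≫ f + inv (f + g) ≫ g = 𝟙 A
    rw [← Preadditive.comp_add, IsIso.inv_hom_id]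
  refine this.imp (fun (_ : IsIso (inv (f + g) ≫ f)) => ?_)
    (fun (_ : IsIso (inv (f + g) ≫ g)) => ?_)
  · exact IsIso.of_isIso_comp_left (inv (f + g)) f
  · exact IsIso.of_isIso_comp_left (inv (f + g)) g

end KrullSchmidt

section KrullSchmidtQuotient

variable {C : Type u} [SmallCategory C] [Preadditive C] [HasZeroObject C] [HasBinaryBiproducts C]
  {X S : ObjectProperty C} [IsFree X]

/-- An object with local endomorphism ring becomes zero in `S/[X]` or keeps a local endomorphism
ring. -/
lemma isZero_or_isLocalRing_quotObj {A : C} (hS : S A) (hA : IsLocalRing (End A)) :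
    IsZero (quotObj X hS) ∨ IsLocalRing (End (quotObj X hS)) := by
  by_cases h0 : IsZero (quotObj X hS)
  · exact Or.inl h0
  right
  have : Nontrivial (End (quotObj X hS)) :=
    ⟨⟨𝟙 _, 0, fun h => h0 ((IsZero.iff_id_eq_zero _).2 h)⟩⟩
  refine ⟨fun {a b} hab => ?_⟩
  obtain ⟨a, rfl⟩ := quotMor_surjective hS hS a
  obtain rfl : b = quotMor X hS hS (𝟙 A - a) := by
    rw [quotMor_sub, quotMor_id]
    exact eq_sub_of_add_eq' hab
  have key : ∀ c : A ⟶ A, IsIso c → IsUnit (M := End (quotObj X hS)) (quotMor X hS hS c) := by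
    intro c hc
    rw [isUnit_iff_isIso]
    exact ⟨quotMor X hS hS (inv c), by rw [← quotMor_comp, IsIso.hom_inv_id, quotMor_id],
      by rw [← quotMor_comp, IsIso.inv_hom_id, quotMor_id]⟩
  exact (isIso_or_isIso_of_add hA a (𝟙 A - a) (by rw [add_sub_cancel]; infer_instance)).imp
    (key _) (key _)

lemma nonempty_quotObj_biprod_iso [HasBinaryBiproducts (IdealQuot S X)] {A B : C} (hA : S A)
    (hB : S B) (hAB : S (A ⊞ B)) :
    Nonempty (quotObj X hA ⊞ quotObj X hB ≅ quotObj X hAB) := by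
  refine ⟨⟨biprod.desc (quotMor X hA hAB biprod.inl) (quotMor X hB hAB biprod.inr),
    biprod.lift (quotMor X hAB hA biprod.fst) (quotMor X hAB hB biprod.snd), ?_, ?_⟩⟩
  · ext <;> simp [← quotMor_comp, ← quotMor_id, ← quotMor_zero]
  · rw [biprod.lift_desc, ← quotMor_comp, ← quotMor_comp, ← quotMor_add, biprod.total, quotMor_id]

/-- An isomorphism of `C`, as an isomorphism of `S/[X]`. -/
def quotIso (X : ObjectProperty C) {A B : C} (hA : S A) (hB : S B) (e : A ≅ B) :
    quotObj X hA ≅ quotObj X hB where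
  hom := quotMor X hA hB e.hom
  inv := quotMor X hB hA e.inv
  hom_inv_id := by rw [← quotMor_comp, e.hom_inv_id, quotMor_id]
  inv_hom_id := by rw [← quotMor_comp, e.inv_hom_id, quotMor_id]

lemma isKrullSchmidt_idealQuot [HasBinaryBiproducts (IdealQuot S X)]
    (hiso : ∀ {A B : C}, (A ≅ B) → S A → S B) (hsummand : ∀ A B, S (A ⊞ B) → S A)
    (hC : IsKrullSchmidt C) : IsKrullSchmidt (IdealQuot S X) := by
  intro M
  obtain ⟨A, hA, rfl⟩ := exists_quotObj_eq M
  let R : ObjectProperty C := fun A => ∀ hA : S A,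
    free (fun Y : IdealQuot S X => IsLocalRing (End Y)) (quotObj X hA)
  refine free_induction (R := R) ?_ ?_ ?_ (hC A) hA
  · exact fun A B e h hB => free_of_iso (quotIso X (hiso e.symm hB) hB e) (h _)
  · intro A h hA
    refine free_of_isZero ((IsZero.iff_id_eq_zero _).2 ?_)
    rw [← quotMor_id, ← quotMor_zero, h.eq_of_src (𝟙 A) 0]
  · intro A B h h' hAB
    have hA := hsummand A B hAB
    have hB := hsummand B A (hiso (biprod.braiding A B) hAB)
    obtain ⟨e⟩ := nonempty_quotObj_biprod_iso (X := X) hA hB hAB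
    rcases isZero_or_isLocalRing_quotObj (X := X) hA h with h0 | hloc
    · exact free_of_iso (isoZeroBiprod h0 ≪≫ e) (h' hB)
    · exact free_of_iso e (free_biprod hloc (h' hB))

end KrullSchmidtQuotient

end Extri

namespace Extri

/-! ### The abelian case -/

namespace IsAbelianCategory

universe v w

variable {D : Type w} [Category.{v} D] [inst : Preadditive D]

lemma exists_isShortExactPair_of_epi (h : IsAbelianCategory D) {M N : D} (p : M ⟶ N) (hp : Epi p) :
    ∃ (L : D) (i : L ⟶ M), IsShortExactPair i p := by
  obtain ⟨a, rfl⟩ := h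
  exact ⟨_, _, isShortExactPair_kernel p⟩

lemma hasBinaryBiproducts (h : IsAbelianCategory D) : HasBinaryBiproducts D := by
  obtain ⟨a, rfl⟩ := h
  infer_instance

/-- In an abelian category, the kernel of a split epimorphism is a complement of its target. -/
lemma exists_biprod_iso [HasBinaryBiproducts D] (h : IsAbelianCategory D) {M N : D} {p : M ⟶ N}
    {s : N ⟶ M} (hs : s ≫ p = 𝟙 N) : ∃ K : D, Nonempty (N ⊞ K ≅ M) := by
  obtain ⟨a, rfl⟩ := h
  let r : M ⟶ kernel p := kernel.lift p (𝟙 M - p ≫ s) (by simp [hs])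
  have hr : r ≫ kernel.ι p = 𝟙 M - p ≫ s := kernel.lift_ι _ _ _
  have hsr : s ≫ r = 0 := (cancel_mono (kernel.ι p)).1 (by simp [hr, reassoc_of% hs])
  have hιr : kernel.ι p ≫ r = 𝟙 _ := (cancel_mono (kernel.ι p)).1 (by simp [hr])
  refine ⟨kernel p, ⟨⟨biprod.desc s (kernel.ι p), biprod.lift p r, ?_, ?_⟩⟩⟩
  · ext <;> simp [hs, hsr, hιr]
  · rw [biprod.lift_desc, hr]
    simp

end IsAbelianCategory

namespace Extriangulation

variable {C : Type u} [SmallCategory C] [Preadditive C] [HasZeroObject C]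
  [HasBinaryBiproducts C] {T : Extriangulation C} {X Q S : ObjectProperty C}

namespace IsRigidTriple

lemma omega_le (h : T.IsRigidTriple X Q S) (hP : T.IsProjObj ≤ X) : T.Omega X ≤ S := by
  rintro A ⟨P, W, x, y, hPP, hW, hxy⟩
  exact (h.mem_iff A).2 ⟨P, W, x, y, hP _ hPP, h.le _ hW, hxy⟩

/-- For a conflation `A ⟶ P ⟶ W` with `P` projective, `E(-, A)` is the stable representable
functor of `W`. -/
lemma nonempty_functorF_iso_rep (h : T.IsRigidTriple X Q S) {A P W : C} (hA : S A) (hP : X P)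
    (hW : Q W) {x : A ⟶ P} {y : P ⟶ W} (hPP : T.IsProjObj P) (hxy : T.IsConflation x y) :
    Nonempty (h.functorF.obj (quotObj X hA) ≅ rep (T.stableObj W hW)) := by
  obtain ⟨δ, hδ⟩ := hxy
  have hy : repMap (T.stMor (h.le _ hP) hW y) = 0 := by
    have : T.stMor (h.le _ hP) hW y = 0 := by
      rw [stMor_eq_zero_iff, ← Category.id_comp y]
      exact (isProjObj_iff_isProjMor_id.1 hPP).comp y
    rw [this, repMap_zero]
  -- the relations given by `P` are trivial
  have h2 : RightExactPair (0 : rep (T.stableObj W hW) ⟶ _) (𝟙 (rep (T.stableObj W hW))) :=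
    fun z => ⟨fun t => ⟨fun e => ⟨0, e.symm⟩, fun ⟨_, e⟩ => e.symm⟩, fun t => ⟨t, rfl⟩⟩
  exact (h.rightExactPair hA hP hW hδ).nonempty_iso h2 (by rw [hy, zero_comp]) zero_comp

variable [IsFree X]

/-- The stable category of `Q = X` has weak kernels: after an `E`-projective deflation has been
added to `f`, an `X`-precover of its kernel in `C` does. -/
lemma exists_weakKernel (h : T.IsRigidTriple X Q S) (hQ : Q ≤ X) (hpre : IsPrecoveringIn X S)
    ⦃A' B' : T.Stable Q⦄ (f' : A' ⟶ B') : ∃ (W : T.Stable Q) (k : W ⟶ A'), k ≫ f' = 0 ∧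
      ∀ ⦃V : T.Stable Q⦄ (g : V ⟶ A'), g ≫ f' = 0 → ∃ l : V ⟶ W, l ≫ k = g := by
  obtain ⟨A, hA, rfl⟩ : ∃ (A : C) (hA : Q A), A' = T.stableObj A hA := ⟨_, _, rfl⟩
  obtain ⟨B, hB, rfl⟩ : ∃ (B : C) (hB : Q B), B' = T.stableObj B hB := ⟨_, _, rfl⟩
  obtain ⟨f, rfl⟩ := stMor_surjective _ _ f'
  obtain ⟨W, p, hW, hp, hp'⟩ := h.enough B hB
  obtain ⟨M, x, δ, hδ⟩ := hp.desc f
  have hM : S M := (h.mem_iff M).2 ⟨_, _, _, _, IsFree.biprod (hQ _ hA) hW, hB, δ, hδ⟩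
  obtain ⟨V, v, hV, hv⟩ := hpre M hM
  have hx : x ≫ biprod.fst ≫ f = -(x ≫ biprod.snd ≫ p) := by
    have := hδ.comp_eq_zero
    rw [biprod.desc_eq, Preadditive.comp_add] at this
    exact eq_neg_of_add_eq_zero_left this
  refine ⟨T.stableObj V (h.le _ hV), T.stMor _ hA (v ≫ x ≫ biprod.fst), ?_, ?_⟩
  · rw [← stMor_comp, stMor_eq_zero_iff]
    have : (v ≫ x ≫ biprod.fst) ≫ f = (-(v ≫ x ≫ biprod.snd)) ≫ p := by
      simp only [Category.assoc, hx, Preadditive.comp_neg, Preadditive.neg_comp]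
    rw [this]
    exact hp'.precomp _
  · intro Z' g' hg
    obtain ⟨Z, hZ, rfl⟩ : ∃ (Z : C) (hZ : Q Z), Z' = T.stableObj Z hZ := ⟨_, _, rfl⟩
    obtain ⟨g, rfl⟩ := stMor_surjective _ _ g'
    rw [← stMor_comp, stMor_eq_zero_iff] at hg
    obtain ⟨U, u, hu⟩ := hp
    obtain ⟨l, hl⟩ := hg.exists_lift hu
    obtain ⟨t, ht⟩ := hδ.exists_lift_of_comp_eq_zero (biprod.lift g (-l)) (by simp [hl])
    obtain ⟨s, rfl⟩ := hv Z t (hQ _ hZ)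
    refine ⟨T.stMor hZ _ s, ?_⟩
    rw [← stMor_comp]
    congr 1
    simpa using congrArg (· ≫ biprod.fst) ht

/-- For `Q = X` the condition on the presentations is that they are by representable modules. -/
lemma classR_eq_fp (h : T.IsRigidTriple X Q S) (hQ : Q ≤ X) : T.classR X Q = fp := by
  obtain ⟨_, _⟩ := h.hasFiniteBiproducts_stable
  have : HasBinaryBiproducts (T.Stable Q) := hasBinaryBiproducts_of_finite_biproducts _
  have e : stableX T X Q = ⊤ := by
    ext z
    exact iff_true_intro (hQ _ z.as.property)
  rw [classR_eq_presented, e, fp_eq_presented]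

lemma fp_closed (h : T.IsRigidTriple X Q S) (hQ : Q ≤ X) (hpre : IsPrecoveringIn X S) :
    (fp (Z := T.Stable Q)).ContainsZero ∧ (fp (Z := T.Stable Q)).IsClosedUnderKernels ∧
      (fp (Z := T.Stable Q)).IsClosedUnderCokernels ∧
      (fp (Z := T.Stable Q)).IsClosedUnderFiniteProducts := by
  obtain ⟨_, _, _⟩ := h.classR_closed
  have h3 : (T.classR X Q).IsClosedUnderFiniteProducts := closedUnderFiniteProducts_of_extensions
  rw [h.classR_eq_fp hQ] at *
  obtain ⟨_, _⟩ := h.hasFiniteBiproducts_stable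
  have : HasBinaryBiproducts (T.Stable Q) := hasBinaryBiproducts_of_finite_biproducts _
  have hU := (isAdditiveClass_top (Z := T.Stable Q)).isProjectiveClass
  refine ⟨inferInstance, ?_, ?_, h3⟩
  · rw [fp_eq_presented]
    exact presented_closedUnderKernels hU
      (isCoherentClass_repClass_top (h.exists_weakKernel hQ hpre))
  · rw [fp_eq_presented]
    exact presented_closedUnderCokernels hU

lemma isAbelianCategory_fp (h : T.IsRigidTriple X Q S) (hQ : Q ≤ X)
    (hpre : IsPrecoveringIn X S) :
    IsAbelianCategory (fp (Z := T.Stable Q)).FullSubcategory := by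
  obtain ⟨_, _, _, _⟩ := h.fp_closed hQ hpre
  exact ⟨inferInstance, rfl⟩

lemma inducedPairs_fp_iff (h : T.IsRigidTriple X Q S) (hQ : Q ≤ X)
    (hpre : IsPrecoveringIn X S) ⦃L M N : (fp (Z := T.Stable Q)).FullSubcategory⦄ (i : L ⟶ M)
    (p : M ⟶ N) : inducedPairs fp i p ↔ IsShortExactPair i p := by
  obtain ⟨_, _, _, _⟩ := h.fp_closed hQ hpre
  rw [inducedPairs_eq_shortExactIn]
  exact shortExactIn_iff_isShortExactPair i p

lemma fp_functorF (h : T.IsRigidTriple X Q S) (hQ : Q ≤ X) (M : IdealQuot S X) :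
    fp (h.functorF.obj M) :=
  h.classR_eq_fp hQ ▸ h.classR_functorF M

lemma additive_isEquivalence_lift_fp (h : T.IsRigidTriple X Q S) (hQ : Q ≤ X) :
    (fp.lift h.functorF (h.fp_functorF hQ)).Additive ∧
      (fp.lift h.functorF (h.fp_functorF hQ)).IsEquivalence := by
  have key : ∀ (P : ObjectProperty (RightMod (T.Stable Q))) (_ : T.classR X Q = P)
      (hP : ∀ M, P (h.functorF.obj M)), (P.lift h.functorF hP).Additive ∧
        (P.lift h.functorF hP).IsEquivalence := by
    rintro _ rfl hP
    exact ⟨h.additive_lift, h.isEquivalence_lift⟩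
  exact key _ (h.classR_eq_fp hQ) _

lemma isAbelianCategory_idealQuot (h : T.IsRigidTriple X Q S) (hQ : Q ≤ X)
    (hpre : IsPrecoveringIn X S) : IsAbelianCategory (IdealQuot S X) := by
  obtain ⟨_, _⟩ := h.additive_isEquivalence_lift_fp hQ
  exact isAbelianCategory_of_isEquivalence (fp.lift h.functorF (h.fp_functorF hQ))
    (h.isAbelianCategory_fp hQ hpre)

lemma epsilon_iff (h : T.IsRigidTriple X Q S) (hQ : Q ≤ X) (hpre : IsPrecoveringIn X S)
    ⦃L M N : IdealQuot S X⦄ (i : L ⟶ M) (p : M ⟶ N) :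
    epsilon h.functorF i p ↔ IsShortExactPair i p := by
  obtain ⟨_, _⟩ := h.additive_isEquivalence_lift_fp hQ
  rw [isShortExactPair_iff_isKernelCokernelPair (h.isAbelianCategory_idealQuot hQ hpre),
    ← isKernelCokernelPair_map_iff (fp.lift h.functorF (h.fp_functorF hQ)),
    ← isShortExactPair_iff_isKernelCokernelPair (h.isAbelianCategory_fp hQ hpre),
    ← h.inducedPairs_fp_iff hQ hpre]
  rfl

lemma isExactEquivalence_lift_fp (h : T.IsRigidTriple X Q S) (hQ : Q ≤ X)
    (hpre : IsPrecoveringIn X S) :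
    IsExactEquivalence IsShortExactPair IsShortExactPair
      (fp.lift h.functorF (h.fp_functorF hQ)) where
  additive := (h.additive_isEquivalence_lift_fp hQ).1
  isEquivalence := (h.additive_isEquivalence_lift_fp hQ).2
  exact_iff L M N i p := by
    rw [← h.epsilon_iff hQ hpre, ← h.inducedPairs_fp_iff hQ hpre]
    rfl

/-! ### Projective objects -/

lemma epi_functorF_map (h : T.IsRigidTriple X Q S) (hQ : Q ≤ X) (hpre : IsPrecoveringIn X S)
    {M N : IdealQuot S X} (p : M ⟶ N) (hp : Epi p) : Epi (h.functorF.map p) := by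
  obtain ⟨L, i, hi⟩ :=
    (h.isAbelianCategory_idealQuot hQ hpre).exists_isShortExactPair_of_epi p hp
  rw [← h.epsilon_iff hQ hpre] at hi
  exact ((modShortExact_iff_isShortExactPair _ _).1 hi).epi

lemma projective_of_omega (h : T.IsRigidTriple X Q S) (hQ : Q ≤ X) (hpre : IsPrecoveringIn X S)
    (hP : T.IsProjObj ≤ X) {A : C} (hA : S A) (hΩ : T.Omega X A) : Projective (quotObj X hA) := by
  obtain ⟨P, W, x, y, hPP, hW, hxy⟩ := hΩ
  obtain ⟨e⟩ := h.nonempty_functorF_iso_rep hA (hP _ hPP) (h.le _ hW) hPP hxy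
  have : Projective (h.functorF.obj (quotObj X hA)) := Projective.of_iso e.symm inferInstance
  refine ⟨fun {M N} f p hp => ?_⟩
  have := h.epi_functorF_map hQ hpre p hp
  refine ⟨h.functorF.preimage (Projective.factorThru (h.functorF.map f) (h.functorF.map p)), ?_⟩
  apply h.functorF.map_injective
  rw [h.functorF.map_comp, h.functorF.map_preimage, Projective.factorThru_comp]

/-- Every object of `S/[X]` is a quotient of a syzygy. -/
lemma exists_epi_of_omega (h : T.IsRigidTriple X Q S) (hQ : Q ≤ X) (hP : T.IsProjObj ≤ X)
    (henough : T.EnoughProjObj) (M : IdealQuot S X) :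
    ∃ (A : C) (hA : S A) (p : quotObj X hA ⟶ M), T.Omega X A ∧ Epi p := by
  obtain ⟨M, hM, rfl⟩ := exists_quotObj_eq M
  obtain ⟨Y, K, x, y, hY, hK, δ, hδ⟩ := (h.mem_iff M).1 hM
  obtain ⟨P, p, hPP, A, i, hip⟩ := henough K
  have hΩ : T.Omega X A := ⟨P, K, i, p, hPP, hQ _ hK, hip⟩
  have hA := h.omega_le hP _ hΩ
  obtain ⟨e⟩ := h.nonempty_functorF_iso_rep hA (hP _ hPP) hK hPP hip
  have := (h.rightExactPair hM hY hK hδ).epi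
  have he : Epi (e.hom ≫ repDesc (h.elt hM hK δ)) := epi_comp _ _
  refine ⟨A, hA, h.functorF.preimage (e.hom ≫ repDesc (h.elt hM hK δ)), hΩ, ?_⟩
  apply h.functorF.epi_of_epi_map
  rwa [h.functorF.map_preimage]

lemma projective_iff_smd (h : T.IsRigidTriple X Q S) (hQ : Q ≤ X) (hpre : IsPrecoveringIn X S)
    (hP : T.IsProjObj ≤ X) (henough : T.EnoughProjObj) (Y : IdealQuot S X) :
    Projective Y ↔ smd (onQuot S X (T.Omega X)) Y := by
  have hab := h.isAbelianCategory_idealQuot hQ hpre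
  have := hab.hasBinaryBiproducts
  rw [smd_iff]
  constructor
  · intro hY
    obtain ⟨A, hA, p, hΩ, hp⟩ := h.exists_epi_of_omega hQ hP henough Y
    obtain ⟨K, e⟩ := hab.exists_biprod_iso (Projective.factorThru_comp (𝟙 Y) p)
    exact ⟨K, quotObj X hA, hΩ, e⟩
  · rintro ⟨B, N, hN, ⟨e⟩⟩
    have : Projective N := h.projective_of_omega hQ hpre hP N.as.property hN
    refine ⟨fun {M L} f p _ => ?_⟩
    refine ⟨biprod.inl ≫ e.hom ≫ Projective.factorThru (e.inv ≫ biprod.fst ≫ f) p, ?_⟩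
    simp

end IsRigidTriple

end Extriangulation

end Extri

namespace Extri

/-! ### Projective objects in the Krull–Schmidt case -/

/-- In a Krull–Schmidt object, a retract with local endomorphism ring has a complement. -/
lemma exists_biprod_iso_of_isIso_comp {D : Type*} [Category* D] [Preadditive D] [HasZeroObject D]
    [HasBinaryBiproducts D] {A U : D} (hA : IsLocalRing (End A))
    (hU : free (fun Y : D => IsLocalRing (End Y)) U) (i : A ⟶ U) (p : U ⟶ A)
    (hip : IsIso (i ≫ p)) : ∃ B : D, Nonempty (A ⊞ B ≅ U) := by
  let R : ObjectProperty D := fun U =>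
    ∀ (i : A ⟶ U) (p : U ⟶ A), IsIso (i ≫ p) → ∃ B : D, Nonempty (A ⊞ B ≅ U)
  refine free_induction (R := R) ?_ ?_ ?_ hU i p hip
  · intro U V e h i p hip
    obtain ⟨B, ⟨e'⟩⟩ := h (i ≫ e.inv) (e.hom ≫ p) (by simpa using hip)
    exact ⟨B, ⟨e' ≪≫ e⟩⟩
  · intro U h i p hip
    -- the object `A` is zero
    have hi : i ≫ p = 0 := by rw [h.eq_of_tgt i 0, zero_comp]
    have : 𝟙 A = 0 := by
      calc 𝟙 A = (i ≫ p) ≫ inv (i ≫ p) := (IsIso.hom_inv_id _).symm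
        _ = 0 ≫ inv (i ≫ p) := congrArg (· ≫ inv (i ≫ p)) hi
        _ = 0 := zero_comp
    exact absurd this (one_ne_zero (α := End A))
  · intro V U hV h i p hip
    have e : i ≫ p = (i ≫ biprod.fst) ≫ (biprod.inl ≫ p) + (i ≫ biprod.snd) ≫ (biprod.inr ≫ p) := by
      calc i ≫ p = i ≫ 𝟙 _ ≫ p := by rw [Category.id_comp]
        _ = _ := by
          rw [← biprod.total, Preadditive.add_comp, Preadditive.comp_add]
          simp only [Category.assoc]
    rw [e] at hip
    rcases isIso_or_isIso_of_add hA _ _ hip with h1 | h1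
    · -- the composition `V ⟶ A ⟶ V` is a unit of the local ring of endomorphisms of `V`
      set a := i ≫ biprod.fst
      set b := biprod.inl ≫ p
      let c := b ≫ inv (a ≫ b) ≫ a
      have hac : a ≫ b ≫ inv (a ≫ b) = 𝟙 A := by rw [← Category.assoc, IsIso.hom_inv_id]
      have hc : c ≫ c = c := by simp [c, reassoc_of% hac]
      have hc' : IsIso c := by
        rcases isIso_or_isIso_of_add hV c (𝟙 V - c) (by rw [add_sub_cancel]; infer_instance) with
          h2 | h2
        · exact h2
        · have : c = 0 := by
            rw [← cancel_mono (𝟙 V - c), Preadditive.comp_sub, hc, Category.comp_id, sub_self,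
              zero_comp]
          have h3 : 𝟙 A = 0 := by
            calc 𝟙 A = a ≫ c ≫ b ≫ inv (a ≫ b) := by simp [c, hac]
              _ = 0 := by rw [this, zero_comp, comp_zero]
          exact absurd h3 (one_ne_zero (α := End A))
      have hc1 : c = 𝟙 V := by rw [← cancel_mono c, hc, Category.id_comp]
      refine ⟨U, ⟨biprod.mapIso ⟨a, b ≫ inv (a ≫ b), hac, ?_⟩ (Iso.refl U)⟩⟩
      simpa [c] using hc1
    · obtain ⟨B, ⟨e'⟩⟩ := h _ _ h1
      exact ⟨V ⊞ B, ⟨(biprod.associator A V B).symm ≪≫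
        biprod.mapIso (biprod.braiding A V) (Iso.refl B) ≪≫ biprod.associator V A B ≪≫
        biprod.mapIso (Iso.refl V) e'⟩⟩

namespace Extriangulation

variable {C : Type u} [SmallCategory C] [Preadditive C] [HasZeroObject C]
  [HasBinaryBiproducts C] {T : Extriangulation C} {X Q S : ObjectProperty C}

lemma IsProjObj.biprod {P P' : C} (hP : T.IsProjObj P) (hP' : T.IsProjObj P') :
    T.IsProjObj (P ⊞ P') := by
  intro A B D x y h f
  obtain ⟨g, hg⟩ := hP x y h (biprod.inl ≫ f)
  obtain ⟨g', hg'⟩ := hP' x y h (biprod.inr ≫ f)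
  exact ⟨biprod.desc g g', by ext <;> simp [hg, hg']⟩

open ZeroObject in
lemma isProjObj_zero : T.IsProjObj (0 : C) := fun _ _ _ _ _ _ _ =>
  ⟨0, (isZero_zero C).eq_of_src _ _⟩

lemma Omega.of_iso {A B : C} (e : A ≅ B) (h : T.Omega X A) : T.Omega X B := by
  obtain ⟨P, W, x, y, hP, hW, hxy⟩ := h
  exact ⟨P, W, _, _, hP, hW, hxy.transport e (Iso.refl W)⟩

variable [IsFree X]

lemma Omega.biprod {A B : C} (hA : T.Omega X A) (hB : T.Omega X B) : T.Omega X (A ⊞ B) := by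
  obtain ⟨P, W, x, y, hP, hW, hxy⟩ := hA
  obtain ⟨P', W', x', y', hP', hW', hxy'⟩ := hB
  exact ⟨_, _, _, _, hP.biprod hP', IsFree.biprod hW hW', hxy.biprod hxy'⟩

open ZeroObject in
lemma omega_zero : T.Omega X (0 : C) :=
  ⟨0, 0, _, _, isProjObj_zero, IsFree.zero, isConflation_id_zero 0⟩

namespace IsRigidTriple

/-- Syzygies inherit closure under direct summands from `X`. -/
lemma omega_of_biprod (h : T.IsRigidTriple X Q S) (hX : smd X = X) (hP : T.IsProjObj ≤ X)
    {A B : C} (hAB : T.Omega X (A ⊞ B)) : T.Omega X A := by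
  obtain ⟨P, W, x, y, hPP, hW, hxy⟩ := hAB
  obtain ⟨K₁, K₂, y₁, y₂, u, v, h₁, -, huv⟩ := hxy.exists_of_biprod
  have hXP : X (P ⊞ P) := IsFree.biprod (hP _ hPP) (hP _ hPP)
  obtain ⟨e⟩ := huv.nonempty_biprod_iso (fun ω => h.eq_zero (h.le _ hW) hXP ω)
  refine ⟨P, K₁, _, y₁, hPP, ?_, h₁⟩
  rw [← hX]
  exact smd_iff.2 ⟨K₂ ⊞ P, _, IsFree.biprod hXP hW,
    ⟨(e ≪≫ biprod.associator K₁ K₂ P).symm⟩⟩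

/-- An object with local endomorphism ring which becomes a retract of a syzygy in `S/[X]` is a
syzygy in `C`, or zero in `S/[X]`. -/
lemma isZero_or_omega (h : T.IsRigidTriple X Q S) (hX : smd X = X) (hP : T.IsProjObj ≤ X)
    (hC : IsKrullSchmidt C) {A U : C} (hS : S A) (hA : IsLocalRing (End A)) (hU : S U)
    (hΩ : T.Omega X U) (i : quotObj X hS ⟶ quotObj X hU) (p : quotObj X hU ⟶ quotObj X hS)
    (hip : i ≫ p = 𝟙 _) : IsZero (quotObj X hS) ∨ T.Omega X A := by
  obtain ⟨i, rfl⟩ := quotMor_surjective _ _ i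
  obtain ⟨p, rfl⟩ := quotMor_surjective _ _ p
  rw [← quotMor_comp, ← quotMor_id] at hip
  rcases isIso_or_isIso_of_add hA (𝟙 A - i ≫ p) (i ≫ p)
    (by rw [sub_add_cancel]; infer_instance) with h1 | h1
  · left
    have h0 : quotMor X hS hS (𝟙 A - i ≫ p) = 0 := by rw [quotMor_sub, hip, sub_self]
    rw [IsZero.iff_id_eq_zero, ← quotMor_id, ← IsIso.hom_inv_id (𝟙 A - i ≫ p),
      quotMor_comp hS hS hS, h0, zero_comp]
  · right
    obtain ⟨B, ⟨e⟩⟩ := exists_biprod_iso_of_isIso_comp hA (hC U) i p h1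
    exact h.omega_of_biprod hX hP (hΩ.of_iso e.symm)

lemma projective_iff_exists_iso (h : T.IsRigidTriple X Q S) (hQ : Q ≤ X)
    (hpre : IsPrecoveringIn X S) (hP : T.IsProjObj ≤ X) (henough : T.EnoughProjObj)
    (hiso : ∀ {A B : C}, (A ≅ B) → S A → S B) (hsummand : ∀ A B, S (A ⊞ B) → S A)
    (hC : IsKrullSchmidt C) (hX : smd X = X) (Y : IdealQuot S X) :
    Projective Y ↔
      ∃ Y' : IdealQuot S X, onQuot S X (T.Omega X) Y' ∧ Nonempty (Y ≅ Y') := by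
  have := (h.isAbelianCategory_idealQuot hQ hpre).hasBinaryBiproducts
  constructor
  · intro hY
    obtain ⟨U, hU, p, hΩ, hp⟩ := h.exists_epi_of_omega hQ hP henough Y
    obtain ⟨A, hA, rfl⟩ := exists_quotObj_eq Y
    -- the statement for the retracts of the syzygy `U`, by induction on the number of summands
    let R : ObjectProperty C := fun A => ∀ (hA : S A) (i : quotObj X hA ⟶ quotObj X hU)
      (p : quotObj X hU ⟶ quotObj X hA), i ≫ p = 𝟙 _ →
        ∃ (A' : C) (hA' : S A'), T.Omega X A' ∧ Nonempty (quotObj X hA ≅ quotObj X hA')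
    suffices hR : R A by
      obtain ⟨A', hA', hΩ', e⟩ := hR hA (Projective.factorThru (𝟙 _) p) p
        (Projective.factorThru_comp _ _)
      exact ⟨quotObj X hA', hΩ', e⟩
    refine free_induction (R := R) ?_ ?_ ?_ (hC A)
    · intro A B e hR hB i p hip
      have hA := hiso e.symm hB
      let e' := quotIso X hA hB e
      obtain ⟨A', hA', hΩ', ⟨e''⟩⟩ := hR hA (e'.hom ≫ i) (p ≫ e'.inv)
        (by simp [reassoc_of% hip])
      exact ⟨A', hA', hΩ', ⟨e'.symm ≪≫ e''⟩⟩
    · intro A hA0 hA _ _ _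
      exact ⟨A, hA, omega_zero.of_iso ((isZero_zero C).iso hA0), ⟨Iso.refl _⟩⟩
    · intro A B hloc hR hAB i p hip
      have hA := hsummand A B hAB
      have hB := hsummand B A (hiso (biprod.braiding A B) hAB)
      obtain ⟨e⟩ := nonempty_quotObj_biprod_iso (X := X) hA hB hAB
      have hip' : (e.hom ≫ i) ≫ p ≫ e.inv = 𝟙 _ := by simp [reassoc_of% hip]
      obtain ⟨B', hB', hΩ', ⟨e'⟩⟩ := hR hB (biprod.inr ≫ e.hom ≫ i) (p ≫ e.inv ≫ biprod.snd)
        (by simp [reassoc_of% hip])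
      rcases h.isZero_or_omega hX hP hC hA hloc hU hΩ (biprod.inl ≫ e.hom ≫ i)
        (p ≫ e.inv ≫ biprod.fst) (by simp [reassoc_of% hip]) with h0 | hΩA
      · exact ⟨B', hB', hΩ', ⟨e.symm ≪≫ (isoZeroBiprod h0).symm ≪≫ e'⟩⟩
      · have hAB' := h.biprod_right _ _ hA hB'
        obtain ⟨e''⟩ := nonempty_quotObj_biprod_iso (X := X) hA hB' hAB'
        exact ⟨A ⊞ B', hAB', hΩA.biprod hΩ',
          ⟨e.symm ≪≫ biprod.mapIso (Iso.refl _) e' ≪≫ e''⟩⟩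
  · rintro ⟨Y', hΩ, ⟨e⟩⟩
    have : Projective Y' := h.projective_of_omega hQ hpre hP Y'.as.property hΩ
    exact Projective.of_iso e.symm this

end IsRigidTriple

end Extriangulation

end Extri

theorem mainTheorem4 {C : Type u} [SmallCategory C] [Preadditive C] [HasZeroObject C]
    [HasBinaryBiproducts C] (T : Extriangulation C) (Ex : ℕ → Cᵒᵖ ⥤ C ⥤ AddCommGrpCat.{u})
    (hEx : T.IsHigherExtFamily Ex) (n : ℕ) (X : ObjectProperty C) [IsFree X]
    (hrigid : IsRigid Ex n X) (hproj : T.EnoughProjMor (T.Cores X n) X) :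
    ∃ F : IdealQuot (T.Cores X (n + 1)) X ⥤ RightMod (T.Stable (T.Cores X n)),
      CategoryTheory.Quotient.functor (idealRel (T.Cores X (n + 1)) X) ⋙ F =
        T.functorH (T.Cores X (n + 1)) (T.Cores X n) ∧
      -- (a)
      (∃ hR : ∀ M, T.classR X (T.Cores X n) (F.obj M),
        ClosedUnderExtensions (T.classR X (T.Cores X n)) ∧
        IsExactCategory (inducedPairs (T.classR X (T.Cores X n))) ∧
        IsExactCategory (epsilon F) ∧
        IsExactEquivalence (epsilon F) (inducedPairs (T.classR X (T.Cores X n)))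
          ((T.classR X (T.Cores X n)).lift F hR)) ∧
      -- (a1), (a2)
      (smd X = X →
        (T.EnoughDeflations (T.Cores X (n + 1)) X →
          IsWeaklyIdempotentComplete (IdealQuot (T.Cores X (n + 1)) X)) ∧
        (IsKrullSchmidt C → IsKrullSchmidt (IdealQuot (T.Cores X (n + 1)) X))) ∧
      -- (b)
      (T.Cores X n = X → IsPrecoveringIn X (T.Cores X (n + 1)) →
        -- (b1)
        (IsAbelianCategory (IdealQuot (T.Cores X (n + 1)) X) ∧
          (∀ ⦃L M N : IdealQuot (T.Cores X (n + 1)) X⦄ (i : L ⟶ M) (p : M ⟶ N),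
            epsilon F i p ↔ IsShortExactPair i p) ∧
          IsAbelianCategory (fp (Z := T.Stable (T.Cores X n))).FullSubcategory ∧
          (∀ ⦃L M N : (fp (Z := T.Stable (T.Cores X n))).FullSubcategory⦄ (i : L ⟶ M) (p : M ⟶ N),
            inducedPairs fp i p ↔ IsShortExactPair i p) ∧
          ∃ hfp : ∀ M, fp (F.obj M),
            IsExactEquivalence IsShortExactPair IsShortExactPair (fp.lift F hfp)) ∧
        -- (b2)
        (T.EnoughProjObj → T.IsProjObj ≤ X →
          T.Omega X ≤ T.Cores X (n + 1) ∧
          (∀ Y : IdealQuot (T.Cores X (n + 1)) X,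
            Projective Y ↔ smd (onQuot (T.Cores X (n + 1)) X (T.Omega X)) Y) ∧
          (IsKrullSchmidt C → smd X = X →
            ∀ Y : IdealQuot (T.Cores X (n + 1)) X,
              Projective Y ↔
                ∃ Y' : IdealQuot (T.Cores X (n + 1)) X,
                  onQuot (T.Cores X (n + 1)) X (T.Omega X) Y' ∧ Nonempty (Y ≅ Y')))) := by
  have h := Extriangulation.isRigidTriple_cores hEx hrigid hproj
  have hiso : ∀ {A B : C}, (A ≅ B) → T.Cores X (n + 1) A → T.Cores X (n + 1) B :=
    fun e => Extriangulation.Cores.of_iso e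
  have hsummand : smd X = X → ∀ A B, T.Cores X (n + 1) (A ⊞ B) → T.Cores X (n + 1) A :=
    fun hX A B hAB => Extriangulation.cores_of_biprod hX h.eq_zero (n + 1) le_rfl hAB
  have : HasFiniteBiproducts (IdealQuot (T.Cores X (n + 1)) X) :=
    h.isExactCategory_epsilon.additive
  have : HasBinaryBiproducts (IdealQuot (T.Cores X (n + 1)) X) :=
    hasBinaryBiproducts_of_finite_biproducts _
  refine ⟨h.functorF, h.functor_comp_functorF, ⟨h.classR_functorF,
    h.closedUnderExtensions_classR, h.isExactCategory_inducedPairs, h.isExactCategory_epsilon,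
    h.isExactEquivalence_lift⟩, fun hX => ⟨fun hdefl => ?_, fun hC => ?_⟩, fun hQ hpre => ?_⟩
  · exact Extriangulation.isWeaklyIdempotentComplete_idealQuot h.le_right h.biprod_right hiso
      (hsummand hX) hdefl
  · exact isKrullSchmidt_idealQuot hiso (hsummand hX) hC
  · have hQ' : T.Cores X n ≤ X := hQ.le
    refine ⟨⟨h.isAbelianCategory_idealQuot hQ' hpre, h.epsilon_iff hQ' hpre,
      h.isAbelianCategory_fp hQ' hpre, h.inducedPairs_fp_iff hQ' hpre, h.fp_functorF hQ',
      h.isExactEquivalence_lift_fp hQ' hpre⟩, fun henough hP => ⟨h.omega_le hP,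
      h.projective_iff_smd hQ' hpre hP henough, fun hC hX =>
        h.projective_iff_exists_iso hQ' hpre hP henough hiso (hsummand hX) hC hX⟩⟩
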